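/- Let $\rho$ be an even probability density on $\mathbb R$ with $\int x^2\rho(x)\,dx=1$ and $\int\rho(x)^{1+\epsilon}dx<\infty$ for some $\epsilon>0$, whose Fourier transform $\hat\rho(f)=\int e^{2\pi i f x}\rho(x)\,dx$ is analytic in a neighborhood of zero, and let $F=-\log\hat\rho$ near zero, with $F(0)=0$. Let $X_1,\dots,X_n$ be independent with density $\rho$. For $\sigma\in\{-1,+1\}^n$ let $E(\sigma)=n^{-1/2}\bigl|\sum_{i}\sigma_iX_i\bigr|$, and let $g_n$ be the density on $[0,\infty)$ of $E(\sigma)$ (which does not depend on $\sigma$), namely the right derivative of its distribution function. Let $\alpha_n\ge 0$ and $\lambda_n\ge 0$ be sequences with $\alpha_n=o(\sqrt n)$ and $\lambda_n=o(\sqrt n)$, and put $\xi_n=1/(2^{n-1}g_n(\alpha_n))$. Let $0\le c_\ell<d_\ell$ for $\ell=1,\dots,m$, $\gamma_\ell=d_\ell-c_\ell$, $a_n^\ell=\alpha_n+c_\ell\xi_n$ and $b_n^\ell=\alpha_n+d_\ell\xi_n$, and let $\ell(1),\dots,\ell(k)\in\{1,\dots,m\}$ be fixed, where each value $\ell$ is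 taken $k_\ell$ times, so that $k=\sum_\ell k_\ell$. For $\sigma^{(1)},\dots,\sigma^{(k)}\in\{-1,+1\}^n$ and $\delta\in\{-1,+1\}^k$ let $n_\delta=|\{s\le n:(\sigma_s^{(1)},\dots,\sigma_s^{(k)})=\delta\}|$, and let $q_{\max}=\max_{i\ne j}\bigl|\frac1n\sum_s\sigma^{(i)}_s\sigma^{(j)}_s\bigr|$ (which is $0$ if $k\le1$). The family is called balanced if $\max_\delta|n_\delta-n2^{-k}|\le\sqrt n\,\lambda_n$. All error terms below are uniform over the balanced families. (1) There is $r>0$ such that for all sufficiently large $n$, for every balanced family and every $x=\frac{\alpha_n}{\sqrt n}s$ with $s\in\{-1,+1\}^k$, the system $$\sum_{\delta}\frac{n_\delta}{n}\,\delta_jF'(i\,\delta\cdot\eta)=2\pi i\,x_j\qquad(j=1,\dots,k)$$ has exactly one solution $\eta=\eta(x)\in\mathbb R^k$ with $\max_j|\eta_j|<r$, the number $$G_{n,k}(x)=\sum_\delta\frac{n_\delta}{n}F(i\,\delta\cdot\eta(x))+2\pi\,\eta(x)\cdot x$$ is real, and $$\mathbb P\bigl(E(\sigma^{(j)})\in[a_n^{\ell(j)},b_n^{\ell(j)}]\text{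 for }j=1,\dots,k\bigr)=\Bigl(\prod_{\ell=1}^m\gamma_\ell^{k_\ell}\Bigr)\Bigl(\frac{\xi_n}{\sqrt{2\pi}}\Bigr)^k\sum_{s\in\{-1,+1\}^k}e^{-nG_{n,k}(\alpha_ns/\sqrt n)}\,(1+o(1)).$$ (2) If moreover $\alpha_n=o(n^{1/4})$, then for all sufficiently large $n$ and every balanced family $$\mathbb P\bigl(E(\sigma^{(j)})\in[a_n^{\ell(j)},b_n^{\ell(j)}]\text{ for }j=1,\dots,k\bigr)=\prod_{j=1}^k\mathbb P\bigl(E(\sigma^{(j)})\in[a_n^{\ell(j)},b_n^{\ell(j)}]\bigr)\;e^{O(\alpha_n^2q_{\max})+o(1)}.$$ -/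

import Mathlib

open MeasureTheory Filter Topology Asymptotics

namespace NPP

noncomputable section

/-- The Fourier transform `ρ̂(z) = ∫ e^{2πizx} ρ(x) dx`, at a real or complex argument `z`. -/
def fourier (ρ : ℝ → ℝ) (z : ℂ) : ℂ :=
  ∫ x : ℝ, Complex.exp (2 * Real.pi * Complex.I * z * x) * (ρ x : ℂ)

/-- The standing assumptions on the density: `ρ` is an even probability density on `ℝ` with second
moment one, `∫ |ρ|^{1+ε} < ∞` for some `ε > 0`, and its Fourier transform, as a function on the
real line, is analytic in a neighborhood of zero. -/
structure IsAdmissible (ρ : ℝ → ℝ) : Prop where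
  measurable : Measurable ρ
  nonneg : ∀ x, 0 ≤ ρ x
  integral_eq_one : ∫ x, ρ x = 1
  even : ∀ x, ρ (-x) = ρ x
  second_moment : ∫ x, x ^ 2 * ρ x = 1
  integrable_rpow : ∃ ε : ℝ, 0 < ε ∧ Integrable (fun x => |ρ x| ^ (1 + ε))
  analytic : AnalyticAt ℝ (fun f : ℝ => fourier ρ (f : ℂ)) 0

/-- The joint law of `n` independent random variables `X_1, …, X_n` with density `ρ`. -/
def law (ρ : ℝ → ℝ) (n : ℕ) : Measure (Fin n → ℝ) :=
  Measure.pi fun _ => volume.withDensity fun x => ENNReal.ofReal (ρ x)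

/-- A spin `±1` (an element of `ℤˣ`) as a real number. -/
def spin (s : ℤˣ) : ℝ := ((s : ℤ) : ℝ)

/-- The energy `E(σ) = n^{-1/2} |∑ σ_i X_i|` of a spin configuration `σ ∈ {-1,+1}^n`. -/
def energy {n : ℕ} (σ : Fin n → ℤˣ) (X : Fin n → ℝ) : ℝ :=
  |∑ i, spin (σ i) * X i| / √n

/-- The density `g_n(y)`, `y ≥ 0`, of the energy `E(σ)` with respect to Lebesgue measure on
`[0,∞)`: the right derivative at `y` of the distribution function of `E(σ)`. For an even `ρ` the
law of `E(σ)` is the same for all `σ`, so that `σ = (1,…,1)` is taken here. -/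
def energyDensity (ρ : ℝ → ℝ) (n : ℕ) (y : ℝ) : ℝ :=
  derivWithin (fun t => (law ρ n).real {X | energy (1 : Fin n → ℤˣ) X ≤ t}) (Set.Ici y) y

/-- The scaling factor `ξ_n = 1 / (2^{n-1} g_n(α_n))`. -/
def xi (ρ : ℝ → ℝ) (α : ℕ → ℝ) (n : ℕ) : ℝ :=
  1 / (2 ^ (n - 1) * energyDensity ρ n (α n))

/-- The energy interval `[α_n + c ξ_n, α_n + d ξ_n]`. -/
def window (ρ : ℝ → ℝ) (α : ℕ → ℝ) (n : ℕ) (c d : ℝ) : Set ℝ :=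
  Set.Icc (α n + c * xi ρ α n) (α n + d * xi ρ α n)

/-- `n_δ(σ^{(1)},…,σ^{(k)})`: the number of sites at which the spins of the `k` configurations
form the vector `δ`. -/
def patternCount {k n : ℕ} (σ : Fin k → Fin n → ℤˣ) (δ : Fin k → ℤˣ) : ℕ :=
  Fintype.card {s : Fin n // ∀ i, σ i s = δ i}

/-- The balance condition `max_δ |n_δ - n 2^{-k}| ≤ √n · lam`. -/
def Balanced {k n : ℕ} (lam : ℝ) (σ : Fin k → Fin n → ℤˣ) : Prop :=
  ∀ δ : Fin k → ℤˣ, |(patternCount σ δ : ℝ) - n / 2 ^ k| ≤ √n * lam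

/-- The overlap `q(σ,τ) = n^{-1} ∑ σ_i τ_i`. -/
def overlap {n : ℕ} (σ τ : Fin n → ℤˣ) : ℝ :=
  (∑ i, spin (σ i) * spin (τ i)) / n

/-- The maximal off-diagonal overlap (it is `0` if `k ≤ 1`, where there are no pairs `i ≠ j`). -/
def qMax {k n : ℕ} (σ : Fin k → Fin n → ℤˣ) : ℝ :=
  ⨆ p : {p : Fin k × Fin k // p.1 ≠ p.2}, |overlap (σ p.1.1) (σ p.1.2)|

/-- The function `F` with `ρ̂ = e^{-F}` near zero, `F(0) = 0`. -/
def F (ρ : ℝ → ℝ) (z : ℂ) : ℂ := -Complex.log (fourier ρ z)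

/-- The scalar product `δ · η` of a spin vector and a real vector. -/
def dot {k : ℕ} (δ : Fin k → ℤˣ) (η : Fin k → ℝ) : ℝ := ∑ j, spin (δ j) * η j

/-- The saddle point equations `∑_δ (n_δ/n) δ_j F'(i δ·η) = 2πi x_j`, `j = 1,…,k`, for `η`. -/
def IsSaddlePoint (ρ : ℝ → ℝ) {k n : ℕ} (σ : Fin k → Fin n → ℤˣ) (x η : Fin k → ℝ) : Prop :=
  ∀ j, ∑ δ : Fin k → ℤˣ, ((patternCount σ δ : ℂ) / n) * (spin (δ j) : ℂ) *
      deriv (F ρ) (Complex.I * (dot δ η : ℂ)) = 2 * Real.pi * Complex.I * (x j : ℂ)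

/-- The exponent `∑_δ (n_δ/n) F(i δ·η) + 2π η·x`. Its value at the saddle point `η = η(x)` is
`G_{n,k}(x)`. -/
def action (ρ : ℝ → ℝ) {k n : ℕ} (σ : Fin k → Fin n → ℤˣ) (x η : Fin k → ℝ) : ℂ :=
  ∑ δ : Fin k → ℤˣ, ((patternCount σ δ : ℂ) / n) * F ρ (Complex.I * (dot δ η : ℂ))
    + 2 * Real.pi * ((∑ j, η j * x j : ℝ) : ℂ)

/-- The point `x ∈ {-α_n/√n, α_n/√n}^k` with the signs `s`. -/
def corner {k : ℕ} (α : ℕ → ℝ) (n : ℕ) (s : Fin k → ℤˣ) : Fin k → ℝ :=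
  fun j => spin (s j) * (α n / √n)

end

end NPP

/-! The proof is a Cramér tilt combined with a local limit theorem that is uniform over the balanced
families. Write K for the cumulant generating function of the density and v_s for the vector of the
k spins at site s. The vector Y = n^{-1/2} ∑_s X_s v_s of signed energies is a sum of independent
terms. Tilting it by exp(√n θ·y) tilts each X_s by v_s·θ. If θ solves the saddle point equation
n^{-1} ∑_s v_s K'(v_s·θ) = x with x = α_n s/√n, the tilted law has mean exactly α_n s.

Balance makes all overlaps tend to 0, so the tilted covariance tends to the identity and the tilted
density near its mean tends to (2π)^{-k/2} (`LocalRegime.tendsto_density`). Undoing the tilt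
multiplies by e^{-nG}, where G = θ·x - n^{-1} ∑_s K(v_s·θ) and θ = 2πη. The windows are so short
that √n ξ_n → 0, so this factor is constant on each of the 2^k boxes making up the event
(`UniformRegime.sumLaw_signBox`, `UniformRegime.energy_mem`). This gives part (1).

The analytic input is this. Real analyticity of the Fourier transform at 0 forces exponential
moments (`zero_mem_interior_integrableExpSet_of_analyticAt_charFun`). The density hypothesis gives
decay of the tilted characteristic functions away from 0 (`IsAdmissible.norm_tiltedCharFun_le`). The
L^{1+ε} hypothesis gives them a uniform L^N bound
(`IsAdmissible.exists_lintegral_tiltedCharFun_pow_le`), so that Fourier inversion applies to the sum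
and the far tail of the inversion integral is negligible. Unique solvability of the saddle point
equation is a contraction argument, because the gradient map is close to the identity
(`IsAdmissible.exists_saddle`).

For part (2), evenness kills the cubic term of K, so nG = kα_n²/2 + O(α_n² q_max + α_n⁴/n), and the
last term vanishes when α_n = o(n^{1/4}). Comparing logarithms for the whole family with those for
single configurations, which have no overlaps, gives the factorization
(`UniformRegime.log_energy_mem`). -/

namespace NPP

open ProbabilityTheory

/-! ### Exponential moments from real analyticity of the characteristic function. -/

section Moments

variable {μ : Measure ℝ}

theorem memLp_id_of_integrable_even_pow {m : ℕ} (h : Integrable (fun x : ℝ => x ^ (2 * m)) μ) :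
    MemLp id ((2 * m : ℕ) : ENNReal) μ := by
  rcases Nat.eq_zero_or_pos m with rfl | hm
  · simpa using (by fun_prop : AEStronglyMeasurable (id : ℝ → ℝ) μ)
  rw [← integrable_norm_rpow_iff (by fun_prop) (by simp; omega)
    (ENNReal.natCast_ne_top _)]
  refine h.congr (ae_of_all _ fun x => ?_)
  beta_reduce
  rw [ENNReal.toReal_natCast, Real.rpow_natCast]
  simp [pow_mul]

variable [IsFiniteMeasure μ]

/-- Differentiating 2m times brings down x^{2m} up to sign, and the symmetric second difference
turns e^{itx} into a nonnegative real integrand, to which Fatou's lemma can be applied. -/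
theorem integral_pow_mul_two_sub_two_mul_cos {m : ℕ} (hint : MemLp id ((2 * m : ℕ) : ENNReal) μ)
    (t : ℝ) :
    ∫ x, x ^ (2 * m) * (2 - 2 * Real.cos (t * x)) ∂μ =
      ((-1) ^ m * (2 * iteratedDeriv (2 * m) (charFun μ) 0
        - iteratedDeriv (2 * m) (charFun μ) t - iteratedDeriv (2 * m) (charFun μ) (-t))).re := by
  have hi : Integrable (fun x : ℝ => x ^ (2 * m)) μ := by
    have := hint.integrable_norm_pow'
    refine this.congr (ae_of_all _ fun x => ?_)
    simp [pow_mul]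
  have hic (s : ℝ) : Integrable (fun x : ℝ => (x : ℂ) ^ (2 * m) * Complex.exp (s * x * Complex.I)) μ := by
    refine (hi.ofReal (𝕜 := ℂ)).mono (by fun_prop) (ae_of_all _ fun x => ?_)
    have : ‖Complex.exp (s * x * Complex.I)‖ = 1 := by
      exact_mod_cast Complex.norm_exp_ofReal_mul_I (s * x)
    simp [this]
  have hI : (-1 : ℂ) ^ m * Complex.I ^ (2 * m) = 1 := by
    rw [pow_mul, Complex.I_sq, ← mul_pow]; simp
  have key (s : ℝ) : (-1 : ℂ) ^ m * iteratedDeriv (2 * m) (charFun μ) s =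
      ∫ x, (x : ℂ) ^ (2 * m) * Complex.exp (s * x * Complex.I) ∂μ := by
    rw [iteratedDeriv_charFun hint, ← mul_assoc, hI, one_mul]
  have i1 : Integrable (fun x : ℝ => 2 * ((x : ℂ) ^ (2 * m) * Complex.exp ((0 : ℝ) * x * Complex.I))
        - (x : ℂ) ^ (2 * m) * Complex.exp (t * x * Complex.I)) μ := ((hic 0).const_mul 2).sub (hic t)
  have i2 : Integrable (fun x : ℝ => 2 * ((x : ℂ) ^ (2 * m) * Complex.exp ((0 : ℝ) * x * Complex.I))
        - (x : ℂ) ^ (2 * m) * Complex.exp (t * x * Complex.I)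
        - (x : ℂ) ^ (2 * m) * Complex.exp ((-t : ℝ) * x * Complex.I)) μ := i1.sub (hic (-t))
  have e1 : (-1 : ℂ) ^ m * (2 * iteratedDeriv (2 * m) (charFun μ) 0
        - iteratedDeriv (2 * m) (charFun μ) t - iteratedDeriv (2 * m) (charFun μ) (-t)) =
      ∫ x : ℝ, (2 * ((x : ℂ) ^ (2 * m) * Complex.exp ((0 : ℝ) * x * Complex.I))
        - (x : ℂ) ^ (2 * m) * Complex.exp (t * x * Complex.I)
        - (x : ℂ) ^ (2 * m) * Complex.exp ((-t : ℝ) * x * Complex.I)) ∂μ := by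
    rw [integral_sub i1 (hic (-t)), integral_sub ((hic 0).const_mul 2) (hic t),
      integral_const_mul, ← key, ← key, ← key]
    ring
  rw [e1, ← Complex.reCLM_apply, ← ContinuousLinearMap.integral_comp_comm _ i2]
  refine integral_congr_ae (ae_of_all _ fun x => ?_)
  have h2 : (2 * ((x : ℂ) ^ (2 * m) * Complex.exp ((0 : ℝ) * x * Complex.I))
        - (x : ℂ) ^ (2 * m) * Complex.exp (t * x * Complex.I)
        - (x : ℂ) ^ (2 * m) * Complex.exp ((-t : ℝ) * x * Complex.I)) =
      ((x ^ (2 * m) * (2 - 2 * Real.cos (t * x)) : ℝ) : ℂ) := by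
    push_cast
    rw [Complex.cos]
    simp
    ring
  simp only [Complex.reCLM_apply]
  rw [h2, Complex.ofReal_re]

/-- The constant terms of the Taylor expansion cancel, and the linear ones cancel because they are
odd. -/
theorem AnalyticAt.second_difference_isBigO {f : ℝ → ℂ} (hf : AnalyticAt ℝ f 0) :
    (fun t => 2 * f 0 - f t - f (-t)) =O[𝓝 0] fun t => t ^ 2 := by
  obtain ⟨p, hp⟩ := hf
  have h1 := hp.isBigO_sub_partialSum_pow 2
  have h2 : (fun y => f (-y) - p.partialSum 2 (-y)) =O[𝓝 0] fun y : ℝ => ‖-y‖ ^ 2 := by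
    have : Tendsto (fun y : ℝ => -y) (𝓝 0) (𝓝 0) := by
      simpa using (continuous_neg (G := ℝ)).tendsto 0
    simpa [Function.comp_def] using h1.comp_tendsto this
  have h3 := (h1.add (h2.congr_right (by simp))).neg_left
  refine h3.congr (fun t => ?_) (fun t => by simp)
  have c0 : p 0 (fun _ => t) = f 0 := hp.coeff_zero _
  have c0' : p 0 (fun _ => -t) = f 0 := hp.coeff_zero _
  have c1 : p 1 (fun _ => -t) = - p 1 (fun _ => t) := by
    rw [p.apply_eq_pow_smul_coeff, p.apply_eq_pow_smul_coeff]
    simp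
  simp only [FormalMultilinearSeries.partialSum, Finset.sum_range_succ, Finset.sum_range_zero,
    zero_add, c0, c0', c1]
  ring

/-- Fatou's lemma along t = 1/(n+1): the integrands x^{2m}(2 - 2cos(tx))/t² tend to x^{2m+2}, and
their integrals are second differences of an analytic function divided by t², hence bounded. -/
theorem integrable_even_pow_succ_of_analyticAt_charFun {m : ℕ}
    (hint : MemLp id ((2 * m : ℕ) : ENNReal) μ) (ha : AnalyticAt ℝ (charFun μ) 0) :
    Integrable (fun x : ℝ => x ^ (2 * (m + 1))) μ := by
  have hd : AnalyticAt ℝ (iteratedDeriv (2 * m) (charFun μ)) 0 := by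
    rw [iteratedDeriv_eq_iterate]
    exact AnalyticAt.iterated_deriv ha _
  have hb := AnalyticAt.second_difference_isBigO hd
  obtain ⟨C, hC⟩ := hb.bound
  have hs : Tendsto (fun n : ℕ => 1 / ((n : ℝ) + 1)) atTop (𝓝 0) :=
    tendsto_one_div_add_atTop_nhds_zero_nat
  have hC' := hs.eventually hC
  have hnn (n : ℕ) (x : ℝ) :
      0 ≤ x ^ (2 * m) * (2 - 2 * Real.cos (1 / ((n : ℝ) + 1) * x)) * ((n : ℝ) + 1) ^ 2 := by
    have := Real.cos_le_one (1 / ((n : ℝ) + 1) * x)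
    have h2 : 0 ≤ x ^ (2 * m) := by rw [pow_mul]; positivity
    have h3 : 0 ≤ 2 - 2 * Real.cos (1 / ((n : ℝ) + 1) * x) := by linarith
    positivity
  have hi : Integrable (fun x : ℝ => x ^ (2 * m)) μ := by
    have := hint.integrable_norm_pow'
    refine this.congr (ae_of_all _ fun x => ?_)
    simp [pow_mul]
  refine integrable_of_tendsto (G := fun n x =>
    x ^ (2 * m) * (2 - 2 * Real.cos (1 / ((n : ℝ) + 1) * x)) * ((n : ℝ) + 1) ^ 2)
    (ae_of_all _ fun x => ?_) (fun n => by fun_prop) ?_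
  · have hlim : Tendsto (fun u : ℝ => (2 - 2 * Real.cos (u * x)) / u ^ 2) (𝓝[≠] 0) (𝓝 (x ^ 2)) := by
      have hcos : (fun u : ℝ => Real.cos u - (1 - u ^ 2 / 2)) =O[𝓝 0] fun u => u ^ 4 := by
        refine IsBigO.of_bound (5 / 96) ?_
        have : ∀ᶠ u : ℝ in 𝓝 0, |u| ≤ 1 := by
          have := (continuous_abs (G := ℝ)).tendsto 0
          rw [abs_zero] at this
          exact this.eventually (eventually_le_nhds one_pos)
        filter_upwards [this] with u hu
        have := Real.cos_bound hu
        rw [Real.norm_eq_abs, Real.norm_eq_abs, abs_pow]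
        linarith
      have hx0 : Tendsto (fun u : ℝ => u * x) (𝓝 0) (𝓝 0) := by
        simpa using (continuous_mul_const x).tendsto (0 : ℝ)
      have h1 := hcos.comp_tendsto hx0
      have h2 : (fun u : ℝ => Real.cos (u * x) - (1 - (u * x) ^ 2 / 2)) =o[𝓝 0] fun u => u ^ 2 := by
        refine h1.trans_isLittleO ?_
        have : (fun u : ℝ => u ^ 4 * x ^ 4) =o[𝓝 0] fun u : ℝ => u ^ 2 := by
          have h24 : (fun u : ℝ => u ^ 4) =o[𝓝 0] fun u : ℝ => u ^ 2 :=
            isLittleO_pow_pow (by norm_num)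
          simpa [mul_comm] using h24.const_mul_left (x ^ 4)
        simpa [Function.comp_def, mul_pow] using this
      have h3 := h2.tendsto_div_nhds_zero
      have h4 : Tendsto (fun u : ℝ => -2 * ((Real.cos (u * x) - (1 - (u * x) ^ 2 / 2)) / u ^ 2)
          + x ^ 2) (𝓝[≠] 0) (𝓝 (x ^ 2)) := by
        simpa using ((h3.mono_left nhdsWithin_le_nhds).const_mul (-2)).add_const (x ^ 2)
      refine h4.congr' ?_
      filter_upwards [self_mem_nhdsWithin] with u hu
      have : u ≠ 0 := hu
      field_simp
      ring
    have hs' : Tendsto (fun n : ℕ => 1 / ((n : ℝ) + 1)) atTop (𝓝[≠] 0) :=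
      tendsto_nhdsWithin_iff.2 ⟨hs, Eventually.of_forall fun n => by
        simp only [Set.mem_compl_iff, Set.mem_singleton_iff]; positivity⟩
    have := (hlim.comp hs').const_mul (x ^ (2 * m))
    refine (this.congr fun n => ?_).trans (by rw [mul_add, pow_add])
    simp only [Function.comp]
    field_simp
  · refine ne_top_of_le_ne_top (ENNReal.ofReal_ne_top (r := C)) ?_
    refine liminf_le_of_frequently_le' (Eventually.frequently ?_)
    filter_upwards [hC'] with n hn
    have hint2 : Integrable (fun x : ℝ =>
        x ^ (2 * m) * (2 - 2 * Real.cos (1 / ((n : ℝ) + 1) * x)) * ((n : ℝ) + 1) ^ 2) μ := by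
      refine Integrable.mul_const ?_ _
      refine (hi.mul_const 4).mono (by fun_prop) (ae_of_all _ fun x => ?_)
      rw [norm_mul, norm_mul]
      gcongr
      rw [Real.norm_eq_abs, abs_le]
      have h1 := Real.cos_le_one (1 / ((n : ℝ) + 1) * x)
      have h2 := Real.neg_one_le_cos (1 / ((n : ℝ) + 1) * x)
      constructor <;> norm_num <;> norm_num at h1 h2 <;> linarith
    have e : ∀ x : ℝ, ‖x ^ (2 * m) * (2 - 2 * Real.cos (1 / ((n : ℝ) + 1) * x)) * ((n : ℝ) + 1) ^ 2‖ₑ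
        = ENNReal.ofReal
          (x ^ (2 * m) * (2 - 2 * Real.cos (1 / ((n : ℝ) + 1) * x)) * ((n : ℝ) + 1) ^ 2) :=
      fun x => Real.enorm_eq_ofReal (hnn n x)
    simp_rw [e]
    rw [← ofReal_integral_eq_lintegral_ofReal hint2 (ae_of_all _ (hnn n))]
    refine ENNReal.ofReal_le_ofReal ?_
    rw [integral_mul_const, integral_pow_mul_two_sub_two_mul_cos hint]
    have h1 := (Complex.re_le_norm _).trans_eq' (rfl : ((-1 : ℂ) ^ m *
      (2 * iteratedDeriv (2 * m) (charFun μ) 0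
        - iteratedDeriv (2 * m) (charFun μ) (1 / ((n : ℝ) + 1))
        - iteratedDeriv (2 * m) (charFun μ) (-(1 / ((n : ℝ) + 1))))).re = _)
    rw [norm_mul, norm_pow, norm_neg, norm_one, one_pow, one_mul] at h1
    have h2 := h1.trans hn
    rw [Real.norm_eq_abs, abs_of_nonneg (by positivity)] at h2
    calc _ ≤ C * (1 / ((n : ℝ) + 1)) ^ 2 * ((n : ℝ) + 1) ^ 2 := by gcongr
      _ = C := by field_simp

theorem integrable_even_pow_of_analyticAt_charFun (ha : AnalyticAt ℝ (charFun μ) 0) (m : ℕ) :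
    Integrable (fun x : ℝ => x ^ (2 * m)) μ := by
  induction m with
  | zero => simp
  | succ m ih =>
    exact integrable_even_pow_succ_of_analyticAt_charFun (memLp_id_of_integrable_even_pow ih) ha

/-- Up to sign, the moments are (2m)! times Taylor coefficients, which grow at most geometrically
inside the radius of convergence. -/
theorem exists_even_moment_bound (ha : AnalyticAt ℝ (charFun μ) 0) :
    ∃ C r : ℝ, 0 < C ∧ 0 < r ∧
      ∀ m : ℕ, (∫ x, x ^ (2 * m) ∂μ) * r ^ (2 * m) ≤ C * (2 * m).factorial := by
  obtain ⟨p, R, hp⟩ := ha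
  obtain ⟨r, hr0, hr⟩ : ∃ r : NNReal, 0 < r ∧ (r : ENNReal) < R := by
    obtain ⟨r, h0, h1⟩ := ENNReal.lt_iff_exists_nnreal_btwn.1 hp.r_pos
    exact ⟨r, by exact_mod_cast h0, h1⟩
  obtain ⟨C, hC, hCb⟩ := p.norm_mul_pow_le_of_lt_radius (hr.trans_le hp.r_le)
  refine ⟨C, r, hC, hr0, fun m => ?_⟩
  have h1 := hp.factorial_smul 1 (2 * m)
  have hint := memLp_id_of_integrable_even_pow
    (integrable_even_pow_of_analyticAt_charFun ⟨p, R, hp⟩ m)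
  rw [← iteratedDeriv_eq_iteratedFDeriv, iteratedDeriv_charFun_zero hint] at h1
  have h2 : ‖(∫ x, x ^ (2 * m) ∂μ : ℝ)‖ = ((2 * m).factorial : ℝ) * ‖p (2 * m) (fun _ => 1)‖ := by
    have := congrArg norm h1
    rw [norm_mul, norm_pow, Complex.norm_I, one_pow, one_mul, nsmul_eq_mul, norm_mul,
      Complex.norm_natCast, Complex.norm_real] at this
    exact this.symm
  have h3 : ‖p (2 * m) (fun _ => 1)‖ ≤ ‖p (2 * m)‖ := by
    simpa only [norm_one, Finset.prod_const_one, mul_one] using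
      (p (2 * m)).le_opNorm (fun _ => (1 : ℝ))
  calc _ ≤ ‖(∫ x, x ^ (2 * m) ∂μ : ℝ)‖ * (r : ℝ) ^ (2 * m) := by
        gcongr
        exact Real.le_norm_self _
    _ ≤ ((2 * m).factorial : ℝ) * ‖p (2 * m)‖ * (r : ℝ) ^ (2 * m) := by rw [h2]; gcongr
    _ = ((2 * m).factorial : ℝ) * (‖p (2 * m)‖ * (r : ℝ) ^ (2 * m)) := by ring
    _ ≤ ((2 * m).factorial : ℝ) * C := by gcongr; exact hCb _
    _ = _ := mul_comm _ _

/-- The power series of cosh is integrated term by term. Halving the radius r leaves a convergent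
geometric factor 4^{-m}. -/
theorem integrable_cosh_of_analyticAt_charFun (ha : AnalyticAt ℝ (charFun μ) 0) :
    ∃ s : ℝ, 0 < s ∧ Integrable (fun x => Real.cosh (s * x)) μ := by
  obtain ⟨C, r, hC, hr, h⟩ := exists_even_moment_bound ha
  refine ⟨r / 2, by positivity, by fun_prop, ?_⟩
  have hnn (m : ℕ) (x : ℝ) : 0 ≤ (r / 2 * x) ^ (2 * m) / ((2 * m).factorial : ℝ) := by
    rw [pow_mul]; positivity
  have e (x : ℝ) : ‖Real.cosh (r / 2 * x)‖ₑ =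
      ∑' m : ℕ, ENNReal.ofReal ((r / 2 * x) ^ (2 * m) / ((2 * m).factorial : ℝ)) := by
    rw [Real.enorm_eq_ofReal (Real.cosh_pos _).le, ← (Real.hasSum_cosh _).tsum_eq,
      ENNReal.ofReal_tsum_of_nonneg (fun m => hnn m x) (Real.hasSum_cosh _).summable]
  rw [HasFiniteIntegral]
  simp_rw [e]
  rw [lintegral_tsum (fun m => by fun_prop)]
  have hb (m : ℕ) : ∫⁻ x, ENNReal.ofReal ((r / 2 * x) ^ (2 * m) / ((2 * m).factorial : ℝ)) ∂μ
      ≤ ENNReal.ofReal (C * (1 / 4) ^ m) := by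
    have hi := integrable_even_pow_of_analyticAt_charFun ha m
    have hi' : Integrable (fun x : ℝ => (r / 2 * x) ^ (2 * m) / ((2 * m).factorial : ℝ)) μ := by
      simp_rw [mul_pow]
      exact (hi.const_mul _).div_const _
    rw [← ofReal_integral_eq_lintegral_ofReal hi' (ae_of_all _ (hnn m))]
    refine ENNReal.ofReal_le_ofReal ?_
    simp_rw [mul_pow]
    rw [integral_div, integral_const_mul, div_le_iff₀ (by positivity)]
    calc _ = (1 / 4) ^ m * ((∫ x, x ^ (2 * m) ∂μ) * r ^ (2 * m)) := by
          rw [div_pow, pow_mul 2, one_div, inv_pow]; norm_num; field_simp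
      _ ≤ (1 / 4) ^ m * (C * (2 * m).factorial) := by exact mul_le_mul_of_nonneg_left (h m) (by positivity)
      _ = _ := by ring
  refine (ENNReal.tsum_le_tsum hb).trans_lt ?_
  rw [← ENNReal.ofReal_tsum_of_nonneg (fun m => by positivity)
    ((summable_geometric_of_lt_one (by norm_num) (by norm_num)).mul_left C)]
  exact ENNReal.ofReal_lt_top

theorem zero_mem_interior_integrableExpSet_of_analyticAt_charFun
    (ha : AnalyticAt ℝ (charFun μ) 0) : 0 ∈ interior (integrableExpSet id μ) := by
  obtain ⟨s, hs, h⟩ := integrable_cosh_of_analyticAt_charFun ha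
  have hexp : ∀ t ∈ ({s, -s} : Set ℝ), Integrable (fun x => Real.exp (t * id x)) μ := by
    intro t ht
    refine (h.const_mul 2).mono (by fun_prop) (ae_of_all _ fun x => ?_)
    rw [Real.norm_of_nonneg (Real.exp_pos _).le, Real.norm_of_nonneg
      (by have := Real.cosh_pos (s * x); positivity), Real.cosh_eq]
    have h1 := Real.exp_pos (s * x)
    have h2 := Real.exp_pos (-(s * x))
    rcases ht with rfl | rfl
    · simp; linarith
    · simp; linarith
  refine mem_interior_iff_mem_nhds.2 (mem_of_superset (Ioo_mem_nhds (neg_lt_zero.2 hs) hs) ?_)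
  intro t ht
  exact integrable_exp_mul_of_le_of_le (hexp (-s) (by simp)) (hexp s (by simp)) ht.1.le ht.2.le

end Moments

/-- The law of a single random variable with density `ρ`. -/
noncomputable def baseLaw (ρ : ℝ → ℝ) : Measure ℝ :=
  volume.withDensity fun x => ENNReal.ofReal (ρ x)

theorem law_eq_pi (ρ : ℝ → ℝ) (n : ℕ) : law ρ n = Measure.pi fun _ => baseLaw ρ := rfl

/-! ### The single-variable law: symmetry, moment generating function and its logarithm. -/

section Base

variable {ρ : ℝ → ℝ}

theorem IsAdmissible.integrable (hρ : IsAdmissible ρ) : Integrable ρ :=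
  -- The Bochner integral of a non-integrable function is 0 by convention, so a nonzero value
  -- certifies integrability.
  .of_integral_ne_zero (by rw [hρ.integral_eq_one]; exact one_ne_zero)

theorem IsAdmissible.isProbabilityMeasure (hρ : IsAdmissible ρ) :
    IsProbabilityMeasure (baseLaw ρ) := by
  refine ⟨?_⟩
  rw [baseLaw, withDensity_apply _ MeasurableSet.univ, Measure.restrict_univ,
    ← ofReal_integral_eq_lintegral_ofReal hρ.integrable (ae_of_all _ hρ.nonneg),
    hρ.integral_eq_one, ENNReal.ofReal_one]

theorem IsAdmissible.integral_baseLaw (hρ : IsAdmissible ρ) {E : Type*} [NormedAddCommGroup E]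
    [NormedSpace ℝ E] (g : ℝ → E) : ∫ x, g x ∂(baseLaw ρ) = ∫ x, ρ x • g x := by
  rw [baseLaw, integral_withDensity_eq_integral_toReal_smul hρ.measurable.ennreal_ofReal
    (ae_of_all _ fun x => ENNReal.ofReal_lt_top)]
  simp_rw [ENNReal.toReal_ofReal (hρ.nonneg _)]

theorem IsAdmissible.integrable_baseLaw_iff (hρ : IsAdmissible ρ) {E : Type*}
    [NormedAddCommGroup E] [NormedSpace ℝ E] {g : ℝ → E} :
    Integrable g (baseLaw ρ) ↔ Integrable (fun x => ρ x • g x) := by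
  rw [baseLaw, integrable_withDensity_iff_integrable_smul' hρ.measurable.ennreal_ofReal
    (ae_of_all _ fun x => ENNReal.ofReal_lt_top)]
  simp_rw [ENNReal.toReal_ofReal (hρ.nonneg _)]

theorem IsAdmissible.fourier_eq_complexMGF (hρ : IsAdmissible ρ) (z : ℂ) :
    fourier ρ z = complexMGF id (baseLaw ρ) (2 * Real.pi * Complex.I * z) := by
  rw [fourier, complexMGF, hρ.integral_baseLaw]
  refine integral_congr_ae (ae_of_all _ fun x => ?_)
  simp only [id, Complex.real_smul]
  ring

theorem IsAdmissible.analyticAt_charFun (hρ : IsAdmissible ρ) :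
    AnalyticAt ℝ (charFun (baseLaw ρ)) 0 := by
  have h1 : charFun (baseLaw ρ) =
      (fun f : ℝ => fourier ρ (f : ℂ)) ∘ fun t : ℝ => (2 * Real.pi)⁻¹ * t := by
    ext t
    rw [Function.comp, hρ.fourier_eq_complexMGF, ← complexMGF_id_mul_I]
    congr 1
    push_cast
    have : (Real.pi : ℂ) ≠ 0 := by exact_mod_cast Real.pi_ne_zero
    field_simp
  rw [h1]
  refine AnalyticAt.comp ?_ (by fun_prop)
  rw [mul_zero]
  exact hρ.analytic

theorem IsAdmissible.zero_mem_interior (hρ : IsAdmissible ρ) :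
    0 ∈ interior (integrableExpSet id (baseLaw ρ)) :=
  have := hρ.isProbabilityMeasure
  zero_mem_interior_integrableExpSet_of_analyticAt_charFun hρ.analyticAt_charFun

theorem IsAdmissible.map_neg (hρ : IsAdmissible ρ) :
    (baseLaw ρ).map (fun x => -x) = baseLaw ρ := by
  ext s hs
  rw [Measure.map_apply measurable_neg hs, baseLaw, withDensity_apply _ (measurable_neg hs),
    withDensity_apply _ hs, ← lintegral_indicator (measurable_neg hs), ← lintegral_indicator hs,
    ← lintegral_neg_eq_self]
  refine lintegral_congr fun x => ?_
  have h : (-x ∈ (fun x : ℝ => -x) ⁻¹' s) ↔ x ∈ s := by rw [Set.mem_preimage, neg_neg]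
  by_cases hx : x ∈ s
  · rw [Set.indicator_of_mem (h.2 hx), Set.indicator_of_mem hx, hρ.even]
  · rw [Set.indicator_of_notMem (fun hx' => hx (h.1 hx')), Set.indicator_of_notMem hx]

theorem IsAdmissible.measurePreserving_neg (hρ : IsAdmissible ρ) :
    MeasurePreserving (fun x : ℝ => -x) (baseLaw ρ) (baseLaw ρ) :=
  ⟨measurable_neg, hρ.map_neg⟩

theorem IsAdmissible.integral_comp_neg (hρ : IsAdmissible ρ) {E : Type*} [NormedAddCommGroup E]
    [NormedSpace ℝ E] (g : ℝ → E) : ∫ x, g (-x) ∂(baseLaw ρ) = ∫ x, g x ∂(baseLaw ρ) :=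
  hρ.measurePreserving_neg.integral_comp (MeasurableEquiv.neg ℝ).measurableEmbedding g

theorem IsAdmissible.mgf_neg (hρ : IsAdmissible ρ) (t : ℝ) :
    mgf id (baseLaw ρ) (-t) = mgf id (baseLaw ρ) t := by
  rw [mgf, mgf, ← hρ.integral_comp_neg]
  simp

theorem IsAdmissible.cgf_neg (hρ : IsAdmissible ρ) (t : ℝ) :
    cgf id (baseLaw ρ) (-t) = cgf id (baseLaw ρ) t := by
  rw [cgf, cgf, hρ.mgf_neg]

theorem IsAdmissible.integral_id (hρ : IsAdmissible ρ) : ∫ x, x ∂(baseLaw ρ) = 0 := by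
  have := hρ.integral_comp_neg fun x => x
  rw [integral_neg] at this
  linarith

theorem IsAdmissible.integral_sq (hρ : IsAdmissible ρ) : ∫ x, x ^ 2 ∂(baseLaw ρ) = 1 := by
  rw [hρ.integral_baseLaw, ← hρ.second_moment]
  simp only [smul_eq_mul, mul_comm]

/-- The half-width of a strip on which all exponential moments exist. -/
theorem IsAdmissible.exists_strip (hρ : IsAdmissible ρ) :
    ∃ τ : ℝ, 0 < τ ∧ ∀ t : ℝ, |t| < τ → t ∈ interior (integrableExpSet id (baseLaw ρ)) := by
  obtain ⟨τ, hτ, h⟩ := Metric.isOpen_iff.1 isOpen_interior 0 hρ.zero_mem_interior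
  exact ⟨τ, hτ, fun t ht => h (by simpa using ht)⟩

theorem IsAdmissible.mgf_pos (hρ : IsAdmissible ρ) {t : ℝ}
    (ht : t ∈ interior (integrableExpSet id (baseLaw ρ))) : 0 < mgf id (baseLaw ρ) t :=
  have := hρ.isProbabilityMeasure
  _root_.ProbabilityTheory.mgf_pos (integrable_of_mem_integrableExpSet (interior_subset ht))

/-- By evenness the integrals of e^{tx} and e^{-tx} agree, and their sum is at least 2. Hence
dividing by the normalizing constant of a tilt never enlarges a density. -/
theorem IsAdmissible.one_le_mgf (hρ : IsAdmissible ρ) {t : ℝ}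
    (ht : t ∈ interior (integrableExpSet id (baseLaw ρ)))
    (ht' : -t ∈ interior (integrableExpSet id (baseLaw ρ))) : 1 ≤ mgf id (baseLaw ρ) t := by
  have := hρ.isProbabilityMeasure
  have i1 : Integrable (fun x => Real.exp (t * id x)) (baseLaw ρ) :=
    integrable_of_mem_integrableExpSet (interior_subset ht)
  have i2 : Integrable (fun x => Real.exp (-t * id x)) (baseLaw ρ) :=
    integrable_of_mem_integrableExpSet (interior_subset ht')
  have h : ∫ _x : ℝ, (2 : ℝ) ∂(baseLaw ρ) ≤
      ∫ x, (Real.exp (t * id x) + Real.exp (-t * id x)) ∂(baseLaw ρ) := by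
    refine integral_mono (by simp) (i1.add i2) fun x => ?_
    have := Real.one_le_cosh (t * id x)
    rw [Real.cosh_eq] at this
    beta_reduce
    rw [neg_mul]
    linarith
  rw [integral_add i1 i2] at h
  have h2 := hρ.mgf_neg t
  rw [mgf, mgf] at h2
  rw [mgf]
  simp only [integral_const, probReal_univ, smul_eq_mul, one_mul] at h
  linarith

theorem IsAdmissible.cgf_nonneg (hρ : IsAdmissible ρ) {t : ℝ}
    (ht : t ∈ interior (integrableExpSet id (baseLaw ρ)))
    (ht' : -t ∈ interior (integrableExpSet id (baseLaw ρ))) : 0 ≤ cgf id (baseLaw ρ) t :=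
  Real.log_nonneg (hρ.one_le_mgf ht ht')

/-- The complex logarithm of the moment generating function. -/
noncomputable def logMGF (ρ : ℝ → ℝ) (z : ℂ) : ℂ := Complex.log (complexMGF id (baseLaw ρ) z)

theorem F_eq_neg_logMGF (hρ : IsAdmissible ρ) (z : ℂ) :
    F ρ z = -logMGF ρ (2 * Real.pi * Complex.I * z) := by
  rw [F, logMGF, hρ.fourier_eq_complexMGF]

theorem IsAdmissible.complexMGF_zero (hρ : IsAdmissible ρ) :
    complexMGF id (baseLaw ρ) 0 = 1 := by
  have := hρ.isProbabilityMeasure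
  simp [complexMGF]

theorem IsAdmissible.analyticAt_complexMGF (hρ : IsAdmissible ρ) :
    AnalyticAt ℂ (complexMGF id (baseLaw ρ)) 0 :=
  _root_.ProbabilityTheory.analyticAt_complexMGF (by simpa using hρ.zero_mem_interior)

theorem IsAdmissible.analyticAt_logMGF (hρ : IsAdmissible ρ) : AnalyticAt ℂ (logMGF ρ) 0 :=
  hρ.analyticAt_complexMGF.clog (by rw [hρ.complexMGF_zero]; exact Complex.one_mem_slitPlane)

theorem IsAdmissible.deriv_complexMGF_zero (hρ : IsAdmissible ρ) :
    deriv (complexMGF id (baseLaw ρ)) 0 = 0 := by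
  have h := iteratedDeriv_complexMGF (X := id) (μ := baseLaw ρ) (z := 0)
    (by simpa using hρ.zero_mem_interior) 1
  rw [iteratedDeriv_one] at h
  rw [h]
  simp only [id, pow_one, zero_mul, Complex.exp_zero, mul_one]
  rw [integral_complex_ofReal, hρ.integral_id, Complex.ofReal_zero]

theorem IsAdmissible.deriv_deriv_complexMGF_zero (hρ : IsAdmissible ρ) :
    deriv (deriv (complexMGF id (baseLaw ρ))) 0 = 1 := by
  have h := iteratedDeriv_complexMGF (X := id) (μ := baseLaw ρ) (z := 0)
    (by simpa using hρ.zero_mem_interior) 2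
  rw [iteratedDeriv_succ, iteratedDeriv_one] at h
  rw [h]
  simp only [id, zero_mul, Complex.exp_zero, mul_one]
  have := hρ.integral_sq
  rw [← Complex.ofReal_one, ← this, ← integral_complex_ofReal]
  simp

theorem IsAdmissible.deriv_logMGF_eventuallyEq (hρ : IsAdmissible ρ) :
    deriv (logMGF ρ) =ᶠ[𝓝 0]
      fun z => deriv (complexMGF id (baseLaw ρ)) z / complexMGF id (baseLaw ρ) z := by
  have h1 := hρ.analyticAt_complexMGF.eventually_analyticAt
  have h2 : ∀ᶠ z in 𝓝 0, complexMGF id (baseLaw ρ) z ∈ Complex.slitPlane :=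
    hρ.analyticAt_complexMGF.continuousAt.eventually_mem (Complex.isOpen_slitPlane.mem_nhds
      (by rw [hρ.complexMGF_zero]; exact Complex.one_mem_slitPlane))
  filter_upwards [h1, h2] with z hz1 hz2
  exact (hz1.differentiableAt.hasDerivAt.clog hz2).deriv

/-- The derivative is the variance, which is 1. Strict differentiability yields two-point estimates
near 0, needed both for expansions uniform in the tilt and for the contraction argument. -/
theorem IsAdmissible.hasStrictDerivAt_deriv_logMGF (hρ : IsAdmissible ρ) :
    HasStrictDerivAt (deriv (logMGF ρ)) 1 0 := by
  have h := hρ.analyticAt_logMGF.deriv.hasStrictDerivAt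
  have h2 : HasDerivAt (deriv (logMGF ρ)) 1 0 := by
    refine HasDerivAt.congr_of_eventuallyEq ?_ hρ.deriv_logMGF_eventuallyEq
    have a := hρ.analyticAt_complexMGF.deriv.differentiableAt.hasDerivAt
    have b := hρ.analyticAt_complexMGF.differentiableAt.hasDerivAt
    convert! a.div b (by rw [hρ.complexMGF_zero]; exact one_ne_zero) using 1
    rw [hρ.complexMGF_zero, hρ.deriv_complexMGF_zero, hρ.deriv_deriv_complexMGF_zero]
    simp
  rwa [h2.deriv] at h

theorem IsAdmissible.logMGF_ofReal (hρ : IsAdmissible ρ) {u : ℝ}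
    (hu : u ∈ interior (integrableExpSet id (baseLaw ρ))) :
    logMGF ρ u = (cgf id (baseLaw ρ) u : ℂ) := by
  rw [logMGF, complexMGF_ofReal, cgf, Complex.ofReal_log (hρ.mgf_pos hu).le]

/-- A disc on which `logMGF` is analytic and inverts the exponential. -/
theorem IsAdmissible.exists_disc (hρ : IsAdmissible ρ) :
    ∃ τ : ℝ, 0 < τ ∧ (∀ z : ℂ, ‖z‖ < τ → AnalyticAt ℂ (logMGF ρ) z) ∧
      (∀ z : ℂ, ‖z‖ < τ → Complex.exp (logMGF ρ z) = complexMGF id (baseLaw ρ) z) ∧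
      ∀ t : ℝ, |t| < τ → t ∈ interior (integrableExpSet id (baseLaw ρ)) := by
  obtain ⟨τ₁, h1, h1'⟩ := hρ.exists_strip
  obtain ⟨τ₂, h2, h2'⟩ := Metric.eventually_nhds_iff.1
    hρ.analyticAt_logMGF.eventually_analyticAt
  have h0 : ∀ᶠ z in 𝓝 0, complexMGF id (baseLaw ρ) z ≠ 0 :=
    hρ.analyticAt_complexMGF.continuousAt.eventually_ne
      (by rw [hρ.complexMGF_zero]; exact one_ne_zero)
  obtain ⟨τ₃, h3, h3'⟩ := Metric.eventually_nhds_iff.1 h0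
  refine ⟨min τ₁ (min τ₂ τ₃), by positivity, fun z hz => h2' ?_, fun z hz => ?_, fun t ht => ?_⟩
  · rw [dist_zero_right]; exact hz.trans_le ((min_le_right _ _).trans (min_le_left _ _))
  · refine Complex.exp_log (h3' ?_)
    rw [dist_zero_right]; exact hz.trans_le ((min_le_right _ _).trans (min_le_right _ _))
  · exact h1' t (ht.trans_le (min_le_left _ _))

theorem IsAdmissible.deriv_logMGF_ofReal (hρ : IsAdmissible ρ) {u : ℝ}
    (ha : AnalyticAt ℂ (logMGF ρ) u) (hu : u ∈ interior (integrableExpSet id (baseLaw ρ))) :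
    deriv (logMGF ρ) u = ((deriv (cgf id (baseLaw ρ)) u : ℝ) : ℂ) := by
  have h1 := ha.differentiableAt.hasDerivAt.comp_ofReal
  have h2 := (analyticAt_cgf hu).differentiableAt.hasDerivAt.ofReal_comp
  refine (h1.congr_of_eventuallyEq ?_).unique h2
  filter_upwards [isOpen_interior.mem_nhds hu] with t ht
  exact (hρ.logMGF_ofReal ht).symm

end Base

/-! ### Expansions of the cumulant generating function near zero. -/

section Expansions

variable {ρ : ℝ → ℝ}

/-- The derivative of the cumulant generating function is `u + o(u)` near `0`, uniformly. -/
theorem IsAdmissible.deriv_cgf_sub (hρ : IsAdmissible ρ) {ε : ℝ} (hε : 0 < ε) :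
    ∃ δ : ℝ, 0 < δ ∧ ∀ z w : ℂ, ‖z‖ < δ → ‖w‖ < δ →
      ‖deriv (logMGF ρ) z - deriv (logMGF ρ) w - (z - w)‖ ≤ ε * ‖z - w‖ := by
  have h := hρ.hasStrictDerivAt_deriv_logMGF.hasStrictFDerivAt.isLittleO.bound hε
  rw [show ((0 : ℂ), (0 : ℂ)) = 0 from rfl] at h
  obtain ⟨δ, hδ, h⟩ := Metric.eventually_nhds_iff.1 h
  refine ⟨δ, hδ, fun z w hz hw => ?_⟩
  have := h (y := (z, w)) (by rw [dist_zero_right, Prod.norm_def]; exact max_lt hz hw)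
  simpa using this

theorem IsAdmissible.deriv_cgf_sub_real (hρ : IsAdmissible ρ) {ε : ℝ} (hε : 0 < ε) :
    ∃ δ : ℝ, 0 < δ ∧ ∀ u v : ℝ, |u| < δ → |v| < δ →
      |deriv (cgf id (baseLaw ρ)) u - deriv (cgf id (baseLaw ρ)) v - (u - v)| ≤ ε * |u - v| := by
  obtain ⟨δ, hδ, h⟩ := hρ.deriv_cgf_sub hε
  obtain ⟨τ, hτ, ha, -, hi⟩ := hρ.exists_disc
  refine ⟨min δ τ, by positivity, fun u v hu hv => ?_⟩
  have h1 := h u v (by simpa using hu.trans_le (min_le_left _ _))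
    (by simpa using hv.trans_le (min_le_left _ _))
  have hu' := hu.trans_le (min_le_right _ _)
  have hv' := hv.trans_le (min_le_right _ _)
  rw [hρ.deriv_logMGF_ofReal (ha u (by simpa using hu')) (hi u hu'),
    hρ.deriv_logMGF_ofReal (ha v (by simpa using hv')) (hi v hv')] at h1
  exact_mod_cast h1

theorem IsAdmissible.deriv_cgf_zero (hρ : IsAdmissible ρ) :
    deriv (cgf id (baseLaw ρ)) 0 = 0 := by
  have := hρ.isProbabilityMeasure
  rw [_root_.ProbabilityTheory.deriv_cgf_zero hρ.zero_mem_interior]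
  simpa using hρ.integral_id

/-- Second order expansion of the normalized Fourier transform of the tilted law. -/
theorem IsAdmissible.tilted_charFun_expansion (hρ : IsAdmissible ρ) :
    ∃ e : ℝ → ℝ → ℂ, ∀ ε : ℝ, 0 < ε → ∃ δ : ℝ, 0 < δ ∧ ∀ κ u : ℝ, |κ| < δ → |u| < δ →
      ‖e κ u‖ ≤ ε * u ^ 2 ∧
      complexMGF id (baseLaw ρ) (κ + u * Complex.I) / mgf id (baseLaw ρ) κ =
        Complex.exp (deriv (cgf id (baseLaw ρ)) κ * u * Complex.I - u ^ 2 / 2 + e κ u) := by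
  -- The remainder is fixed before ε; only the radius δ depends on ε.
  refine ⟨fun κ u => logMGF ρ (κ + u * Complex.I) - logMGF ρ κ
    - deriv (cgf id (baseLaw ρ)) κ * u * Complex.I + u ^ 2 / 2, fun ε hε => ?_⟩
  obtain ⟨δ, hδ, h⟩ := hρ.deriv_cgf_sub hε
  obtain ⟨τ, hτ, ha, hexp, hi⟩ := hρ.exists_disc
  refine ⟨min δ τ / 2, by positivity, fun κ u hκ hu => ?_⟩
  have hball (s : ℝ) (hs : s ∈ Set.Icc (0 : ℝ) 1) : ‖(κ + s * u * Complex.I : ℂ)‖ < min δ τ := by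
    refine (norm_add_le _ _).trans_lt ?_
    rw [norm_mul, norm_mul, Complex.norm_I, Complex.norm_real, Complex.norm_real, Complex.norm_real,
      Real.norm_eq_abs, Real.norm_eq_abs, Real.norm_eq_abs, abs_of_nonneg hs.1]
    have : s * |u| ≤ 1 * |u| := by gcongr; exact hs.2
    linarith
  have hκ0 : ‖(κ : ℂ)‖ < min δ τ := by simpa using hball 0 (by simp)
  have hK := hρ.deriv_logMGF_ofReal (ha κ (hκ0.trans_le (min_le_right _ _)))
    (hi κ (by simpa using hκ0.trans_le (min_le_right _ _)))
  -- Second order remainder along the segment from κ to κ + iu. Its derivative is iu times the error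
  -- in linearizing the derivative of `logMGF`, hence at most ε u² in norm.
  let g : ℝ → ℂ := fun s => logMGF ρ (κ + s * u * Complex.I)
    - s * (u * Complex.I) * deriv (logMGF ρ) κ - (s * u * Complex.I) ^ 2 / 2
  have hg (s : ℝ) (hs : s ∈ Set.Icc (0 : ℝ) 1) : HasDerivWithinAt g
      (u * Complex.I * (deriv (logMGF ρ) (κ + s * u * Complex.I) - deriv (logMGF ρ) κ
        - s * u * Complex.I)) (Set.Icc 0 1) s := by
    have h1 := (ha _ ((hball s hs).trans_le (min_le_right _ _))).differentiableAt.hasDerivAt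
    have h2 : HasDerivAt (fun w : ℂ => (κ + w * u * Complex.I : ℂ)) (u * Complex.I) (s : ℂ) := by
      have := (((hasDerivAt_id (s : ℂ)).mul_const (u : ℂ)).mul_const Complex.I).const_add (κ : ℂ)
      simpa using this
    have h3 := HasDerivAt.comp (s : ℂ) h1 h2
    have h4 : HasDerivAt (fun w : ℂ => w * (u * Complex.I) * deriv (logMGF ρ) κ)
        (u * Complex.I * deriv (logMGF ρ) κ) (s : ℂ) := by
      simpa using ((hasDerivAt_id (s : ℂ)).mul_const (u * Complex.I)).mul_const _
    have h5 : HasDerivAt (fun w : ℂ => (w * u * Complex.I) ^ 2 / 2)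
        ((s * u * Complex.I) * (u * Complex.I)) (s : ℂ) := by
      have := ((((hasDerivAt_id (s : ℂ)).mul_const (u : ℂ)).mul_const Complex.I).pow 2).div_const 2
      convert! this using 1
      simp; ring
    have h6 := ((h3.sub h4).sub h5).comp_ofReal
    convert! h6.hasDerivWithinAt using 1
    ring
  have hbound (s : ℝ) (hs : s ∈ Set.Icc (0 : ℝ) 1) :
      ‖u * Complex.I * (deriv (logMGF ρ) (κ + s * u * Complex.I) - deriv (logMGF ρ) κ
        - s * u * Complex.I)‖ ≤ ε * u ^ 2 := by
    have h1 := h _ _ ((hball s hs).trans_le (min_le_left _ _)) (hκ0.trans_le (min_le_left _ _))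
    rw [add_sub_cancel_left] at h1
    rw [norm_mul, norm_mul, Complex.norm_I, Complex.norm_real, mul_one, Real.norm_eq_abs]
    have h2 : ‖(s * u * Complex.I : ℂ)‖ ≤ |u| := by
      rw [norm_mul, norm_mul, Complex.norm_I, Complex.norm_real, Complex.norm_real, mul_one,
        Real.norm_eq_abs, Real.norm_eq_abs, abs_of_nonneg hs.1]
      exact mul_le_of_le_one_left (abs_nonneg _) hs.2
    calc _ ≤ |u| * (ε * |u|) := by gcongr; exact h1.trans (by gcongr)
      _ = ε * u ^ 2 := by rw [← sq_abs]; ring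
  have hmv := (convex_Icc (0 : ℝ) 1).norm_image_sub_le_of_norm_hasDerivWithin_le hg hbound
    (Set.left_mem_Icc.2 zero_le_one) (Set.right_mem_Icc.2 zero_le_one)
  have hg01 : g 1 - g 0 = logMGF ρ (κ + u * Complex.I) - logMGF ρ κ
      - deriv (cgf id (baseLaw ρ)) κ * u * Complex.I + u ^ 2 / 2 := by
    simp only [g, hK]
    have hI := Complex.I_sq
    push_cast
    simp only [zero_mul, add_zero, one_mul, mul_pow, hI]
    ring
  rw [hg01] at hmv
  refine ⟨by simpa using hmv, ?_⟩
  have e1 := hexp _ ((hball 1 (by simp)).trans_le (min_le_right _ _))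
  have e0 := hexp _ (hκ0.trans_le (min_le_right _ _))
  rw [complexMGF_ofReal] at e0
  rw [← e0]
  have e1' : complexMGF id (baseLaw ρ) (κ + u * Complex.I) =
      Complex.exp (logMGF ρ (κ + u * Complex.I)) := by
    simpa using e1.symm
  rw [e1', ← Complex.exp_sub]
  congr 1
  ring

theorem IsAdmissible.deriv_cgf_neg (hρ : IsAdmissible ρ) (u : ℝ) :
    deriv (cgf id (baseLaw ρ)) (-u) = -deriv (cgf id (baseLaw ρ)) u := by
  have h : (fun x => cgf id (baseLaw ρ) (-x)) = cgf id (baseLaw ρ) := funext hρ.cgf_neg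
  have h2 := deriv_comp_neg (cgf id (baseLaw ρ)) u
  rw [h] at h2
  linarith

/-- As the cumulant generating function is even, its derivative has no quadratic term. -/
theorem IsAdmissible.deriv_cgf_cubic (hρ : IsAdmissible ρ) :
    ∃ C δ : ℝ, 0 < C ∧ 0 < δ ∧ ∀ u : ℝ, |u| < δ →
      |deriv (cgf id (baseLaw ρ)) u - u| ≤ C * |u| ^ 3 := by
  set K' := deriv (cgf id (baseLaw ρ)) with hK'
  have ha : AnalyticAt ℝ K' 0 := (analyticAt_cgf hρ.zero_mem_interior).deriv
  have hd : deriv K' 0 = 1 := by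
    have h2 : HasDerivAt K' 1 0 := by
      rw [hasDerivAt_iff_isLittleO_nhds_zero, isLittleO_iff]
      intro c hc
      obtain ⟨δ, hδ, h⟩ := hρ.deriv_cgf_sub_real hc
      refine Metric.eventually_nhds_iff.2 ⟨δ, hδ, fun u hu => ?_⟩
      have := h u 0 (by simpa using hu) (by simpa using hδ)
      simpa using this
    exact h2.deriv
  obtain ⟨p, hp⟩ := ha
  have h1 := hp.isBigO_sub_partialSum_pow 3
  have hneg : Tendsto (fun y : ℝ => -y) (𝓝 0) (𝓝 0) := by
    simpa using (continuous_neg (G := ℝ)).tendsto 0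
  have h2 := h1.comp_tendsto hneg
  -- The derivative K' is odd: subtracting the expansion at -y doubles the odd terms and removes the
  -- constant and quadratic ones.
  have h3 := h1.sub (h2.congr_right (g₂ := fun y : ℝ => ‖y‖ ^ 3) (by simp))
  obtain ⟨C, hC, hb⟩ := h3.exists_pos
  obtain ⟨δ, hδ, hb⟩ := Metric.eventually_nhds_iff.1 hb.bound
  refine ⟨C, δ, hC, hδ, fun u hu => ?_⟩
  have := hb (y := u) (by simpa using hu)
  have c1 : p.coeff 1 = 1 := by rw [← hd, hp.deriv]; rfl
  simp only [FormalMultilinearSeries.partialSum, Finset.sum_range_succ, Finset.sum_range_zero,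
    zero_add, Function.comp, FormalMultilinearSeries.apply_eq_pow_smul_coeff, hK',
    hρ.deriv_cgf_neg, c1] at this
  rw [Real.norm_eq_abs, norm_pow, norm_norm, Real.norm_eq_abs] at this
  have e : ∀ a b c : ℝ, a - ((u ^ 0 • b) + (u ^ 1 • (1 : ℝ)) + (u ^ 2 • c)) -
    (-a - (((-u) ^ 0 • b) + ((-u) ^ 1 • (1 : ℝ)) + ((-u) ^ 2 • c))) = 2 * (a - u) := by
    intro a b c; simp only [smul_eq_mul]; ring
  rw [e, abs_mul, abs_two] at this
  have h0 := abs_nonneg (deriv (cgf id (baseLaw ρ)) u - u)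
  linarith

theorem IsAdmissible.cgf_quartic (hρ : IsAdmissible ρ) :
    ∃ C δ : ℝ, 0 < C ∧ 0 < δ ∧ ∀ u : ℝ, |u| < δ →
      |cgf id (baseLaw ρ) u - u ^ 2 / 2| ≤ C * |u| ^ 4 := by
  have := hρ.isProbabilityMeasure
  obtain ⟨C, δ, hC, hδ, h⟩ := hρ.deriv_cgf_cubic
  obtain ⟨τ, hτ, hi⟩ := hρ.exists_strip
  refine ⟨C, min δ τ, hC, by positivity, fun u hu => ?_⟩
  have hd (t : ℝ) (ht : t ∈ Set.uIcc 0 u) : HasDerivWithinAt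
      (fun t => cgf id (baseLaw ρ) t - t ^ 2 / 2) (deriv (cgf id (baseLaw ρ)) t - t)
      (Set.uIcc 0 u) t := by
    have ht' : |t| ≤ |u| := by
      have := Set.abs_sub_left_of_mem_uIcc ht
      simpa using this
    have h1 := (analyticAt_cgf (hi t (ht'.trans_lt (hu.trans_le (min_le_right _ _))))
      ).differentiableAt.hasDerivAt
    have h2 : HasDerivAt (fun t : ℝ => t ^ 2 / 2) t t := by
      have := ((hasDerivAt_id t).pow 2).div_const 2
      convert! this using 1
      simp
    exact (h1.sub h2).hasDerivWithinAt
  have hb (t : ℝ) (ht : t ∈ Set.uIcc 0 u) :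
      ‖deriv (cgf id (baseLaw ρ)) t - t‖ ≤ C * |u| ^ 3 := by
    have ht' : |t| ≤ |u| := by
      have := Set.abs_sub_left_of_mem_uIcc ht
      simpa using this
    refine (h t (ht'.trans_lt (hu.trans_le (min_le_left _ _)))).trans (by gcongr)
  have hmv := (convex_uIcc (0 : ℝ) u).norm_image_sub_le_of_norm_hasDerivWithin_le hd hb
    Set.left_mem_uIcc Set.right_mem_uIcc
  simp only [cgf_zero, Real.norm_eq_abs, sub_zero] at hmv
  refine le_trans ?_ (hmv.trans_eq (by ring))
  simp

/-- On the imaginary axis 2πi·(iu) = -2πu is real, and the sign is absorbed by the evenness of K.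
This is why the saddle point equations and G are real. -/
theorem IsAdmissible.F_and_deriv_F (hρ : IsAdmissible ρ) :
    ∃ δ : ℝ, 0 < δ ∧ ∀ u : ℝ, |u| < δ →
      F ρ (Complex.I * u) = -(cgf id (baseLaw ρ) (2 * Real.pi * u) : ℂ) ∧
      deriv (F ρ) (Complex.I * u) =
        2 * Real.pi * Complex.I * ((deriv (cgf id (baseLaw ρ)) (2 * Real.pi * u) : ℝ) : ℂ) := by
  obtain ⟨τ, hτ, ha, -, hi⟩ := hρ.exists_disc
  have hpi := Real.pi_pos
  refine ⟨τ / (2 * Real.pi), by positivity, fun u hu => ?_⟩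
  have hu' : |2 * Real.pi * u| < τ := by
    rw [lt_div_iff₀ (by positivity)] at hu
    rw [abs_mul, abs_of_pos (by positivity : 0 < 2 * Real.pi)]
    linarith
  have e1 : 2 * Real.pi * Complex.I * (Complex.I * u) = ((-(2 * Real.pi * u) : ℝ) : ℂ) := by
    push_cast
    linear_combination (2 * Real.pi * u : ℂ) * Complex.I_sq
  have hneg : |-(2 * Real.pi * u)| < τ := by rwa [abs_neg]
  constructor
  · rw [F_eq_neg_logMGF hρ, e1, hρ.logMGF_ofReal (hi _ hneg), hρ.cgf_neg]
  · have hF : F ρ = fun z => -logMGF ρ (2 * Real.pi * Complex.I * z) :=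
      funext (F_eq_neg_logMGF hρ)
    have han := ha ((-(2 * Real.pi * u) : ℝ) : ℂ) (by simpa using hu')
    have h1 : HasDerivAt (fun z : ℂ => 2 * Real.pi * Complex.I * z) (2 * Real.pi * Complex.I)
        (Complex.I * u) := by
      simpa using (hasDerivAt_id (Complex.I * u)).const_mul (2 * Real.pi * Complex.I : ℂ)
    have h2 : HasDerivAt (logMGF ρ) (deriv (logMGF ρ) ((-(2 * Real.pi * u) : ℝ) : ℂ))
        (2 * Real.pi * Complex.I * (Complex.I * u)) := by
      rw [e1]
      exact han.differentiableAt.hasDerivAt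
    have h3 := (HasDerivAt.comp (Complex.I * (u : ℂ)) h2 h1).neg
    rw [hF]
    refine h3.deriv.trans ?_
    rw [hρ.deriv_logMGF_ofReal han (hi _ hneg), hρ.deriv_cgf_neg]
    push_cast
    ring

end Expansions

/-! ### Decay of tilted characteristic functions, uniformly in the tilt. -/

section Decay

theorem exists_norm_one_mul_eq_norm (w : ℂ) : ∃ b : ℂ, ‖b‖ = 1 ∧ b * w = (‖w‖ : ℂ) := by
  rcases eq_or_ne w 0 with rfl | hw
  · exact ⟨1, by simp, by simp⟩
  · refine ⟨‖w‖ / w, ?_, ?_⟩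
    · rw [norm_div, Complex.norm_real, norm_norm, div_self (norm_ne_zero_iff.2 hw)]
    · rw [div_mul_cancel₀ _ hw]

theorem integrable_charFun_integrand (ν : Measure ℝ) [IsFiniteMeasure ν] (u : ℝ) :
    Integrable (fun x : ℝ => Complex.exp (u * x * Complex.I)) ν := by
  refine (integrable_const (1 : ℝ)).mono (by fun_prop) (ae_of_all _ fun x => ?_)
  have : ‖Complex.exp (u * x * Complex.I)‖ = 1 := by
    exact_mod_cast Complex.norm_exp_ofReal_mul_I (u * x)
  simp [this]

theorem norm_mul_exp_mul_I {b : ℂ} (hb : ‖b‖ = 1) (u x : ℝ) :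
    ‖b * Complex.exp (u * x * Complex.I)‖ = 1 := by
  rw [norm_mul, hb, one_mul]
  exact_mod_cast Complex.norm_exp_ofReal_mul_I (u * x)

theorem integrable_re {α : Type*} {m : MeasurableSpace α} {ν : Measure α} {f : α → ℂ}
    (hf : Integrable f ν) : Integrable (fun x => (f x).re) ν :=
  Complex.reCLM.integrable_comp hf

theorem integral_one_sub_re_mul_exp (ν : Measure ℝ) [IsFiniteMeasure ν] (b : ℂ) (u : ℝ) :
    ∫ x : ℝ, (1 - (b * Complex.exp (u * x * Complex.I)).re) ∂ν =
      ν.real Set.univ - (b * charFun ν u).re := by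
  have h := (integrable_charFun_integrand ν u).const_mul b
  rw [integral_sub (integrable_const _) (integrable_re h), charFun_apply_real, ← integral_const_mul]
  have := Complex.reCLM.integral_comp_comm h
  simp only [Complex.reCLM_apply] at this
  rw [this, integral_const, smul_eq_mul, mul_one]

/-- Equality would force e^{iux} to be constant almost everywhere, so that the measure would sit on
a countable set (an arithmetic progression), which is Lebesgue null. -/
theorem norm_charFun_lt {ν : Measure ℝ} [IsFiniteMeasure ν] (hac : ν ≪ volume) (h0 : ν ≠ 0) {u : ℝ}
    (hu : u ≠ 0) : ‖charFun ν u‖ < ν.real Set.univ := by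
  refine lt_of_le_of_ne (norm_charFun_le u) fun heq => h0 ?_
  obtain ⟨b, hb, hb'⟩ := exists_norm_one_mul_eq_norm (charFun ν u)
  have h1 := integral_one_sub_re_mul_exp ν b u
  rw [hb', Complex.ofReal_re, heq, sub_self] at h1
  have hnn : 0 ≤ᵐ[ν] fun x : ℝ => 1 - (b * Complex.exp (u * x * Complex.I)).re :=
    ae_of_all _ fun x => by
      have := Complex.re_le_norm (b * Complex.exp (u * x * Complex.I))
      rw [norm_mul_exp_mul_I hb] at this
      simp only [Pi.zero_apply]; linarith
  have hint := (integrable_const (1 : ℝ)).sub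
    (integrable_re ((integrable_charFun_integrand ν u).const_mul b))
  have h2 := (integral_eq_zero_iff_of_nonneg_ae hnn hint).1 h1
  have hbexp : b = Complex.exp (b.arg * Complex.I) := by
    conv_lhs => rw [← Complex.norm_mul_exp_arg_mul_I b, hb]
    simp
  have hcount : (⋃ k : ℤ, {x : ℝ | x = (k * (2 * Real.pi) - b.arg) / u}).Countable :=
    Set.countable_iUnion fun k => by simp
  have hnull : ν (⋃ k : ℤ, {x : ℝ | x = (k * (2 * Real.pi) - b.arg) / u}) = 0 :=
    hac (hcount.measure_zero _)
  rw [← Measure.measure_univ_eq_zero]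
  refine measure_mono_null (t := {x : ℝ | ¬ (1 - (b * Complex.exp (u * x * Complex.I)).re = 0)}
    ∪ ⋃ k : ℤ, {x : ℝ | x = (k * (2 * Real.pi) - b.arg) / u}) (fun x _ => ?_)
    (measure_union_null (by simpa [Filter.EventuallyEq, ae_iff] using h2) hnull)
  by_cases hx : 1 - (b * Complex.exp (u * x * Complex.I)).re = 0
  · right
    have e : b * Complex.exp (u * x * Complex.I) =
        Complex.exp ((b.arg + u * x : ℝ) * Complex.I) := by
      conv_lhs => rw [hbexp]
      rw [← Complex.exp_add]
      push_cast
      ring_nf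
    rw [e, Complex.exp_ofReal_mul_I_re, sub_eq_zero] at hx
    obtain ⟨k, hk⟩ := (Real.cos_eq_one_iff _).1 hx.symm
    refine Set.mem_iUnion.2 ⟨k, ?_⟩
    simp only [Set.mem_ofPred_eq]
    rw [eq_div_iff hu]
    linarith
  · left; exact hx

theorem tendsto_charFun_withDensity_cocompact {g : ℝ → ℝ} (hg : Measurable g) (hg0 : ∀ x, 0 ≤ g x) :
    Tendsto (charFun (volume.withDensity fun x => ENNReal.ofReal (g x))) (cocompact ℝ) (𝓝 0) := by
  have h := Real.zero_at_infty_fourier (fun x => (g x : ℂ))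
  have h2 : Tendsto (fun u : ℝ => -(2 * Real.pi)⁻¹ * u) (cocompact ℝ) (cocompact ℝ) := by
    refine (Homeomorph.mulLeft₀ (-(2 * Real.pi)⁻¹) ?_).isClosedEmbedding.tendsto_cocompact
    have := Real.pi_pos
    simp [this.ne']
  refine (h.comp h2).congr fun u => ?_
  rw [Function.comp, Real.fourier_real_eq_integral_exp_smul, charFun_apply_real,
    integral_withDensity_eq_integral_toReal_smul hg.ennreal_ofReal
    (ae_of_all _ fun x => ENNReal.ofReal_lt_top)]
  refine integral_congr_ae (ae_of_all _ fun x => ?_)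
  simp only [ENNReal.toReal_ofReal (hg0 x), smul_eq_mul, Complex.real_smul]
  rw [mul_comm]
  congr 3
  push_cast
  have : (Real.pi : ℂ) ≠ 0 := by exact_mod_cast Real.pi_ne_zero
  field_simp

variable {ρ : ℝ → ℝ}

/-- The part of the base law on `[-A, A]`. -/
noncomputable def truncLaw (ρ : ℝ → ℝ) (A : ℝ) : Measure ℝ :=
  (baseLaw ρ).restrict (Set.Icc (-A) A)

theorem truncLaw_eq (ρ : ℝ → ℝ) (A : ℝ) : truncLaw ρ A =
    volume.withDensity fun x => ENNReal.ofReal ((Set.Icc (-A) A).indicator ρ x) := by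
  rw [truncLaw, baseLaw, restrict_withDensity measurableSet_Icc,
    ← withDensity_indicator measurableSet_Icc]
  congr 1
  ext x
  by_cases hx : x ∈ Set.Icc (-A) A
  · simp [Set.indicator_of_mem hx]
  · simp [Set.indicator_of_notMem hx]

theorem IsAdmissible.exists_trunc (hρ : IsAdmissible ρ) :
    ∃ A : ℝ, 0 < A ∧ 0 < ∫ x, x ^ 2 ∂(truncLaw ρ A) := by
  have := hρ.isProbabilityMeasure
  have hint : Integrable (fun x : ℝ => x ^ 2) (baseLaw ρ) :=
    .of_integral_ne_zero (by rw [hρ.integral_sq]; exact one_ne_zero)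
  have h := tendsto_setIntegral_of_monotone (μ := baseLaw ρ) (f := fun x : ℝ => x ^ 2)
    (s := fun n : ℕ => Set.Icc (-(n : ℝ)) n) (fun n => measurableSet_Icc)
    (fun m n hmn => Set.Icc_subset_Icc (by simpa using hmn) (by simpa using hmn))
    (hint.integrableOn)
  have hU : (⋃ n : ℕ, Set.Icc (-(n : ℝ)) n) = Set.univ := by
    refine Set.eq_univ_of_forall fun x => ?_
    obtain ⟨n, hn⟩ := exists_nat_ge |x|
    exact Set.mem_iUnion.2 ⟨n, abs_le.1 hn⟩
  rw [hU, setIntegral_univ, hρ.integral_sq] at h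
  have h2 := h.eventually (lt_mem_nhds one_pos)
  obtain ⟨n, hn, hn'⟩ := (h2.and (eventually_ge_atTop 1)).exists
  exact ⟨n, by exact_mod_cast hn', hn⟩

theorem IsAdmissible.charFun_truncLaw (hρ : IsAdmissible ρ) (A u : ℝ) :
    charFun (truncLaw ρ A) u = ((∫ x, Real.cos (u * x) ∂(truncLaw ρ A) : ℝ) : ℂ) := by
  have := hρ.isProbabilityMeasure
  have hmp : MeasurePreserving (fun x : ℝ => -x) (truncLaw ρ A) (truncLaw ρ A) := by
    have h := hρ.measurePreserving_neg.restrict_preimage (s := Set.Icc (-A) A) measurableSet_Icc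
    have e : (fun x : ℝ => -x) ⁻¹' Set.Icc (-A) A = Set.Icc (-A) A := by
      ext x; simp only [Set.mem_preimage, Set.mem_Icc]; constructor <;> intro h <;>
        constructor <;> linarith [h.1, h.2]
    rw [e] at h
    exact h
  have : IsFiniteMeasure (truncLaw ρ A) := by unfold truncLaw; infer_instance
  have h1 : charFun (truncLaw ρ A) (-u) = charFun (truncLaw ρ A) u := by
    rw [charFun_apply_real, charFun_apply_real, ← hmp.integral_comp
      (MeasurableEquiv.neg ℝ).measurableEmbedding]
    simp
  rw [charFun_neg] at h1
  obtain ⟨r, hr⟩ := Complex.conj_eq_iff_real.1 h1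
  have h2 := Complex.reCLM.integral_comp_comm (integrable_charFun_integrand (truncLaw ρ A) u)
  rw [← charFun_apply_real, hr] at h2
  rw [hr]
  simp only [Complex.reCLM_apply, Complex.ofReal_re] at h2
  rw [← h2]
  congr 1
  refine integral_congr_ae (ae_of_all _ fun x => ?_)
  simpa using Complex.exp_ofReal_mul_I_re (u * x)

/-- Three ranges of u. For |u| ≤ 1/A the phase ux stays in [-1, 1] and a quadratic bound on the
cosine applies. Near infinity the Riemann–Lebesgue lemma gives a gap of half the mass. In between,
compactness and the strict inequality `norm_charFun_lt` apply. -/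
theorem IsAdmissible.exists_truncLaw_gap (hρ : IsAdmissible ρ) :
    ∃ A c : ℝ, 0 < A ∧ 0 < c ∧ ∀ u : ℝ,
      c * min 1 (u ^ 2) ≤ (truncLaw ρ A).real Set.univ - ‖charFun (truncLaw ρ A) u‖ := by
  have := hρ.isProbabilityMeasure
  obtain ⟨A, hA, hA'⟩ := hρ.exists_trunc
  have hfin : IsFiniteMeasure (truncLaw ρ A) := by unfold truncLaw; infer_instance
  set ν := truncLaw ρ A with hν
  have hne : ν ≠ 0 := by
    intro h; rw [h] at hA'; simp at hA'
  have hm : 0 < ν.real Set.univ :=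
    have : NeZero ν := ⟨hne⟩
    measureReal_univ_pos
  have hac : ν ≪ volume := by rw [hν, truncLaw_eq]; exact withDensity_absolutelyContinuous _ _
  have hpi := Real.pi_pos
  have hae : ∀ᵐ x ∂ν, |x| ≤ A := by
    refine (ae_restrict_mem measurableSet_Icc).mono fun x hx => abs_le.2 hx
  have hint2 : Integrable (fun x : ℝ => x ^ 2) ν := .of_integral_ne_zero hA'.ne'
  have hcosint (u : ℝ) : Integrable (fun x : ℝ => Real.cos (u * x)) ν :=
    (integrable_const (1 : ℝ)).mono (by fun_prop) (ae_of_all _ fun x => by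
      simpa using Real.abs_cos_le_one (u * x))
  set c₁ : ℝ := 2 / Real.pi ^ 2 * ∫ x, x ^ 2 ∂ν with hc₁
  have hc₁pos : 0 < c₁ := by positivity
  have hsmall (u : ℝ) (hu : |u| ≤ 1 / A) :
      c₁ * u ^ 2 ≤ ν.real Set.univ - ‖charFun ν u‖ := by
    have hux : ∀ᵐ x ∂ν, |u * x| ≤ 1 := by
      filter_upwards [hae] with x hx
      rw [abs_mul]
      calc _ ≤ 1 / A * A := by gcongr
        _ = 1 := by field_simp
    have hnn : 0 ≤ ∫ x, Real.cos (u * x) ∂ν := by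
      refine integral_nonneg_of_ae ?_
      filter_upwards [hux] with x hx
      refine Real.cos_nonneg_of_mem_Icc ⟨?_, ?_⟩ <;>
        linarith [abs_le.1 hx, Real.pi_gt_three, (abs_le.1 hx).1, (abs_le.1 hx).2]
    have hle : ∫ x, Real.cos (u * x) ∂ν ≤ ∫ x, (1 - 2 / Real.pi ^ 2 * u ^ 2 * x ^ 2) ∂ν := by
      refine integral_mono_ae (hcosint u) ((integrable_const _).sub (hint2.const_mul _)) ?_
      filter_upwards [hux] with x hx
      have := Real.cos_le_one_sub_mul_cos_sq (x := u * x) (by linarith [Real.pi_gt_three])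
      rw [mul_pow, ← mul_assoc] at this
      exact this
    rw [integral_sub (integrable_const _) (hint2.const_mul _), integral_const_mul] at hle
    rw [hρ.charFun_truncLaw, Complex.norm_real, Real.norm_of_nonneg hnn]
    simp only [integral_const, smul_eq_mul, mul_one] at hle
    rw [hc₁]
    linarith
  have hinf : ∀ᶠ u in cocompact ℝ, ‖charFun ν u‖ < ν.real Set.univ / 2 := by
    have h := tendsto_charFun_withDensity_cocompact
      (hρ.measurable.indicator (measurableSet_Icc (a := -A) (b := A)))
      (fun x => Set.indicator_nonneg (fun x _ => hρ.nonneg x) x)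
    rw [← truncLaw_eq, ← hν] at h
    have := h.norm
    rw [norm_zero] at this
    exact this.eventually (gt_mem_nhds (by positivity))
  obtain ⟨S, hS, hS'⟩ := mem_cocompact.1 hinf
  have hcont : Continuous fun u => ν.real Set.univ - ‖charFun ν u‖ :=
    continuous_const.sub continuous_charFun.norm
  obtain ⟨c₂, hc₂, hmid⟩ : ∃ c₂ : ℝ, 0 < c₂ ∧ ∀ u ∈ S, 1 / A ≤ |u| →
      c₂ ≤ ν.real Set.univ - ‖charFun ν u‖ := by
    have hcomp : IsCompact (S ∩ {u : ℝ | 1 / A ≤ |u|}) :=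
      hS.inter_right (isClosed_le continuous_const continuous_abs)
    rcases (S ∩ {u : ℝ | 1 / A ≤ |u|}).eq_empty_or_nonempty with he | hne'
    · refine ⟨1, one_pos, fun u hu hu' => ?_⟩
      have : u ∈ S ∩ {u : ℝ | 1 / A ≤ |u|} := ⟨hu, hu'⟩
      rw [he] at this
      exact this.elim
    · obtain ⟨u₀, hu₀, hmin⟩ := hcomp.exists_isMinOn hne' hcont.continuousOn
      refine ⟨_, sub_pos.2 (norm_charFun_lt hac hne (u := u₀) ?_), fun u hu hu' => hmin ⟨hu, hu'⟩⟩
      have h0 : 0 < |u₀| := lt_of_lt_of_le (by positivity) hu₀.2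
      exact abs_pos.1 h0
  refine ⟨A, min c₁ (min c₂ (ν.real Set.univ / 2)), hA, by positivity, fun u => ?_⟩
  by_cases h1 : |u| ≤ 1 / A
  · refine le_trans ?_ (hsmall u h1)
    gcongr
    · exact min_le_left _ _
    · exact min_le_right _ _
  · have h2 : min c₁ (min c₂ (ν.real Set.univ / 2)) * min 1 (u ^ 2) ≤
        min c₂ (ν.real Set.univ / 2) * 1 := by
      exact mul_le_mul (min_le_right _ _) (min_le_left _ _) (by positivity) (by positivity)
    rw [mul_one] at h2
    refine h2.trans ?_
    by_cases hu : u ∈ S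
    · exact (min_le_left _ _).trans (hmid u hu (not_le.1 h1).le)
    · have : ‖charFun ν u‖ < ν.real Set.univ / 2 := hS' hu
      refine (min_le_right _ _).trans ?_
      linarith

/-- The characteristic function of the base law tilted by `κ`. -/
noncomputable def tiltedCharFun (ρ : ℝ → ℝ) (κ u : ℝ) : ℂ :=
  complexMGF id (baseLaw ρ) (κ + u * Complex.I) / mgf id (baseLaw ρ) κ

/-- After a rotation b making the value real, the gap is the integral of a nonnegative function
against e^{κx}. Restricting to [-A, A], where small tilts are harmless, reduces it to the gap of the
untilted truncated law. -/
theorem IsAdmissible.norm_tiltedCharFun_le (hρ : IsAdmissible ρ) :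
    ∃ c κ₀ : ℝ, 0 < c ∧ 0 < κ₀ ∧ ∀ κ u : ℝ, |κ| < κ₀ →
      ‖tiltedCharFun ρ κ u‖ ≤ Real.exp (-(c * min 1 (u ^ 2))) := by
  have := hρ.isProbabilityMeasure
  obtain ⟨A, c, hA, hc, hgap⟩ := hρ.exists_truncLaw_gap
  obtain ⟨τ, hτ, hi⟩ := hρ.exists_strip
  -- The thresholds 4/3 and 2/3 are matched so that e^{κx} ≥ M/2 on [-A, A], where M is the
  -- normalizing constant.
  have hM : ∀ᶠ κ in 𝓝 (0 : ℝ), mgf id (baseLaw ρ) κ < 4 / 3 := by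
    have h := (differentiableAt_mgf hρ.zero_mem_interior).continuousAt.tendsto
    rw [mgf_zero] at h
    exact h.eventually (gt_mem_nhds (by norm_num))
  have hE : ∀ᶠ κ in 𝓝 (0 : ℝ), 2 / 3 < Real.exp (-(|κ| * A)) := by
    have h : Tendsto (fun κ : ℝ => Real.exp (-(|κ| * A))) (𝓝 0) (𝓝 (Real.exp (-(|0| * A)))) :=
      Continuous.tendsto (by fun_prop) 0
    rw [abs_zero, zero_mul, neg_zero, Real.exp_zero] at h
    exact h.eventually (lt_mem_nhds (by norm_num))
  obtain ⟨κ₁, hκ₁, hκ₁'⟩ := Metric.eventually_nhds_iff.1 (hM.and hE)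
  refine ⟨c / 2, min τ κ₁, by positivity, by positivity, fun κ u hκ => ?_⟩
  have hκi := hi κ (hκ.trans_le (min_le_left _ _))
  obtain ⟨hMκ, hEκ⟩ := hκ₁' (y := κ) (by simpa using hκ.trans_le (min_le_right _ _))
  have hMpos := hρ.mgf_pos hκi
  have hintexp : Integrable (fun x => Real.exp (κ * id x)) (baseLaw ρ) :=
    integrable_of_mem_integrableExpSet (interior_subset hκi)
  set φ := tiltedCharFun ρ κ u with hφ
  obtain ⟨b, hb, hb'⟩ := exists_norm_one_mul_eq_norm φ
  set M := mgf id (baseLaw ρ) κ with hMdef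
  have hintC : Integrable (fun x : ℝ => Complex.exp ((κ + u * Complex.I) * x)) (baseLaw ρ) :=
    integrable_cexp_mul_of_re_mem_interior_integrableExpSet (X := id) (z := κ + u * Complex.I)
      (by simpa using hκi)
  have hpt (x : ℝ) : (b * Complex.exp ((κ + u * Complex.I) * x)).re =
      Real.exp (κ * x) * (b * Complex.exp (u * x * Complex.I)).re := by
    have : b * Complex.exp ((κ + u * Complex.I) * x) =
        (Real.exp (κ * x) : ℂ) * (b * Complex.exp (u * x * Complex.I)) := by
      rw [mul_left_comm, Complex.ofReal_exp, ← Complex.exp_add]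
      push_cast
      ring_nf
    rw [this, Complex.re_ofReal_mul]
  have hid : M * (1 - ‖φ‖) =
      ∫ x, Real.exp (κ * x) * (1 - (b * Complex.exp (u * x * Complex.I)).re) ∂(baseLaw ρ) := by
    have h1 : (M : ℂ) * (b * φ) = ∫ x : ℝ, b * Complex.exp ((κ + u * Complex.I) * x) ∂(baseLaw ρ) := by
      rw [integral_const_mul, hφ, tiltedCharFun, ← hMdef, mul_left_comm]
      congr 1
      rw [mul_div_cancel₀ _ (by exact_mod_cast hMpos.ne')]
      rfl
    have h2 := congrArg Complex.re h1
    rw [hb', ← Complex.ofReal_mul, Complex.ofReal_re] at h2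
    have h3 := Complex.reCLM.integral_comp_comm (hintC.const_mul b)
    simp only [Complex.reCLM_apply] at h3
    rw [mul_sub, h2, ← h3, mul_one, hMdef, mgf, ← integral_sub hintexp (integrable_re (hintC.const_mul b))]
    refine integral_congr_ae (ae_of_all _ fun x => ?_)
    simp only [id]
    rw [hpt]; ring
  have hnn (x : ℝ) : 0 ≤ 1 - (b * Complex.exp (u * x * Complex.I)).re := by
    have := Complex.re_le_norm (b * Complex.exp (u * x * Complex.I))
    rw [norm_mul_exp_mul_I hb] at this
    linarith
  have hintR : Integrable (fun x : ℝ =>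
      Real.exp (κ * x) * (1 - (b * Complex.exp (u * x * Complex.I)).re)) (baseLaw ρ) := by
    refine (hintexp.sub (integrable_re (hintC.const_mul b))).congr (ae_of_all _ fun x => ?_)
    simp only [Pi.sub_apply, id]
    rw [hpt]; ring
  have hlow : M / 2 * (c * min 1 (u ^ 2)) ≤ M * (1 - ‖φ‖) := by
    rw [hid]
    calc M / 2 * (c * min 1 (u ^ 2)) ≤
          M / 2 * ((truncLaw ρ A).real Set.univ - ‖charFun (truncLaw ρ A) u‖) := by
          gcongr; exact hgap u
      _ ≤ M / 2 * ((truncLaw ρ A).real Set.univ - (b * charFun (truncLaw ρ A) u).re) := by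
          gcongr
          refine (Complex.re_le_norm _).trans ?_
          rw [norm_mul, hb, one_mul]
      _ = ∫ x in Set.Icc (-A) A, M / 2 *
          (1 - (b * Complex.exp (u * x * Complex.I)).re) ∂(baseLaw ρ) := by
          rw [integral_const_mul]
          congr 1
          have : IsFiniteMeasure (truncLaw ρ A) := by unfold truncLaw; infer_instance
          exact (integral_one_sub_re_mul_exp (truncLaw ρ A) b u).symm
      _ ≤ ∫ x in Set.Icc (-A) A, Real.exp (κ * x) *
          (1 - (b * Complex.exp (u * x * Complex.I)).re) ∂(baseLaw ρ) := by
          refine setIntegral_mono_on ?_ hintR.integrableOn measurableSet_Icc fun x hx => ?_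
          · exact (((integrable_const (1 : ℝ)).sub
              (integrable_re ((integrable_charFun_integrand _ u).const_mul b))).const_mul _
              ).integrableOn
          · refine mul_le_mul_of_nonneg_right ?_ (hnn x)
            have h1 : -(|κ| * A) ≤ κ * x := by
              have : |κ * x| ≤ |κ| * A := by
                rw [abs_mul]; gcongr; exact abs_le.2 hx
              exact (abs_le.1 this).1
            have h2 := Real.exp_le_exp.2 h1
            linarith
      _ ≤ _ := setIntegral_le_integral hintR
          (ae_of_all _ fun x => mul_nonneg (Real.exp_pos _).le (hnn x))
  have hfin : ‖φ‖ ≤ 1 - c / 2 * min 1 (u ^ 2) := by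
    have : M * (c / 2 * min 1 (u ^ 2)) ≤ M * (1 - ‖φ‖) := by linarith
    have := le_of_mul_le_mul_left this hMpos
    linarith
  refine hfin.trans ?_
  have := Real.add_one_le_exp (-(c / 2 * min 1 (u ^ 2)))
  linarith

end Decay

open scoped FourierTransform RealInnerProductSpace

/-! ### Fourier inversion for finite measures with integrable characteristic function. -/

section FourierInversion

variable {V : Type*} [NormedAddCommGroup V] [InnerProductSpace ℝ V]

theorem norm_cexp_inner_mul_I (x t : V) : ‖Complex.exp (⟪x, t⟫ * Complex.I)‖ = 1 :=
  Complex.norm_exp_ofReal_mul_I _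

variable [MeasurableSpace V]

theorem norm_charFun_mul_exp (μ : Measure V) (y t : V) :
    ‖charFun μ t * Complex.exp (-⟪y, t⟫ * Complex.I)‖ = ‖charFun μ t‖ := by
  rw [norm_mul, ← Complex.ofReal_neg, Complex.norm_exp_ofReal_mul_I, mul_one]

variable [FiniteDimensional ℝ V] [BorelSpace V]

theorem integrable_gaussian {b : ℝ} (hb : 0 < b) :
    Integrable fun t : V => Real.exp (-b * ‖t‖ ^ 2) := by
  have h := (GaussianFourier.integrable_cexp_neg_mul_sq_norm_add (V := V) (b := b)
    (by simpa using hb) 0 0).norm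
  refine h.congr (ae_of_all _ fun t => ?_)
  simp only [zero_mul, add_zero, Complex.norm_exp]
  congr 1
  rw [← Complex.ofReal_pow, ← Complex.ofReal_neg, ← Complex.ofReal_mul, Complex.ofReal_re]

/-- The Gaussian average of a characteristic function. -/
theorem integral_gaussian_mul_charFun (μ : Measure V) [IsFiniteMeasure μ] {b : ℝ} (hb : 0 < b)
    (y : V) :
    ∫ t, (Real.exp (-b * ‖t‖ ^ 2) : ℂ) * (charFun μ t * Complex.exp (-⟪y, t⟫ * Complex.I)) =
      ((∫ x, (Real.pi / b) ^ (Module.finrank ℝ V / 2 : ℝ) *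
        Real.exp (-(4 * b)⁻¹ * ‖x - y‖ ^ 2) ∂μ : ℝ) : ℂ) := by
  have h1 : ∀ t : V,
      (Real.exp (-b * ‖t‖ ^ 2) : ℂ) * (charFun μ t * Complex.exp (-⟪y, t⟫ * Complex.I)) =
      ∫ x, Complex.exp (-b * ‖t‖ ^ 2 + Complex.I * ⟪x - y, t⟫) ∂μ := by
    intro t
    rw [charFun_apply, ← integral_mul_const, ← integral_const_mul]
    refine integral_congr_ae (ae_of_all _ fun x => ?_)
    simp only
    rw [Complex.ofReal_exp, ← Complex.exp_add, ← Complex.exp_add, inner_sub_left]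
    push_cast
    ring_nf
  simp_rw [h1]
  rw [integral_integral_swap, ← integral_complex_ofReal]
  · refine integral_congr_ae (ae_of_all _ fun x => ?_)
    simp only
    rw [GaussianFourier.integral_cexp_neg_mul_sq_norm_add (by simpa using hb), Complex.I_sq,
      Complex.ofReal_mul, Complex.ofReal_cpow (by positivity), Complex.ofReal_exp]
    congr 2
    · push_cast; rfl
    · push_cast; rfl
    · push_cast; field_simp
  · have hi := (integrable_gaussian (V := V) hb).mul_prod (integrable_const (μ := μ) (1 : ℝ))
    refine hi.mono (by fun_prop) (ae_of_all _ fun p => ?_)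
    simp only [Function.uncurry, mul_one]
    rw [Complex.exp_add, norm_mul, mul_comm Complex.I, norm_cexp_inner_mul_I, mul_one,
      Complex.norm_exp, Real.norm_of_nonneg (Real.exp_pos _).le]
    refine le_of_eq ?_
    congr 1
    rw [← Complex.ofReal_pow, ← Complex.ofReal_neg, ← Complex.ofReal_mul, Complex.ofReal_re]

/-- The inverse Fourier transform of the characteristic function of `μ`. -/
noncomputable def invCharFun (μ : Measure V) (y : V) : ℂ :=
  ((2 * Real.pi) ^ Module.finrank ℝ V)⁻¹ * ∫ t, charFun μ t * Complex.exp (-⟪y, t⟫ * Complex.I)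

theorem continuous_invCharFun {μ : Measure V} [IsFiniteMeasure μ] (h : Integrable (charFun μ)) :
    Continuous (invCharFun μ) := by
  refine continuous_const.mul (continuous_of_dominated (fun y => ?_)
    (fun y => ae_of_all _ fun t => (norm_charFun_mul_exp μ y t).le) h.norm
    (ae_of_all _ fun t => by fun_prop))
  exact (h.1.mul (by fun_prop))

/-- Gaussian regularization of the inversion integral, removed by dominated convergence. The
regularized integrals are averages of μ against positive kernels, which is the source of
nonnegativity and of the mass bound. -/
theorem tendsto_gaussian_average {μ : Measure V} [IsFiniteMeasure μ] (h : Integrable (charFun μ))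
    (y : V) : Tendsto (fun n : ℕ => ∫ x, ((2 * Real.pi) ^ Module.finrank ℝ V)⁻¹ *
      ((Real.pi / (1 / ((n : ℝ) + 1))) ^ (Module.finrank ℝ V / 2 : ℝ) *
        Real.exp (-(4 * (1 / ((n : ℝ) + 1)))⁻¹ * ‖x - y‖ ^ 2)) ∂μ) atTop
      (𝓝 (invCharFun μ y).re) := by
  have h1 : Tendsto (fun n : ℕ => ∫ t, (Real.exp (-(1 / ((n : ℝ) + 1)) * ‖t‖ ^ 2) : ℂ) *
      (charFun μ t * Complex.exp (-⟪y, t⟫ * Complex.I))) atTop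
      (𝓝 (∫ t, charFun μ t * Complex.exp (-⟪y, t⟫ * Complex.I))) := by
    refine tendsto_integral_of_dominated_convergence (fun t => ‖charFun μ t‖) (fun n => ?_)
      h.norm (fun n => ae_of_all _ fun t => ?_) (ae_of_all _ fun t => ?_)
    · exact AEStronglyMeasurable.mul (by fun_prop) (h.1.mul (by fun_prop))
    · rw [norm_mul, norm_charFun_mul_exp, Complex.norm_real,
        Real.norm_of_nonneg (Real.exp_pos _).le]
      refine mul_le_of_le_one_left (norm_nonneg _) (Real.exp_le_one_iff.2 ?_)
      have : 0 ≤ 1 / ((n : ℝ) + 1) := by positivity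
      nlinarith [sq_nonneg ‖t‖]
    · have h2 : Tendsto (fun n : ℕ => (Real.exp (-(1 / ((n : ℝ) + 1)) * ‖t‖ ^ 2) : ℂ)) atTop
          (𝓝 ((Real.exp (-0 * ‖t‖ ^ 2) : ℝ) : ℂ)) := by
        refine (Complex.continuous_ofReal.tendsto _).comp ?_
        refine (Real.continuous_exp.tendsto _).comp ?_
        exact (tendsto_one_div_add_atTop_nhds_zero_nat.neg).mul_const _
      simpa using h2.mul_const (charFun μ t * Complex.exp (-⟪y, t⟫ * Complex.I))
  have h2 := (Complex.continuous_re.tendsto _).comp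
    (h1.const_mul ((((2 * Real.pi) ^ Module.finrank ℝ V)⁻¹ : ℝ) : ℂ))
  refine h2.congr fun n => ?_
  simp only [Function.comp]
  rw [integral_gaussian_mul_charFun μ (by positivity), Complex.re_ofReal_mul, Complex.ofReal_re,
    ← integral_const_mul]

theorem invCharFun_re_nonneg {μ : Measure V} [IsFiniteMeasure μ] (h : Integrable (charFun μ))
    (y : V) : 0 ≤ (invCharFun μ y).re :=
  ge_of_tendsto' (tendsto_gaussian_average h y) fun n => integral_nonneg fun x => by positivity

theorem invCharFun_im {μ : Measure V} [IsFiniteMeasure μ] (y : V) :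
    ((invCharFun μ y).re : ℂ) = invCharFun μ y := by
  rw [← Complex.conj_eq_iff_re, invCharFun, map_mul, ← integral_conj,
    ← integral_neg_eq_self (μ := (volume : Measure V))]
  congr 1
  · simp only [Complex.conj_ofReal]
  · refine integral_congr_ae (ae_of_all _ fun t => ?_)
    simp only [map_mul, charFun_neg, ← Complex.exp_conj, map_neg, Complex.conj_I,
      Complex.conj_ofReal, inner_neg_right]
    simp

theorem integral_normalized_gaussian {b : ℝ} (hb : 0 < b) :
    ∫ y : V, ((2 * Real.pi) ^ Module.finrank ℝ V)⁻¹ *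
      ((Real.pi / b) ^ (Module.finrank ℝ V / 2 : ℝ) * Real.exp (-(4 * b)⁻¹ * ‖y‖ ^ 2)) = 1 := by
  have hpi := Real.pi_pos
  rw [integral_const_mul, integral_const_mul, GaussianFourier.integral_rexp_neg_mul_sq_norm
    (by positivity), ← Real.mul_rpow (by positivity) (by positivity)]
  have : Real.pi / b * (Real.pi / (4 * b)⁻¹) = (2 * Real.pi) ^ (2 : ℝ) := by
    rw [Real.rpow_two]; field_simp; ring
  rw [this, ← Real.rpow_mul (by positivity), mul_div_cancel₀ _ (two_ne_zero), Real.rpow_natCast]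
  exact inv_mul_cancel₀ (by positivity)

/-- Each Gaussian average has total mass μ(V) by Tonelli's theorem, and Fatou's lemma passes the
bound to the limit. -/
theorem lintegral_invCharFun_le {μ : Measure V} [IsFiniteMeasure μ] (h : Integrable (charFun μ)) :
    ∫⁻ y, ENNReal.ofReal (invCharFun μ y).re ≤ μ Set.univ := by
  set d := Module.finrank ℝ V
  let g : ℕ → V → ℝ := fun n z => ((2 * Real.pi) ^ d)⁻¹ *
      ((Real.pi / (1 / ((n : ℝ) + 1))) ^ (d / 2 : ℝ) *
        Real.exp (-(4 * (1 / ((n : ℝ) + 1)))⁻¹ * ‖z‖ ^ 2))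
  have hg0 (n : ℕ) (z : V) : 0 ≤ g n z := by positivity
  have hgc (n : ℕ) : Continuous (g n) := by fun_prop
  have hgi (n : ℕ) : Integrable (g n) := .of_integral_ne_zero (by
    rw [integral_normalized_gaussian (V := V) (b := 1 / ((n : ℝ) + 1)) (by positivity)]
    exact one_ne_zero)
  have hglin (n : ℕ) : ∫⁻ z, ENNReal.ofReal (g n z) = 1 := by
    rw [← ofReal_integral_eq_lintegral_ofReal (hgi n) (ae_of_all _ (hg0 n)),
      integral_normalized_gaussian (V := V) (b := 1 / ((n : ℝ) + 1)) (by positivity),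
      ENNReal.ofReal_one]
  have hlim (y : V) : ENNReal.ofReal (invCharFun μ y).re =
      liminf (fun n => ∫⁻ x, ENNReal.ofReal (g n (x - y)) ∂μ) atTop := by
    symm
    refine Tendsto.liminf_eq ?_
    refine ((ENNReal.continuous_ofReal.tendsto _).comp (tendsto_gaussian_average h y)).congr
      fun n => ?_
    rw [Function.comp, ofReal_integral_eq_lintegral_ofReal]
    · refine (integrable_const (((2 * Real.pi) ^ d)⁻¹ *
        (Real.pi / (1 / ((n : ℝ) + 1))) ^ (d / 2 : ℝ))).mono
        (Continuous.aestronglyMeasurable (by fun_prop)) (ae_of_all _ fun x => ?_)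
      rw [Real.norm_of_nonneg (by positivity), Real.norm_of_nonneg (by positivity), ← mul_assoc]
      refine mul_le_of_le_one_right (by positivity) (Real.exp_le_one_iff.2 ?_)
      have : 0 ≤ (4 * (1 / ((n : ℝ) + 1)))⁻¹ := by positivity
      nlinarith [sq_nonneg ‖x - y‖]
    · exact ae_of_all _ fun x => hg0 n _
  simp_rw [hlim]
  have hmeas (n : ℕ) : Measurable (fun p : V × V => ENNReal.ofReal (g n (p.2 - p.1))) := by
    have := (hgc n).comp (continuous_snd.sub continuous_fst : Continuous fun p : V × V => p.2 - p.1)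
    exact this.measurable.ennreal_ofReal
  refine (lintegral_liminf_le fun n => ?_).trans ?_
  · exact (hmeas n).lintegral_prod_right'
  refine liminf_le_of_frequently_le' (Frequently.of_forall fun n => ?_)
  rw [lintegral_lintegral_swap (hmeas n).aemeasurable]
  have (x : V) : ∫⁻ y, ENNReal.ofReal (g n (x - y)) = 1 := by
    rw [← hglin n]
    exact lintegral_sub_left_eq_self (fun z => ENNReal.ofReal (g n z)) x
  simp [this]

/-- A finite measure with integrable characteristic function has a continuous density, given by
Fourier inversion. -/
theorem eq_withDensity_invCharFun {μ : Measure V} [IsFiniteMeasure μ]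
    (h : Integrable (charFun μ)) :
    μ = volume.withDensity fun y => ENNReal.ofReal (invCharFun μ y).re := by
  have hcont := continuous_invCharFun h
  have hmeas : Measurable fun y => ENNReal.ofReal (invCharFun μ y).re :=
    (Complex.measurable_re.comp hcont.measurable).ennreal_ofReal
  have hlt : ∫⁻ y, ENNReal.ofReal (invCharFun μ y).re < ⊤ :=
    (lintegral_invCharFun_le h).trans_lt (measure_lt_top _ _)
  have hfin : IsFiniteMeasure (volume.withDensity fun y => ENNReal.ofReal (invCharFun μ y).re) :=
    isFiniteMeasure_withDensity hlt.ne
  have hint : Integrable (invCharFun μ) := by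
    refine ⟨hcont.aestronglyMeasurable, ?_⟩
    rw [HasFiniteIntegral]
    refine lt_of_eq_of_lt (lintegral_congr fun y => ?_) hlt
    rw [← invCharFun_im y, ← ofReal_norm, Complex.norm_real,
      Real.norm_of_nonneg (invCharFun_re_nonneg h y), Complex.ofReal_re]
  have hpi := Real.pi_pos
  have h2pi : (2 * Real.pi) ≠ 0 := by positivity
  -- The dilation converts between the convention e^{i⟨x,t⟩} of `charFun` and the convention
  -- e^{-2πi⟨x,t⟩} of `𝓕`.
  let φ : V → ℂ := fun t => charFun μ ((2 * Real.pi) • t)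
  have hφc : Continuous φ := continuous_charFun.comp (continuous_const_smul _)
  have hφi : Integrable φ := h.comp_smul h2pi
  have hF : 𝓕 φ = invCharFun μ := by
    ext y
    rw [Real.fourier_eq', invCharFun]
    have := Measure.integral_comp_smul (volume : Measure V)
      (fun t => charFun μ t * Complex.exp (-⟪y, t⟫ * Complex.I)) (2 * Real.pi)
    rw [abs_of_pos (by positivity)] at this
    have e : ∫ v, Complex.exp ((-2 * Real.pi * ⟪v, y⟫ : ℝ) * Complex.I) • φ v =
        ∫ t, (fun t => charFun μ t * Complex.exp (-⟪y, t⟫ * Complex.I)) ((2 * Real.pi) • t) := by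
      refine integral_congr_ae (ae_of_all _ fun v => ?_)
      simp only [φ, smul_eq_mul, inner_smul_right, real_inner_comm y v]
      rw [mul_comm]
      push_cast
      ring_nf
    rw [e, this, Complex.real_smul]
  have hinv := hφc.fourierInv_fourier_eq hφi (by rw [hF]; exact hint)
  rw [hF] at hinv
  refine Measure.ext_of_charFun (funext fun t => ?_)
  have h3 := congrFun hinv ((2 * Real.pi)⁻¹ • t)
  simp only [φ, smul_smul, mul_inv_cancel₀ h2pi, one_smul] at h3
  rw [← h3, Real.fourierInv_eq', charFun_apply,
    integral_withDensity_eq_integral_toReal_smul hmeas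
      (ae_of_all _ fun x => ENNReal.ofReal_lt_top)]
  refine integral_congr_ae (ae_of_all _ fun v => ?_)
  simp only
  rw [ENNReal.toReal_ofReal (invCharFun_re_nonneg h v), Complex.real_smul, invCharFun_im,
    smul_eq_mul, mul_comm, inner_smul_right, mul_inv_cancel_left₀ h2pi]

end FourierInversion

/-! ### Uniform L^N bounds for characteristic functions of densities in L^{1+ε}. -/

section FourierIntegrability

/-- The finite measure with Lebesgue density `f`. -/
noncomputable def densityMeasure (f : ℝ → ℝ) : Measure ℝ :=
  volume.withDensity fun x => ENNReal.ofReal (f x)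

theorem isFiniteMeasure_densityMeasure {f : ℝ → ℝ} (hf : Integrable f) :
    IsFiniteMeasure (densityMeasure f) :=
  isFiniteMeasure_withDensity_ofReal hf.2

theorem integral_densityMeasure {f : ℝ → ℝ} (hf : Measurable f) (hf0 : ∀ x, 0 ≤ f x)
    {E : Type*} [NormedAddCommGroup E] [NormedSpace ℝ E] (g : ℝ → E) :
    ∫ x, g x ∂(densityMeasure f) = ∫ x, f x • g x := by
  rw [densityMeasure, integral_withDensity_eq_integral_toReal_smul hf.ennreal_ofReal
    (ae_of_all _ fun x => ENNReal.ofReal_lt_top)]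
  simp_rw [ENNReal.toReal_ofReal (hf0 _)]

theorem densityMeasure_real_univ {f : ℝ → ℝ} (hf : Measurable f) (hf0 : ∀ x, 0 ≤ f x) :
    (densityMeasure f).real Set.univ = ∫ x, f x := by
  have := integral_densityMeasure hf hf0 fun _ => (1 : ℝ)
  simpa using this

theorem ennreal_two_mul_le_add_sq (a b : ENNReal) : 2 * a * b ≤ a ^ 2 + b ^ 2 := by
  wlog h : a ≤ b generalizing a b
  · have := this b a (le_of_not_ge h)
    rwa [mul_right_comm, add_comm] at this
  obtain ⟨c, rfl⟩ := exists_add_of_le h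
  calc 2 * a * (a + c) ≤ 2 * a * (a + c) + c ^ 2 := le_self_add
    _ = a ^ 2 + (a + c) ^ 2 := by ring

/-- From 2ab ≤ a² + b² and translation invariance. The factor 2 is kept on both sides to avoid
dividing in `ENNReal`. -/
theorem lintegral_lintegral_mul_mul_le {f k : ℝ → ENNReal} (hf : Measurable f) (hk : Measurable k) :
    2 * ∫⁻ x, ∫⁻ y, f x * f y * k (x - y) ≤ 2 * ((∫⁻ x, f x ^ 2) * ∫⁻ z, k z) := by
  have h1 : ∫⁻ x, ∫⁻ y, f x ^ 2 * k (x - y) = (∫⁻ x, f x ^ 2) * ∫⁻ z, k z := by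
    rw [← lintegral_mul_const _ (by fun_prop)]
    refine lintegral_congr fun x => ?_
    rw [lintegral_const_mul _ (by fun_prop), lintegral_sub_left_eq_self (fun z => k z) x]
  have h2 : ∫⁻ x, ∫⁻ y, f y ^ 2 * k (x - y) = (∫⁻ x, f x ^ 2) * ∫⁻ z, k z := by
    rw [lintegral_lintegral_swap (by fun_prop), ← lintegral_mul_const _ (by fun_prop)]
    refine lintegral_congr fun y => ?_
    rw [lintegral_const_mul _ (by fun_prop), lintegral_sub_right_eq_self (fun z => k z) y]
  calc 2 * ∫⁻ x, ∫⁻ y, f x * f y * k (x - y)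
      = ∫⁻ x, ∫⁻ y, 2 * (f x * f y * k (x - y)) := by
        rw [← lintegral_const_mul _ (by fun_prop)]
        refine lintegral_congr fun x => ?_
        rw [← lintegral_const_mul _ (by fun_prop)]
    _ ≤ ∫⁻ x, ∫⁻ y, (f x ^ 2 * k (x - y) + f y ^ 2 * k (x - y)) := by
        refine lintegral_mono fun x => lintegral_mono fun y => ?_
        simp only
        rw [← add_mul, ← mul_assoc, ← mul_assoc]
        gcongr
        exact ennreal_two_mul_le_add_sq (f x) (f y)
    _ = (∫⁻ x, ∫⁻ y, f x ^ 2 * k (x - y)) + ∫⁻ x, ∫⁻ y, f y ^ 2 * k (x - y) := by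
        rw [← lintegral_add_left (by fun_prop)]
        refine lintegral_congr fun x => ?_
        rw [lintegral_add_left (by fun_prop)]
    _ = _ := by rw [h1, h2, two_mul]

/-- The `L²` bound for the Fourier transform of an integrable, square integrable function. -/
theorem lintegral_charFun_sq_le {f : ℝ → ℝ} (hf : Measurable f) (hi : Integrable f) :
    ∫⁻ u, ENNReal.ofReal (‖charFun (densityMeasure f) u‖ ^ 2) ≤
      (∫⁻ x, ENNReal.ofReal (f x) ^ 2) * ENNReal.ofReal (2 * Real.pi) := by
  have hpi := Real.pi_pos
  have hfin := isFiniteMeasure_densityMeasure hi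
  set ν := densityMeasure f with hν
  -- Symmetrization: the characteristic function of η is |φ|², so the Gaussian average of |φ|²
  -- becomes an integral of a Gaussian kernel against η.
  set η := ν ∗ ν.map (fun x => (-1 : ℝ) * x) with hη
  have hfin2 : IsFiniteMeasure (ν.map (fun x => (-1 : ℝ) * x)) := inferInstance
  have hchar (u : ℝ) : charFun η u = ((‖charFun ν u‖ ^ 2 : ℝ) : ℂ) := by
    rw [hη, charFun_conv, charFun_map_mul, neg_one_mul, charFun_neg, Complex.mul_conj,
      Complex.normSq_eq_norm_sq]
  have hb (n : ℕ) : ∫⁻ u, ENNReal.ofReal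
      (Real.exp (-(1 / ((n : ℝ) + 1)) * ‖u‖ ^ 2) * ‖charFun ν u‖ ^ 2) ≤
      (∫⁻ x, ENNReal.ofReal (f x) ^ 2) * ENNReal.ofReal (2 * Real.pi) := by
    set b : ℝ := 1 / ((n : ℝ) + 1) with hb
    have hbpos : 0 < b := by positivity
    let k : ℝ → ℝ := fun z => (Real.pi / b) ^ ((Module.finrank ℝ ℝ : ℝ) / 2) *
      Real.exp (-(4 * b)⁻¹ * ‖z‖ ^ 2)
    have hk0 (z : ℝ) : 0 ≤ k z := by positivity
    have hkc : Continuous k := by fun_prop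
    have hkint : ∫ z, k z = 2 * Real.pi := by
      have := integral_normalized_gaussian (V := ℝ) hbpos
      rw [integral_const_mul] at this
      rw [Module.finrank_self, pow_one] at this
      have h2 : ∫ z, k z = 2 * Real.pi * ((2 * Real.pi)⁻¹ * ∫ z, k z) := by
        field_simp
      rw [h2]
      simp only [k, Module.finrank_self]
      rw [this, mul_one]
    have hki : Integrable k := .of_integral_ne_zero (by rw [hkint]; positivity)
    have h1 := integral_gaussian_mul_charFun η hbpos 0
    simp only [hchar, inner_zero_left, Complex.ofReal_zero, neg_zero, zero_mul, Complex.exp_zero,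
      mul_one, sub_zero] at h1
    simp only [← Complex.ofReal_mul] at h1
    rw [integral_complex_ofReal] at h1
    have h1' : ∫ t, Real.exp (-b * ‖t‖ ^ 2) * ‖charFun ν t‖ ^ 2 = ∫ x, k x ∂η := by
      exact_mod_cast h1
    have hintL : Integrable (fun t : ℝ => Real.exp (-b * ‖t‖ ^ 2) * ‖charFun ν t‖ ^ 2) := by
      refine ((integrable_gaussian (V := ℝ) hbpos).mul_const (ν.real Set.univ ^ 2)).mono
        (Continuous.aestronglyMeasurable (by have := continuous_charFun (μ := ν); fun_prop))
        (ae_of_all _ fun t => ?_)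
      have h0 : 0 ≤ ν.real Set.univ := measureReal_nonneg
      rw [norm_mul, norm_mul, norm_pow, norm_pow, norm_norm, Real.norm_of_nonneg h0]
      gcongr
      exact norm_charFun_le t
    have hintR : Integrable k η := by
      refine (integrable_const ((Real.pi / b) ^ ((Module.finrank ℝ ℝ : ℝ) / 2))).mono
        hkc.aestronglyMeasurable (ae_of_all _ fun x => ?_)
      rw [Real.norm_of_nonneg (hk0 x), Real.norm_of_nonneg (by positivity)]
      refine mul_le_of_le_one_right (by positivity) (Real.exp_le_one_iff.2 ?_)
      have : 0 ≤ (4 * b)⁻¹ := by positivity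
      nlinarith [sq_nonneg ‖x‖]
    rw [← ofReal_integral_eq_lintegral_ofReal hintL (ae_of_all _ fun t => by positivity), h1',
      ofReal_integral_eq_lintegral_ofReal hintR (ae_of_all _ hk0), hη,
      Measure.lintegral_conv (by fun_prop)]
    have h2 (x : ℝ) : ∫⁻ y, ENNReal.ofReal (k (x + y)) ∂(ν.map (fun x => (-1 : ℝ) * x)) =
        ∫⁻ y, ENNReal.ofReal (f y) * ENNReal.ofReal (k (x - y)) := by
      rw [lintegral_map (by fun_prop) (by fun_prop), hν, densityMeasure,
        lintegral_withDensity_eq_lintegral_mul _ hf.ennreal_ofReal (by fun_prop)]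
      refine lintegral_congr fun y => ?_
      simp only [Pi.mul_apply, neg_one_mul, sub_eq_add_neg]
    simp_rw [h2]
    have hm : Measurable fun x => ∫⁻ y, ENNReal.ofReal (f y) * ENNReal.ofReal (k (x - y)) := by
      refine Measurable.lintegral_prod_right' (f := fun p : ℝ × ℝ =>
        ENNReal.ofReal (f p.2) * ENNReal.ofReal (k (p.1 - p.2))) ?_
      fun_prop
    rw [hν, densityMeasure, lintegral_withDensity_eq_lintegral_mul _ hf.ennreal_ofReal hm]
    have h3 := lintegral_lintegral_mul_mul_le (f := fun x => ENNReal.ofReal (f x))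
      (k := fun z => ENNReal.ofReal (k z)) (by fun_prop) (by fun_prop)
    rw [ENNReal.mul_le_mul_iff_right two_ne_zero ENNReal.ofNat_ne_top,
      ← ofReal_integral_eq_lintegral_ofReal hki (ae_of_all _ hk0), hkint] at h3
    refine le_trans (le_of_eq (lintegral_congr fun x => ?_)) h3
    simp only [Pi.mul_apply]
    rw [← lintegral_const_mul _ (by fun_prop)]
    simp only [mul_assoc]
  have hlim (u : ℝ) : ENNReal.ofReal (‖charFun ν u‖ ^ 2) = liminf (fun n : ℕ => ENNReal.ofReal
      (Real.exp (-(1 / ((n : ℝ) + 1)) * ‖u‖ ^ 2) * ‖charFun ν u‖ ^ 2)) atTop := by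
    symm
    refine Tendsto.liminf_eq ?_
    refine (ENNReal.continuous_ofReal.tendsto _).comp ?_
    have h2 : Tendsto (fun n : ℕ => Real.exp (-(1 / ((n : ℝ) + 1)) * ‖u‖ ^ 2)) atTop
        (𝓝 (Real.exp (-0 * ‖u‖ ^ 2))) :=
      (Real.continuous_exp.tendsto _).comp
        ((tendsto_one_div_add_atTop_nhds_zero_nat.neg).mul_const _)
    simpa using h2.mul_const (‖charFun ν u‖ ^ 2)
  simp_rw [hlim]
  refine (lintegral_liminf_le fun n => ?_).trans
    (liminf_le_of_frequently_le' (Frequently.of_forall hb))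
  have := continuous_charFun (μ := ν)
  fun_prop

/-- Where f > l one has f ≤ f^{1+ε} l^{-ε}. The part of f cut off above level l therefore has mass
at most C l^{-ε}, and this bounds its characteristic function. -/
theorem densityMeasure_real_univ_sub_le {f : ℝ → ℝ} {ε C l : ℝ} (hf : Measurable f)
    (hf0 : ∀ x, 0 ≤ f x) (hi : Integrable f) (hε : 0 < ε)
    (hi' : Integrable fun x => f x ^ (1 + ε)) (hC : ∫ x, f x ^ (1 + ε) ≤ C) (hl : 0 < l) (u : ℝ) :
    ‖charFun (densityMeasure f) u‖ ≤
      ‖charFun (densityMeasure ({x | f x ≤ l}.indicator f)) u‖ + C * l ^ (-ε) := by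
  have hS : MeasurableSet {x | f x ≤ l} := measurableSet_le hf measurable_const
  have hs0 (x : ℝ) : 0 ≤ {x | f x ≤ l}.indicator f x := Set.indicator_nonneg (fun x _ => hf0 x) x
  have hb0 (x : ℝ) : 0 ≤ {x | f x ≤ l}ᶜ.indicator f x := Set.indicator_nonneg (fun x _ => hf0 x) x
  have hfin := isFiniteMeasure_densityMeasure (hi.indicator hS.compl)
  have hdec : charFun (densityMeasure f) u = charFun (densityMeasure ({x | f x ≤ l}.indicator f)) u
      + charFun (densityMeasure ({x | f x ≤ l}ᶜ.indicator f)) u := by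
    have hint {g : ℝ → ℝ} (hg : Integrable g) :
        Integrable fun x : ℝ => g x • Complex.exp (u * x * Complex.I) := by
      refine hg.mono (hg.1.smul (by fun_prop)) (ae_of_all _ fun x => ?_)
      have : ‖Complex.exp (u * x * Complex.I)‖ = 1 := by
        exact_mod_cast Complex.norm_exp_ofReal_mul_I (u * x)
      rw [norm_smul, this, mul_one]
    rw [charFun_apply_real, charFun_apply_real, charFun_apply_real, integral_densityMeasure hf hf0,
      integral_densityMeasure (hf.indicator hS) hs0,
      integral_densityMeasure (hf.indicator hS.compl) hb0,
      ← integral_add (hint (hi.indicator hS)) (hint (hi.indicator hS.compl))]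
    refine integral_congr_ae (ae_of_all _ fun x => ?_)
    simp only [← add_smul]
    congr 1
    exact (congrFun (Set.indicator_self_add_compl {x | f x ≤ l} f) x).symm
  rw [hdec]
  refine (norm_add_le _ _).trans ?_
  gcongr
  refine (norm_charFun_le u).trans ?_
  rw [densityMeasure_real_univ (hf.indicator hS.compl) hb0]
  calc ∫ x, {x | f x ≤ l}ᶜ.indicator f x ≤ ∫ x, f x ^ (1 + ε) * l ^ (-ε) := by
        refine integral_mono (hi.indicator hS.compl) (hi'.mul_const _) fun x => ?_
        by_cases hx : f x ≤ l
        · have : x ∉ {x | f x ≤ l}ᶜ := by simpa using hx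
          rw [Set.indicator_of_notMem this]
          have := hf0 x
          positivity
        · have : x ∈ {x | f x ≤ l}ᶜ := hx
          rw [Set.indicator_of_mem this]
          have hx' : l < f x := not_le.1 hx
          have hfx : 0 < f x := hl.trans hx'
          rw [Real.rpow_add hfx, Real.rpow_one, mul_assoc, Real.rpow_neg hl.le]
          refine le_mul_of_one_le_right hfx.le ?_
          rw [← div_eq_mul_inv, one_le_div (by positivity)]
          gcongr
    _ ≤ C * l ^ (-ε) := by
        rw [integral_mul_const]
        gcongr

/-- Where f ≤ l one has f² ≤ f^{1+ε} l^{1-ε}: the bounded part lies in L². -/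
theorem lintegral_indicator_sq_le {f : ℝ → ℝ} {ε C l : ℝ}
    (hf0 : ∀ x, 0 ≤ f x) (hε : 0 < ε) (hε1 : ε ≤ 1)
    (hi' : Integrable fun x => f x ^ (1 + ε)) (hC : ∫ x, f x ^ (1 + ε) ≤ C) (hl : 0 < l) :
    ∫⁻ x, ENNReal.ofReal ({x | f x ≤ l}.indicator f x) ^ 2 ≤
      ENNReal.ofReal (C * l ^ (1 - ε)) := by
  calc ∫⁻ x, ENNReal.ofReal ({x | f x ≤ l}.indicator f x) ^ 2
      ≤ ∫⁻ x, ENNReal.ofReal (f x ^ (1 + ε) * l ^ (1 - ε)) := by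
        refine lintegral_mono fun x => ?_
        simp only
        rw [← ENNReal.ofReal_pow (Set.indicator_nonneg (fun x _ => hf0 x) x)]
        refine ENNReal.ofReal_le_ofReal ?_
        by_cases hx : f x ≤ l
        · have : x ∈ {x | f x ≤ l} := hx
          rw [Set.indicator_of_mem this]
          have : f x ^ 2 = f x ^ (1 + ε) * f x ^ (1 - ε) := by
            rw [← Real.rpow_add_of_nonneg (hf0 x) (by linarith) (by linarith),
              show (1 + ε) + (1 - ε) = 2 by ring, Real.rpow_two]
          rw [this]
          have := hf0 x
          gcongr
        · have : x ∉ {x | f x ≤ l} := hx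
          rw [Set.indicator_of_notMem this, zero_pow two_ne_zero]
          have := hf0 x
          positivity
    _ = ENNReal.ofReal (∫ x, f x ^ (1 + ε) * l ^ (1 - ε)) := by
        refine (ofReal_integral_eq_lintegral_ofReal (hi'.mul_const _) (ae_of_all _ fun x => ?_)).symm
        have := hf0 x
        positivity
    _ ≤ _ := by
        rw [integral_mul_const]
        refine ENNReal.ofReal_le_ofReal ?_
        gcongr

/-- A weak type bound: functions bounded in `L¹⁺ᵉ` have Fourier transforms with polynomially
small level sets. -/
theorem volume_charFun_ge_le {f : ℝ → ℝ} {ε C : ℝ} (hf : Measurable f)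
    (hf0 : ∀ x, 0 ≤ f x) (hi : Integrable f) (hε : 0 < ε) (hε1 : ε ≤ 1)
    (hi' : Integrable fun x => f x ^ (1 + ε)) (hC : ∫ x, f x ^ (1 + ε) ≤ C) (hC1 : 1 ≤ C)
    {m : ℕ} (hm : 1 / ε ≤ m) {s : ℝ} (hs : 0 < s) (hs1 : s ≤ 1) :
    volume {u | s ≤ ‖charFun (densityMeasure f) u‖} ≤
      ENNReal.ofReal (8 * Real.pi * C * (2 * C) ^ m * (s ^ (m + 2))⁻¹) := by
  have hpi := Real.pi_pos
  -- At this level the part above l contributes exactly s/2 to the bound. The part below must then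
  -- reach s/2, and Chebyshev's inequality is applied with its L² bound.
  set l : ℝ := (2 * C / s) ^ (1 / ε) with hldef
  have hbase : 1 ≤ 2 * C / s := by rw [one_le_div hs]; linarith
  have hl : 0 < l := by positivity
  have hlε : C * l ^ (-ε) = s / 2 := by
    rw [hldef, ← Real.rpow_mul (by positivity), show 1 / ε * -ε = -1 by field_simp,
      Real.rpow_neg_one, inv_div]
    field_simp
  have hl1 : l ^ (1 - ε) ≤ (2 * C / s) ^ m := by
    rw [hldef, ← Real.rpow_mul (by positivity), ← Real.rpow_natCast]
    refine Real.rpow_le_rpow_of_exponent_le hbase (le_trans ?_ hm)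
    rw [one_div, mul_sub, mul_one, inv_mul_cancel₀ hε.ne']
    linarith
  have hS : MeasurableSet {x | f x ≤ l} := measurableSet_le hf measurable_const
  have hfin := isFiniteMeasure_densityMeasure (hi.indicator hS)
  set ψ := charFun (densityMeasure ({x | f x ≤ l}.indicator f)) with hψ
  have hcont : Continuous ψ := continuous_charFun
  have hsub : {u | s ≤ ‖charFun (densityMeasure f) u‖} ⊆
      {u | ENNReal.ofReal (s ^ 2 / 4) ≤ ENNReal.ofReal (‖ψ u‖ ^ 2)} := by
    intro u hu
    have h1 := densityMeasure_real_univ_sub_le hf hf0 hi hε hi' hC hl u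
    rw [hlε] at h1
    have h2 : s / 2 ≤ ‖ψ u‖ := by
      have : s ≤ ‖charFun (densityMeasure f) u‖ := hu
      linarith
    refine ENNReal.ofReal_le_ofReal ?_
    calc s ^ 2 / 4 = (s / 2) ^ 2 := by ring
      _ ≤ _ := by gcongr
  refine (measure_mono hsub).trans ?_
  refine (meas_ge_le_lintegral_div (by fun_prop) (by simpa using sq_pos_of_pos hs)
    ENNReal.ofReal_ne_top).trans ?_
  have h3 := (lintegral_charFun_sq_le (hf.indicator hS) (hi.indicator hS)).trans
    (mul_le_mul_left (lintegral_indicator_sq_le hf0 hε hε1 hi' hC hl) _)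
  refine (ENNReal.div_le_div_right h3 _).trans ?_
  rw [← ENNReal.ofReal_mul (by positivity), ← ENNReal.ofReal_div_of_pos (by positivity)]
  refine ENNReal.ofReal_le_ofReal ?_
  calc C * l ^ (1 - ε) * (2 * Real.pi) / (s ^ 2 / 4)
      ≤ C * (2 * C / s) ^ m * (2 * Real.pi) / (s ^ 2 / 4) := by gcongr
    _ = _ := by rw [div_pow, pow_add]; field_simp; ring

/-- The Fourier transforms of functions bounded in `L¹⁺ᵉ` are uniformly bounded in some `L^N`. -/
theorem exists_lintegral_charFun_pow_le {ε C : ℝ} (hε : 0 < ε) (hε1 : ε ≤ 1) (hC1 : 1 ≤ C) :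
    ∃ N : ℕ, 0 < N ∧ ∃ B : ENNReal, B < ⊤ ∧ ∀ f : ℝ → ℝ, Measurable f → (∀ x, 0 ≤ f x) →
      Integrable f → ∫ x, f x ≤ 1 → Integrable (fun x => f x ^ (1 + ε)) →
      ∫ x, f x ^ (1 + ε) ≤ C →
      ∫⁻ u, ENNReal.ofReal (‖charFun (densityMeasure f) u‖ ^ N) ≤ B := by
  obtain ⟨m, hm⟩ := exists_nat_ge (1 / ε)
  have hpi := Real.pi_pos
  set K : ℝ := 8 * Real.pi * C * (2 * C) ^ m with hK
  -- With N = 2(m+2) and s = t^{1/N}, the weak bound of order s^{-(m+2)} becomes t^{-1/2},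
  -- integrable at 0 in the layer cake formula. Levels t > 1 are empty because the mass is at most
  -- 1.
  refine ⟨2 * (m + 2), by positivity,
    ∫⁻ t in Set.Ioo (0 : ℝ) 2, ENNReal.ofReal (K * t ^ (-(1 / 2) : ℝ)), ?_, ?_⟩
  · have hint : IntegrableOn (fun t : ℝ => K * t ^ (-(1 / 2) : ℝ)) (Set.Ioo 0 2) := by
      refine Integrable.const_mul ?_ _
      exact (intervalIntegral.integrableOn_Ioo_rpow_iff two_pos).2 (by norm_num)
    rw [← ofReal_integral_eq_lintegral_ofReal hint
      ((ae_restrict_mem measurableSet_Ioo).mono fun t ht => ?_)]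
    · exact ENNReal.ofReal_lt_top
    · have := ht.1
      simp only [Pi.zero_apply]
      positivity
  · intro f hf hf0 hi h1 hi' hC
    have hfin := isFiniteMeasure_densityMeasure hi
    have hcont := continuous_charFun (μ := densityMeasure f)
    rw [lintegral_eq_lintegral_meas_le _ (ae_of_all _ fun u => by positivity) (by fun_prop),
      ← lintegral_indicator measurableSet_Ioi, ← lintegral_indicator measurableSet_Ioo]
    refine lintegral_mono fun t => ?_
    simp only
    by_cases ht : t ∈ Set.Ioi (0 : ℝ)
    swap
    · rw [Set.indicator_of_notMem ht]; exact zero_le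
    rw [Set.indicator_of_mem ht]
    have ht0 : 0 < t := ht
    by_cases ht1 : t ≤ 1
    · rw [Set.indicator_of_mem (show t ∈ Set.Ioo (0 : ℝ) 2 from ⟨ht0, by linarith⟩)]
      have hs : 0 < t ^ (1 / (2 * (m + 2) : ℝ)) := by positivity
      have hs1 : t ^ (1 / (2 * (m + 2) : ℝ)) ≤ 1 :=
        Real.rpow_le_one ht0.le ht1 (by positivity)
      have h2 := volume_charFun_ge_le hf hf0 hi hε hε1 hi' hC hC1 hm hs hs1
      rw [← hK, ← Real.rpow_natCast, ← Real.rpow_mul ht0.le, ← Real.rpow_neg ht0.le] at h2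
      have e : -(1 / (2 * ((m : ℝ) + 2)) * ((m + 2 : ℕ) : ℝ)) = -(1 / 2) := by
        push_cast; field_simp
      rw [e] at h2
      refine le_trans (measure_mono fun u hu => ?_) h2
      have hu' : t ≤ ‖charFun (densityMeasure f) u‖ ^ (2 * (m + 2)) := hu
      simp only [Set.mem_ofPred_eq]
      have h3 := Real.rpow_le_rpow ht0.le hu' (z := 1 / (2 * (m + 2) : ℝ)) (by positivity)
      refine h3.trans_eq ?_
      rw [← Real.rpow_natCast, ← Real.rpow_mul (norm_nonneg _)]
      have e2 : ((2 * (m + 2) : ℕ) : ℝ) * (1 / (2 * ((m : ℝ) + 2))) = 1 := by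
        push_cast; field_simp
      rw [e2, Real.rpow_one]
    · have : {u | t ≤ ‖charFun (densityMeasure f) u‖ ^ (2 * (m + 2))} = ∅ := by
        refine Set.eq_empty_of_forall_notMem fun u hu => ht1 ?_
        have hu' : t ≤ ‖charFun (densityMeasure f) u‖ ^ (2 * (m + 2)) := hu
        refine hu'.trans (pow_le_one₀ (norm_nonneg _) ?_)
        refine (norm_charFun_le u).trans ?_
        rwa [densityMeasure_real_univ hf hf0]
      rw [this, measure_empty]
      exact zero_le

variable {ρ : ℝ → ℝ}

/-- The density of the tilted law. -/
noncomputable def tiltedDensity (ρ : ℝ → ℝ) (κ x : ℝ) : ℝ :=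
  Real.exp (κ * x) * ρ x / mgf id (baseLaw ρ) κ

theorem IsAdmissible.tiltedCharFun_eq (hρ : IsAdmissible ρ) {κ : ℝ}
    (hκ : κ ∈ interior (integrableExpSet id (baseLaw ρ))) (u : ℝ) :
    tiltedCharFun ρ κ u = charFun (densityMeasure (tiltedDensity ρ κ)) u := by
  have hM := hρ.mgf_pos hκ
  have hmeas : Measurable (tiltedDensity ρ κ) := by
    have := hρ.measurable
    unfold tiltedDensity
    fun_prop
  rw [charFun_apply_real, integral_densityMeasure hmeas, tiltedCharFun, complexMGF,
    hρ.integral_baseLaw, ← integral_div]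
  · refine integral_congr_ae (ae_of_all _ fun x => ?_)
    simp only [id, tiltedDensity, Complex.real_smul, add_mul, Complex.exp_add]
    push_cast
    rw [mul_right_comm (u : ℂ) Complex.I]
    ring
  · intro x
    have := hρ.nonneg x
    unfold tiltedDensity
    positivity

/-- The tilted densities are bounded in L^{1+ε₁/2} uniformly in κ. Half of the exponent ε₁ is given
up so that the product of a power of ρ and an exponential splits, by 2ab ≤ a² + b², into ρ^{1+ε₁}
and ρ times an exponential. -/
theorem IsAdmissible.exists_lintegral_tiltedCharFun_pow_le (hρ : IsAdmissible ρ) :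
    ∃ (N : ℕ) (κ₀ : ℝ) (B : ENNReal), 0 < N ∧ 0 < κ₀ ∧ B < ⊤ ∧ ∀ κ : ℝ, |κ| < κ₀ →
      ∫⁻ u, ENNReal.ofReal (‖tiltedCharFun ρ κ u‖ ^ N) ≤ B := by
  obtain ⟨ε, hε, hint⟩ := hρ.integrable_rpow
  have hint' : Integrable fun x => ρ x ^ (1 + ε) := by
    simpa only [abs_of_nonneg (hρ.nonneg _)] using hint
  obtain ⟨τ, hτ, hi⟩ := hρ.exists_strip
  set ε₁ := min ε 1 with hε₁
  have hε₁0 : 0 < ε₁ := by positivity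
  have hε₁1 : ε₁ ≤ 1 := min_le_right _ _
  set t := τ / 2 with ht
  have hti := hi t (by rw [abs_of_pos (by positivity)]; linarith)
  have hti' := hi (-t) (by rw [abs_neg, abs_of_pos (by positivity)]; linarith)
  have hexp (s : ℝ) (hs : s ∈ interior (integrableExpSet id (baseLaw ρ))) :
      Integrable fun x => ρ x * Real.exp (s * x) := by
    have h : Integrable (fun x => Real.exp (s * id x)) (baseLaw ρ) :=
      integrable_of_mem_integrableExpSet (interior_subset hs)
    simpa using hρ.integrable_baseLaw_iff.1 h
  let D : ℝ → ℝ := fun x => ρ x + ρ x ^ (1 + ε) + (ρ x * Real.exp (t * x) + ρ x * Real.exp (-t * x))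
  have hDi : Integrable D := (hρ.integrable.add hint').add ((hexp t hti).add (hexp (-t) hti'))
  obtain ⟨N, hN, B, hB, h⟩ := exists_lintegral_charFun_pow_le (ε := ε₁ / 2)
    (C := max 1 (∫ x, D x)) (by positivity) (by linarith) (le_max_left _ _)
  -- The exponential that appears has rate (2 + ε₁)κ with ε₁ ≤ 1, so |κ| < t/3 keeps it below t.
  refine ⟨N, t / 3, B, hN, by positivity, hB, fun κ hκ => ?_⟩
  have hκi := hi κ (by linarith)
  have hκi' := hi (-κ) (by rw [abs_neg]; linarith)
  simp_rw [hρ.tiltedCharFun_eq hκi]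
  have hM1 := hρ.one_le_mgf hκi hκi'
  have hM := hρ.mgf_pos hκi
  have hmeas : Measurable (tiltedDensity ρ κ) := by
    have := hρ.measurable
    unfold tiltedDensity
    fun_prop
  have h0 (x : ℝ) : 0 ≤ tiltedDensity ρ κ x := by
    have := hρ.nonneg x
    unfold tiltedDensity
    positivity
  have hle (x : ℝ) : tiltedDensity ρ κ x ^ (1 + ε₁ / 2) ≤ D x := by
    have hr := hρ.nonneg x
    have a1 : tiltedDensity ρ κ x ≤ ρ x * Real.exp (κ * x) := by
      unfold tiltedDensity
      rw [div_le_iff₀ hM, mul_comm (Real.exp _)]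
      exact le_mul_of_one_le_right (by positivity) hM1
    have a2 : tiltedDensity ρ κ x ^ (1 + ε₁ / 2) ≤
        ρ x ^ (1 + ε₁ / 2) * Real.exp ((1 + ε₁ / 2) * κ * x) := by
      refine (Real.rpow_le_rpow (h0 x) a1 (by positivity)).trans_eq ?_
      rw [Real.mul_rpow hr (Real.exp_pos _).le, ← Real.exp_mul]
      ring_nf
    have a3 : ρ x ^ (1 + ε₁ / 2) * Real.exp ((1 + ε₁ / 2) * κ * x) ≤
        ρ x ^ (1 + ε₁) + ρ x * Real.exp (2 * ((1 + ε₁ / 2) * κ * x)) := by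
      have e1 : ρ x ^ (1 + ε₁) = (ρ x ^ ((1 + ε₁) / 2)) ^ 2 := by
        rw [← Real.rpow_natCast, ← Real.rpow_mul hr]; congr 1; push_cast; ring
      have e2 : ρ x * Real.exp (2 * ((1 + ε₁ / 2) * κ * x)) =
          (ρ x ^ (1 / 2 : ℝ) * Real.exp ((1 + ε₁ / 2) * κ * x)) ^ 2 := by
        rw [mul_pow, ← Real.rpow_natCast, ← Real.rpow_mul hr, ← Real.exp_nat_mul]
        norm_num
      have e3 : ρ x ^ (1 + ε₁ / 2) * Real.exp ((1 + ε₁ / 2) * κ * x) = ρ x ^ ((1 + ε₁) / 2) *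
          (ρ x ^ (1 / 2 : ℝ) * Real.exp ((1 + ε₁ / 2) * κ * x)) := by
        rw [← mul_assoc, ← Real.rpow_add_of_nonneg hr (by positivity) (by positivity)]
        congr 2; ring
      rw [e1, e2, e3]
      have := two_mul_le_add_sq (ρ x ^ ((1 + ε₁) / 2))
        (ρ x ^ (1 / 2 : ℝ) * Real.exp ((1 + ε₁ / 2) * κ * x))
      have hp : 0 ≤ ρ x ^ ((1 + ε₁) / 2) *
          (ρ x ^ (1 / 2 : ℝ) * Real.exp ((1 + ε₁ / 2) * κ * x)) := by positivity
      linarith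
    have a4 : ρ x ^ (1 + ε₁) ≤ ρ x + ρ x ^ (1 + ε) := by
      rcases le_total (ρ x) 1 with h1 | h1
      · have : ρ x ^ (1 + ε₁) ≤ ρ x := by
          conv_rhs => rw [← Real.rpow_one (ρ x)]
          rcases hr.eq_or_lt with h0 | h0
          · rw [← h0, Real.zero_rpow (by positivity), Real.zero_rpow one_ne_zero]
          · exact Real.rpow_le_rpow_of_exponent_ge h0 h1 (by linarith)
        have : 0 ≤ ρ x ^ (1 + ε) := by positivity
        linarith
      · have : ρ x ^ (1 + ε₁) ≤ ρ x ^ (1 + ε) :=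
          Real.rpow_le_rpow_of_exponent_le h1 (by linarith [min_le_left ε 1])
        linarith
    have a5 : Real.exp (2 * ((1 + ε₁ / 2) * κ * x)) ≤ Real.exp (t * x) + Real.exp (-t * x) := by
      have b1 : |2 * ((1 + ε₁ / 2) * κ * x)| ≤ t * |x| := by
        rw [show 2 * ((1 + ε₁ / 2) * κ * x) = (2 + ε₁) * κ * x by ring, abs_mul, abs_mul,
          abs_of_pos (by positivity : 0 < 2 + ε₁)]
        gcongr
        nlinarith [abs_nonneg κ]
      have b2 : Real.exp (2 * ((1 + ε₁ / 2) * κ * x)) ≤ Real.exp (t * |x|) :=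
        Real.exp_le_exp.2 ((le_abs_self _).trans b1)
      rcases abs_cases x with ⟨h1, _⟩ | ⟨h1, _⟩
      · rw [h1] at b2; linarith [Real.exp_pos (-t * x)]
      · rw [h1, mul_neg, ← neg_mul] at b2; linarith [Real.exp_pos (t * x)]
    have a6 : ρ x * Real.exp (2 * ((1 + ε₁ / 2) * κ * x)) ≤
        ρ x * Real.exp (t * x) + ρ x * Real.exp (-t * x) := by
      rw [← mul_add]; gcongr
    simp only [D]
    linarith
  have hpowi : Integrable fun x => tiltedDensity ρ κ x ^ (1 + ε₁ / 2) :=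
    hDi.mono (hmeas.pow_const _).aestronglyMeasurable (ae_of_all _ fun x => by
      have := h0 x
      rw [Real.norm_of_nonneg (by positivity)]
      exact (hle x).trans (Real.le_norm_self _))
  have hti0 : Integrable (tiltedDensity ρ κ) := by
    refine ((hexp κ hκi).div_const (mgf id (baseLaw ρ) κ)).congr (ae_of_all _ fun x => ?_)
    simp only [tiltedDensity, mul_comm]
  refine h _ hmeas h0 hti0 (le_of_eq ?_) hpowi ((integral_mono hpowi hDi hle).trans
    (le_max_right _ _))
  simp only [tiltedDensity]
  rw [integral_div, div_eq_one_iff_eq hM.ne', mgf, hρ.integral_baseLaw]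
  simp [mul_comm]

end FourierIntegrability

open scoped RealInnerProductSpace

/-! ### The vector of signed energies, its exponential tilts and the change of measure. -/

section Sums

variable {ρ : ℝ → ℝ} {k n : ℕ}

/-- The spins `(σ_1, …, σ_k)` at the site `s`. -/
def pattern (σ : Fin k → Fin n → ℤˣ) (s : Fin n) : Fin k → ℤˣ := fun j => σ j s

/-- The vector `n^{-1/2} ∑_s σ_j(s) X_s`, `j = 1, …, k`, of signed energies. -/
noncomputable def scaledSum (σ : Fin k → Fin n → ℤˣ) (X : Fin n → ℝ) : EuclideanSpace ℝ (Fin k) :=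
  WithLp.toLp 2 fun j => (∑ s, spin (σ j s) * X s) / √n

/-- The law of the vector of signed energies. -/
noncomputable def sumLaw (ρ : ℝ → ℝ) (σ : Fin k → Fin n → ℤˣ) :
    Measure (EuclideanSpace ℝ (Fin k)) :=
  (law ρ n).map (scaledSum σ)

/-- The exponentially tilted law of the vector of signed energies. -/
noncomputable def tiltedSum (ρ : ℝ → ℝ) (σ : Fin k → Fin n → ℤˣ) (θ : Fin k → ℝ) :
    Measure (EuclideanSpace ℝ (Fin k)) :=
  (sumLaw ρ σ).tilted fun y => √n * ∑ j, θ j * y j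

theorem measurable_scaledSum (σ : Fin k → Fin n → ℤˣ) : Measurable (scaledSum σ) := by
  unfold scaledSum
  fun_prop

theorem IsAdmissible.isProbabilityMeasure_law (hρ : IsAdmissible ρ) (n : ℕ) :
    IsProbabilityMeasure (law ρ n) := by
  have := hρ.isProbabilityMeasure
  rw [law_eq_pi]
  infer_instance

theorem IsAdmissible.isProbabilityMeasure_sumLaw (hρ : IsAdmissible ρ) (σ : Fin k → Fin n → ℤˣ) :
    IsProbabilityMeasure (sumLaw ρ σ) := by
  have := hρ.isProbabilityMeasure_law n
  exact Measure.isProbabilityMeasure_map (measurable_scaledSum σ).aemeasurable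

theorem sum_mul_scaledSum (σ : Fin k → Fin n → ℤˣ) (θ : Fin k → ℝ) (X : Fin n → ℝ) :
    ∑ j, θ j * scaledSum σ X j = ∑ s, dot (pattern σ s) θ / √n * X s := by
  simp only [scaledSum, dot, pattern, Finset.sum_div, Finset.mul_sum, Finset.sum_mul]
  rw [Finset.sum_comm]
  refine Finset.sum_congr rfl fun s _ => Finset.sum_congr rfl fun j _ => ?_
  ring

theorem sqrt_mul_sum_mul_scaledSum (hn : 0 < n) (σ : Fin k → Fin n → ℤˣ) (θ : Fin k → ℝ)
    (X : Fin n → ℝ) : √n * ∑ j, θ j * scaledSum σ X j = ∑ s, dot (pattern σ s) θ * X s := by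
  have : √(n : ℝ) ≠ 0 := by positivity
  rw [sum_mul_scaledSum, Finset.mul_sum]
  refine Finset.sum_congr rfl fun s _ => ?_
  field_simp

/-- Since √n θ·y = ∑_s (v_s·θ) X_s, the exponential factorizes over the independent sites, and
tilting the sum by θ amounts to tilting site s by v_s·θ. -/
theorem integral_cexp_sumLaw (hρ : IsAdmissible ρ) (hn : 0 < n) (σ : Fin k → Fin n → ℤˣ)
    (θ : Fin k → ℝ) (t : EuclideanSpace ℝ (Fin k)) :
    ∫ y, Complex.exp ((√n * ∑ j, θ j * y j : ℝ) + ⟪y, t⟫ * Complex.I) ∂(sumLaw ρ σ) =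
      ∏ s, complexMGF id (baseLaw ρ)
        (dot (pattern σ s) θ + ((dot (pattern σ s) t / √n : ℝ) : ℂ) * Complex.I) := by
  have := hρ.isProbabilityMeasure
  rw [sumLaw, integral_map (measurable_scaledSum σ).aemeasurable
    (Continuous.aestronglyMeasurable (by fun_prop)), law_eq_pi]
  simp only [complexMGF, id]
  rw [← integral_fintype_prod_eq_prod (𝕜 := ℂ)]
  refine integral_congr_ae (ae_of_all _ fun X => ?_)
  simp only
  rw [sqrt_mul_sum_mul_scaledSum hn, ← Complex.exp_sum]
  congr 1
  have h1 : ⟪scaledSum σ X, t⟫ = ∑ s, dot (pattern σ s) t / √n * X s := by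
    rw [← sum_mul_scaledSum, PiLp.inner_apply]
    rfl
  rw [h1]
  push_cast
  rw [Finset.sum_mul, ← Finset.sum_add_distrib]
  refine Finset.sum_congr rfl fun s _ => ?_
  ring

theorem IsAdmissible.integral_exp_sumLaw (hρ : IsAdmissible ρ) (hn : 0 < n)
    (σ : Fin k → Fin n → ℤˣ) (θ : Fin k → ℝ) :
    ∫ y, Real.exp (√n * ∑ j, θ j * y j) ∂(sumLaw ρ σ) =
      ∏ s, mgf id (baseLaw ρ) (dot (pattern σ s) θ) := by
  have h := integral_cexp_sumLaw hρ hn σ θ 0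
  simp only [inner_zero_right, Complex.ofReal_zero, zero_mul, add_zero] at h
  have h2 : ∀ s, dot (pattern σ s) (0 : EuclideanSpace ℝ (Fin k)) = 0 := fun s => by simp [dot]
  simp only [h2, zero_div, Complex.ofReal_zero, zero_mul, add_zero, complexMGF_ofReal,
    ← Complex.ofReal_exp, integral_complex_ofReal] at h
  exact_mod_cast h

theorem IsAdmissible.integral_exp_sumLaw_eq_exp (hρ : IsAdmissible ρ) (hn : 0 < n)
    (σ : Fin k → Fin n → ℤˣ) (θ : Fin k → ℝ)
    (hθ : ∀ s, dot (pattern σ s) θ ∈ interior (integrableExpSet id (baseLaw ρ))) :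
    ∫ y, Real.exp (√n * ∑ j, θ j * y j) ∂(sumLaw ρ σ) =
      Real.exp (∑ s, cgf id (baseLaw ρ) (dot (pattern σ s) θ)) := by
  rw [hρ.integral_exp_sumLaw hn, Real.exp_sum]
  exact Finset.prod_congr rfl fun s _ => (Real.exp_log (hρ.mgf_pos (hθ s))).symm

theorem IsAdmissible.integrable_exp_sumLaw (hρ : IsAdmissible ρ) (hn : 0 < n)
    (σ : Fin k → Fin n → ℤˣ) (θ : Fin k → ℝ)
    (hθ : ∀ s, dot (pattern σ s) θ ∈ interior (integrableExpSet id (baseLaw ρ))) :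
    Integrable (fun y => Real.exp (√n * ∑ j, θ j * y j)) (sumLaw ρ σ) :=
  .of_integral_ne_zero (by
    rw [hρ.integral_exp_sumLaw_eq_exp hn σ θ hθ]
    exact (Real.exp_pos _).ne')

theorem IsAdmissible.isProbabilityMeasure_tiltedSum (hρ : IsAdmissible ρ) (hn : 0 < n)
    (σ : Fin k → Fin n → ℤˣ) (θ : Fin k → ℝ)
    (hθ : ∀ s, dot (pattern σ s) θ ∈ interior (integrableExpSet id (baseLaw ρ))) :
    IsProbabilityMeasure (tiltedSum ρ σ θ) := by
  have := hρ.isProbabilityMeasure_sumLaw σ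
  exact isProbabilityMeasure_tilted (hρ.integrable_exp_sumLaw hn σ θ hθ)

theorem IsAdmissible.charFun_tiltedSum (hρ : IsAdmissible ρ) (hn : 0 < n)
    (σ : Fin k → Fin n → ℤˣ) (θ : Fin k → ℝ) (t : EuclideanSpace ℝ (Fin k)) :
    charFun (tiltedSum ρ σ θ) t =
      ∏ s, tiltedCharFun ρ (dot (pattern σ s) θ) (dot (pattern σ s) t / √n) := by
  rw [charFun_apply, tiltedSum, integral_tilted, hρ.integral_exp_sumLaw hn]
  simp only [tiltedCharFun]
  rw [Finset.prod_div_distrib, ← integral_cexp_sumLaw hρ hn, ← integral_div]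
  refine integral_congr_ae (ae_of_all _ fun y => ?_)
  simp only [Complex.real_smul]
  rw [Complex.exp_add]
  push_cast
  ring

/-- Cramér's change of measure, with the tilted law written through its Fourier density. The tilt θ
remains free, to be chosen so that the tilted law is centred at the box. -/
theorem IsAdmissible.sumLaw_real_eq (hρ : IsAdmissible ρ) (hn : 0 < n)
    (σ : Fin k → Fin n → ℤˣ) (θ : Fin k → ℝ)
    (hθ : ∀ s, dot (pattern σ s) θ ∈ interior (integrableExpSet id (baseLaw ρ)))
    (hint : Integrable (charFun (tiltedSum ρ σ θ))) {B : Set (EuclideanSpace ℝ (Fin k))}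
    (hB : MeasurableSet B) :
    (sumLaw ρ σ).real B = ∫ y in B,
      Real.exp (∑ s, cgf id (baseLaw ρ) (dot (pattern σ s) θ) - √n * ∑ j, θ j * y j) *
        (invCharFun (tiltedSum ρ σ θ) y).re := by
  have := hρ.isProbabilityMeasure_sumLaw σ
  have := hρ.isProbabilityMeasure_tiltedSum hn σ θ hθ
  set S := ∑ s, cgf id (baseLaw ρ) (dot (pattern σ s) θ) with hS
  have h1 : ∫ y in B, Real.exp (S - √n * ∑ j, θ j * y j) ∂(tiltedSum ρ σ θ) =
      (sumLaw ρ σ).real B := by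
    rw [tiltedSum, setIntegral_tilted' _ _ hB, hρ.integral_exp_sumLaw_eq_exp hn σ θ hθ]
    have : ∀ y : EuclideanSpace ℝ (Fin k),
        (Real.exp (√n * ∑ j, θ j * y j) / Real.exp S) • Real.exp (S - √n * ∑ j, θ j * y j) = 1 := by
      intro y
      rw [smul_eq_mul, ← Real.exp_sub, ← Real.exp_add, Real.exp_eq_one_iff]
      ring
    simp only [← hS, this]
    simp
  have hmeas : Measurable fun y => ENNReal.ofReal (invCharFun (tiltedSum ρ σ θ) y).re :=
    (Complex.measurable_re.comp (continuous_invCharFun hint).measurable).ennreal_ofReal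
  rw [← h1]
  conv_lhs => rw [eq_withDensity_invCharFun hint]
  rw [setIntegral_withDensity_eq_setIntegral_toReal_smul hmeas
    (ae_of_all _ fun _ => ENNReal.ofReal_lt_top) _ hB]
  refine integral_congr_ae (ae_of_all _ fun y => ?_)
  simp only [ENNReal.toReal_ofReal (invCharFun_re_nonneg hint y), smul_eq_mul]
  ring

theorem IsAdmissible.sumLaw_absolutelyContinuous (hρ : IsAdmissible ρ) (hn : 0 < n)
    (σ : Fin k → Fin n → ℤˣ) (θ : Fin k → ℝ)
    (hθ : ∀ s, dot (pattern σ s) θ ∈ interior (integrableExpSet id (baseLaw ρ)))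
    (hint : Integrable (charFun (tiltedSum ρ σ θ))) : sumLaw ρ σ ≪ volume := by
  have := hρ.isProbabilityMeasure_sumLaw σ
  have := hρ.isProbabilityMeasure_tiltedSum hn σ θ hθ
  have h1 : sumLaw ρ σ ≪ tiltedSum ρ σ θ :=
    absolutelyContinuous_tilted (hρ.integrable_exp_sumLaw hn σ θ hθ)
  refine h1.trans ?_
  rw [eq_withDensity_invCharFun hint]
  exact withDensity_absolutelyContinuous _ _

end Sums

/-! ### Spin patterns, overlaps and linear forms. -/

section Patterns

variable {k n : ℕ}

theorem abs_spin (s : ℤˣ) : |spin s| = 1 := by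
  rcases Int.units_eq_one_or s with rfl | rfl <;> simp [spin]

theorem spin_mul_self (s : ℤˣ) : spin s * spin s = 1 := by
  rcases Int.units_eq_one_or s with rfl | rfl <;> simp [spin]

theorem patternCount_eq_card (σ : Fin k → Fin n → ℤˣ) (δ : Fin k → ℤˣ) :
    patternCount σ δ = (Finset.univ.filter fun s => pattern σ s = δ).card := by
  rw [patternCount, Fintype.card_subtype]
  congr 1
  ext s
  simp [pattern, funext_iff]

theorem sum_pattern {M : Type*} [AddCommMonoid M] (σ : Fin k → Fin n → ℤˣ)
    (f : (Fin k → ℤˣ) → M) : ∑ s, f (pattern σ s) = ∑ δ, patternCount σ δ • f δ := by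
  rw [← Finset.sum_fiberwise Finset.univ (pattern σ)]
  refine Finset.sum_congr rfl fun δ _ => ?_
  rw [patternCount_eq_card, ← Finset.sum_const]
  exact Finset.sum_congr rfl fun s hs => by rw [(Finset.mem_filter.1 hs).2]

theorem prod_pattern {M : Type*} [CommMonoid M] (σ : Fin k → Fin n → ℤˣ)
    (f : (Fin k → ℤˣ) → M) : ∏ s, f (pattern σ s) = ∏ δ, f δ ^ patternCount σ δ := by
  rw [← Finset.prod_fiberwise Finset.univ (pattern σ)]
  refine Finset.prod_congr rfl fun δ _ => ?_
  rw [patternCount_eq_card, ← Finset.prod_const]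
  exact Finset.prod_congr rfl fun s hs => by rw [(Finset.mem_filter.1 hs).2]

theorem abs_dot_le (δ : Fin k → ℤˣ) (θ : Fin k → ℝ) : |dot δ θ| ≤ k * ‖θ‖ := by
  calc |dot δ θ| ≤ ∑ j, |spin (δ j) * θ j| := Finset.abs_sum_le_sum_abs _ _
    _ ≤ ∑ _j : Fin k, ‖θ‖ := Finset.sum_le_sum fun j _ => by
        rw [abs_mul, abs_spin, one_mul]
        exact norm_le_pi_norm θ j
    _ = k * ‖θ‖ := by simp

theorem dot_sub (δ : Fin k → ℤˣ) (θ θ' : Fin k → ℝ) : dot δ (θ - θ') = dot δ θ - dot δ θ' := by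
  simp [dot, mul_sub, Finset.sum_sub_distrib]

theorem dot_smul (δ : Fin k → ℤˣ) (a : ℝ) (θ : Fin k → ℝ) : dot δ (a • θ) = a * dot δ θ := by
  simp only [dot, Pi.smul_apply, smul_eq_mul, Finset.mul_sum]
  exact Finset.sum_congr rfl fun j _ => by ring

theorem dot_sq_le (δ : Fin k → ℤˣ) (θ : Fin k → ℝ) : dot δ θ ^ 2 ≤ k * ∑ j, θ j ^ 2 := by
  have := sq_sum_le_card_mul_sum_sq (s := Finset.univ) (f := fun j => spin (δ j) * θ j)
  simp only [Finset.card_univ, Fintype.card_fin] at this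
  refine this.trans_eq ?_
  congr 1
  exact Finset.sum_congr rfl fun j _ => by rw [mul_pow, sq (spin _), spin_mul_self, one_mul]

theorem overlap_self (hn : 0 < n) (σ : Fin n → ℤˣ) : overlap σ σ = 1 := by
  have : (n : ℝ) ≠ 0 := by positivity
  simp [overlap, spin_mul_self, this]

theorem sum_spin_mul_dot (hn : 0 < n) (σ : Fin k → Fin n → ℤˣ) (θ : Fin k → ℝ) (j : Fin k) :
    ∑ s, spin (σ j s) * dot (pattern σ s) θ = n * ∑ l, overlap (σ j) (σ l) * θ l := by
  have : (n : ℝ) ≠ 0 := by positivity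
  simp only [dot, pattern, overlap, Finset.mul_sum, Finset.sum_div, Finset.sum_mul]
  rw [Finset.sum_comm]
  refine Finset.sum_congr rfl fun l _ => Finset.sum_congr rfl fun s _ => ?_
  field_simp

theorem abs_sum_overlap_sub_le {q : ℝ} (hn : 0 < n) {σ : Fin k → Fin n → ℤˣ}
    (hq : ∀ j l, j ≠ l → |overlap (σ j) (σ l)| ≤ q) (hq0 : 0 ≤ q) (θ : Fin k → ℝ) (j : Fin k) :
    |∑ l, overlap (σ j) (σ l) * θ l - θ j| ≤ q * ∑ l, |θ l| := by
  rw [← Finset.add_sum_erase _ _ (Finset.mem_univ j), overlap_self hn, one_mul, add_sub_cancel_left]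
  calc |∑ l ∈ Finset.univ.erase j, overlap (σ j) (σ l) * θ l|
      ≤ ∑ l ∈ Finset.univ.erase j, |overlap (σ j) (σ l) * θ l| := Finset.abs_sum_le_sum_abs _ _
    _ ≤ ∑ l ∈ Finset.univ.erase j, q * |θ l| := Finset.sum_le_sum fun l hl => by
        rw [abs_mul]
        exact mul_le_mul_of_nonneg_right (hq j l (Finset.ne_of_mem_erase hl).symm) (abs_nonneg _)
    _ ≤ ∑ l, q * |θ l| := Finset.sum_le_sum_of_subset_of_nonneg (Finset.subset_univ _)
        fun l _ _ => by positivity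
    _ = q * ∑ l, |θ l| := by rw [Finset.mul_sum]

/-- The quadratic form is n times that of the overlap matrix, which has unit diagonal. The
off-diagonal part is bounded by the Cauchy–Schwarz inequality. -/
theorem abs_sum_dot_sq_sub_le {q : ℝ} (hn : 0 < n) {σ : Fin k → Fin n → ℤˣ}
    (hq : ∀ j l, j ≠ l → |overlap (σ j) (σ l)| ≤ q) (hq0 : 0 ≤ q) (θ : Fin k → ℝ) :
    |∑ s, dot (pattern σ s) θ ^ 2 - n * ∑ j, θ j ^ 2| ≤ n * (q * (k * ∑ j, θ j ^ 2)) := by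
  have h1 : ∑ s, dot (pattern σ s) θ ^ 2 = n * ∑ j, θ j * ∑ l, overlap (σ j) (σ l) * θ l := by
    calc ∑ s, dot (pattern σ s) θ ^ 2
        = ∑ s, ∑ j, θ j * (spin (σ j s) * dot (pattern σ s) θ) := by
          refine Finset.sum_congr rfl fun s _ => ?_
          rw [sq]
          nth_rewrite 1 [dot]
          rw [Finset.sum_mul]
          exact Finset.sum_congr rfl fun j _ => by rw [pattern]; ring
      _ = ∑ j, θ j * ∑ s, spin (σ j s) * dot (pattern σ s) θ := by
          rw [Finset.sum_comm]
          simp_rw [Finset.mul_sum]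
      _ = _ := by
          simp_rw [sum_spin_mul_dot hn]
          rw [Finset.mul_sum]
          exact Finset.sum_congr rfl fun j _ => by ring
  rw [h1, ← mul_sub, abs_mul, abs_of_nonneg (Nat.cast_nonneg n), ← Finset.sum_sub_distrib]
  refine mul_le_mul_of_nonneg_left ?_ (Nat.cast_nonneg n)
  calc |∑ j, (θ j * ∑ l, overlap (σ j) (σ l) * θ l - θ j ^ 2)|
      ≤ ∑ j, |θ j * ∑ l, overlap (σ j) (σ l) * θ l - θ j ^ 2| := Finset.abs_sum_le_sum_abs _ _
    _ ≤ ∑ j, |θ j| * (q * ∑ l, |θ l|) := Finset.sum_le_sum fun j _ => by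
        rw [sq, ← mul_sub, abs_mul]
        exact mul_le_mul_of_nonneg_left (abs_sum_overlap_sub_le hn hq hq0 θ j) (abs_nonneg _)
    _ = q * (∑ j, |θ j|) ^ 2 := by rw [← Finset.sum_mul]; ring
    _ ≤ q * (k * ∑ j, θ j ^ 2) := by
        refine mul_le_mul_of_nonneg_left ?_ hq0
        have := sq_sum_le_card_mul_sum_sq (s := Finset.univ) (f := fun j => |θ j|)
        simpa only [Finset.card_univ, Fintype.card_fin, sq_abs] using this

theorem le_sum_min_one_sq (hn : 0 < n) {σ : Fin k → Fin n → ℤˣ} {q : ℝ} (hq0 : 0 ≤ q)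
    (hq : ∀ j l, j ≠ l → |overlap (σ j) (σ l)| ≤ q) (hqk : q * k ≤ 1 / 2)
    (t : EuclideanSpace ℝ (Fin k)) :
    min (‖t‖ ^ 2) (n / (k + 1)) / 2 ≤ ∑ s, min 1 ((dot (pattern σ s) t / √n) ^ 2) := by
  have hnR : (0 : ℝ) < n := by positivity
  have hk : (0 : ℝ) < k + 1 := by positivity
  rw [EuclideanSpace.real_norm_sq_eq]
  set T := ∑ j, t j ^ 2 with hT
  have hT0 : 0 ≤ T := Finset.sum_nonneg fun j _ => sq_nonneg _
  have h1 : n * T / 2 ≤ ∑ s, dot (pattern σ s) t ^ 2 := by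
    have h := (abs_le.1 (abs_sum_dot_sq_sub_le hn hq hq0 t)).1
    have : n * (q * (k * T)) ≤ n * (T / 2) := by
      refine mul_le_mul_of_nonneg_left ?_ hnR.le
      nlinarith
    linarith
  have h2 : ∀ s, (dot (pattern σ s) t / √n) ^ 2 = dot (pattern σ s) t ^ 2 / n := fun s => by
    rw [div_pow, Real.sq_sqrt hnR.le]
  have h3 : ∀ s, dot (pattern σ s) t ^ 2 ≤ (k + 1) * T := fun s =>
    (dot_sq_le _ _).trans (by nlinarith)
  -- For 0 ≤ a ≤ 1 and av ≤ 1 one has min(1, v) ≥ av, so a common shrinking factor a reduces the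
  -- truncated sum to the quadratic form. Using k + 1 instead of k covers the case k = 0.
  obtain ⟨a, ha0, ha1, haT, ha⟩ : ∃ a : ℝ, 0 ≤ a ∧ a ≤ 1 ∧ a * ((k + 1) * T) ≤ n ∧
      min T (n / (k + 1)) ≤ a * T := by
    rcases le_or_gt T (n / (k + 1)) with h | h
    · refine ⟨1, zero_le_one, le_rfl, ?_, by simp⟩
      rw [le_div_iff₀ hk] at h
      linarith
    · have hTp : 0 < T := lt_of_le_of_lt (by positivity) h
      refine ⟨n / ((k + 1) * T), by positivity, ?_, ?_, ?_⟩
      · rw [div_lt_iff₀ hk] at h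
        rw [div_le_one (by positivity)]
        linarith
      · rw [div_mul_cancel₀ _ (by positivity)]
      · refine (min_le_right _ _).trans_eq ?_
        field_simp
  calc min T (n / (k + 1)) / 2 ≤ a * T / 2 := by linarith
    _ = a * (n * T / 2) / n := by field_simp
    _ ≤ a * (∑ s, dot (pattern σ s) t ^ 2) / n := by gcongr
    _ = ∑ s, a * dot (pattern σ s) t ^ 2 / n := by rw [Finset.mul_sum, Finset.sum_div]
    _ ≤ _ := Finset.sum_le_sum fun s _ => by
        rw [h2]
        refine le_min ?_ ?_
        · rw [div_le_one hnR]
          exact (mul_le_mul_of_nonneg_left (h3 s) ha0).trans haT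
        · gcongr
          exact mul_le_of_le_one_left (sq_nonneg _) ha1

/-- The sign pattern that is `-1` exactly at `j`; for `j = 0` it is `+1` everywhere. -/
def flipPattern (j : Fin k) : Fin k → ℤˣ := fun i => if i = j ∧ j.val ≠ 0 then -1 else 1

theorem flipPattern_injective : Function.Injective (flipPattern (k := k)) := by
  have key : ∀ i j : Fin k, flipPattern i = flipPattern j → i.val ≠ 0 → i = j := by
    intro i j h hi
    have := congrFun h i
    simp only [flipPattern, true_and, hi, ne_eq, not_false_eq_true, if_true] at this
    by_contra hij
    simp [hij] at this
  intro i j h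
  by_cases hi : i.val = 0
  · by_cases hj : j.val = 0
    · exact Fin.ext (hi.trans hj.symm)
    · exact (key j i h.symm hj).symm
  · exact key i j h hi

theorem dot_flipPattern (j : Fin k) (t : Fin k → ℝ) :
    dot (flipPattern j) t = ∑ i, t i - if j.val ≠ 0 then 2 * t j else 0 := by
  have : ∀ i, spin (flipPattern j i) * t i = t i - if i = j then (if j.val ≠ 0 then 2 * t j else 0)
      else 0 := by
    intro i
    by_cases hij : i = j
    · subst hij
      by_cases hj : i.val = 0
      · simp [flipPattern, hj, spin]
      · simp only [flipPattern, hj, spin, ne_eq, not_false_eq_true, and_self, if_true]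
        push_cast
        ring
    · simp [flipPattern, hij, spin]
  simp [dot, this, Finset.sum_sub_distrib]

/-- The linear map `t ↦ (δ^j · t)_j` for the patterns `δ^j = flipPattern j`. -/
noncomputable def flipMap (k : ℕ) : (Fin k → ℝ) →ₗ[ℝ] (Fin k → ℝ) where
  toFun t j := dot (flipPattern j) t
  map_add' t u := by
    ext j
    simp [dot, mul_add, Finset.sum_add_distrib]
  map_smul' a t := by
    ext j
    simp [dot_smul]

/-- In the kernel, the row of index 0 gives ∑ t_i = 0 and every other row gives ∑ t_i = 2t_j. So t_j
= 0 for j ≠ 0, and then also for j = 0. -/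
theorem det_flipMap_ne_zero (k : ℕ) : LinearMap.det (flipMap k) ≠ 0 := by
  rw [← isUnit_iff_ne_zero, ← LinearMap.isUnit_iff_isUnit_det, LinearMap.isUnit_iff_ker_eq_bot,
    LinearMap.ker_eq_bot']
  intro t ht
  have h : ∀ j : Fin k, ∑ i, t i - (if j.val ≠ 0 then 2 * t j else 0) = 0 := fun j => by
    rw [← dot_flipPattern]
    exact congrFun ht j
  rcases k.eq_zero_or_pos with rfl | hk
  · exact Subsingleton.elim _ _
  have h0 : ∑ i, t i = 0 := by simpa using h ⟨0, hk⟩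
  have h1 : ∀ j : Fin k, j.val ≠ 0 → t j = 0 := fun j hj => by
    have := h j
    rw [if_pos hj, h0] at this
    linarith
  ext j
  by_cases hj : j.val = 0
  · rw [Finset.sum_eq_single j (fun i _ hij => h1 i fun hi => hij (Fin.ext (hi.trans hj.symm)))
      (by simp)] at h0
    exact h0
  · exact h1 j hj

/-- The k linear forms are independent, so a linear change of variables turns the integral into a
product of one-dimensional ones. This converts one-variable L^N bounds into integrability on ℝ^k. -/
theorem exists_integral_prod_flipPattern (k : ℕ) : ∃ C : ℝ, 0 ≤ C ∧ ∀ f : Fin k → ℝ → ℝ,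
    (∀ j, Integrable (f j)) → ∀ r : ℝ, 0 < r →
    Integrable (fun t : EuclideanSpace ℝ (Fin k) => ∏ j, f j (dot (flipPattern j) t / r)) ∧
    ∫ t : EuclideanSpace ℝ (Fin k), ∏ j, f j (dot (flipPattern j) t / r) =
      C * (r ^ k * ∏ j, ∫ u, f j u) := by
  refine ⟨|(LinearMap.det (flipMap k))⁻¹|, abs_nonneg _, fun f hf r hr => ?_⟩
  have hf' : ∀ j, Integrable fun u => f j (u / r) := fun j => (hf j).comp_div hr.ne'
  have hmap := Real.map_linearMap_volume_pi_eq_smul_volume_pi (det_flipMap_ne_zero k)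
  have hmeas : AEMeasurable (flipMap k) volume :=
    (LinearMap.continuous_of_finiteDimensional (flipMap k)).aemeasurable
  have hprod : Integrable (fun u : Fin k → ℝ => ∏ j, f j (u j / r)) :=
    Integrable.fintype_prod (f := fun j u => f j (u / r)) hf'
  have hprod' : Integrable (fun u : Fin k → ℝ => ∏ j, f j (u j / r))
      (Measure.map (flipMap k) volume) := by
    rw [hmap]
    exact hprod.smul_measure ENNReal.ofReal_ne_top
  have hpres := EuclideanSpace.volume_preserving_symm_measurableEquiv_toLp (Fin k)
  constructor
  · have h1 := (integrable_map_measure hprod'.1 hmeas).1 hprod'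
    exact (hpres.integrable_comp_emb (MeasurableEquiv.measurableEmbedding _)).2 h1
  · have h2 := hpres.integral_comp (MeasurableEquiv.measurableEmbedding _)
      (fun t : Fin k → ℝ => ∏ j, f j (flipMap k t j / r))
    refine Eq.trans h2 ?_
    rw [← integral_map (f := fun u : Fin k → ℝ => ∏ j, f j (u j / r)) hmeas hprod'.1, hmap,
      integral_smul_measure, ENNReal.toReal_ofReal (abs_nonneg _), smul_eq_mul]
    congr 1
    rw [volume_pi, integral_fintype_prod_eq_prod (𝕜 := ℝ) (fun j u => f j (u / r))]
    simp_rw [Measure.integral_comp_div, smul_eq_mul, abs_of_pos hr]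
    rw [Finset.prod_mul_distrib, Finset.prod_const, Finset.card_univ, Fintype.card_fin]

end Patterns

/-! ### Bounds for the characteristic function of the tilted sum. -/

section Bounds

variable {ρ : ℝ → ℝ} {k n : ℕ}

theorem IsAdmissible.exists_integral_tiltedCharFun_pow_le (hρ : IsAdmissible ρ) :
    ∃ (N : ℕ) (κ₀ B : ℝ), 0 < κ₀ ∧ 0 ≤ B ∧ ∀ κ : ℝ, |κ| < κ₀ →
      Integrable (fun u => ‖tiltedCharFun ρ κ u‖ ^ N) ∧ ∫ u, ‖tiltedCharFun ρ κ u‖ ^ N ≤ B := by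
  obtain ⟨N, κ₀, B, -, hκ₀, hB, h⟩ := hρ.exists_lintegral_tiltedCharFun_pow_le
  obtain ⟨τ, hτ, hi⟩ := hρ.exists_strip
  refine ⟨N, min κ₀ τ, B.toReal, lt_min hκ₀ hτ, ENNReal.toReal_nonneg, fun κ hκ => ?_⟩
  have h1 := h κ (hκ.trans_le (min_le_left _ _))
  have hmeas : AEStronglyMeasurable (fun u => ‖tiltedCharFun ρ κ u‖ ^ N) volume := by
    simp_rw [hρ.tiltedCharFun_eq (hi κ (hκ.trans_le (min_le_right _ _)))]
    have : SFinite (densityMeasure (tiltedDensity ρ κ)) := by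
      unfold densityMeasure
      infer_instance
    exact (measurable_charFun.norm.pow_const N).aestronglyMeasurable
  have h0 : ∀ u, 0 ≤ ‖tiltedCharFun ρ κ u‖ ^ N := fun u => by positivity
  refine ⟨⟨hmeas, ?_⟩, ?_⟩
  · rw [hasFiniteIntegral_iff_ofReal (ae_of_all _ h0)]
    exact h1.trans_lt hB
  · rw [integral_eq_lintegral_of_nonneg_ae (ae_of_all _ h0) hmeas]
    exact ENNReal.toReal_mono hB.ne h1

theorem IsAdmissible.norm_charFun_tiltedSum_eq (hρ : IsAdmissible ρ) (hn : 0 < n)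
    (σ : Fin k → Fin n → ℤˣ) (θ : Fin k → ℝ) (t : EuclideanSpace ℝ (Fin k)) :
    ‖charFun (tiltedSum ρ σ θ) t‖ =
      ∏ s, ‖tiltedCharFun ρ (dot (pattern σ s) θ) (dot (pattern σ s) t / √n)‖ := by
  rw [hρ.charFun_tiltedSum hn, norm_prod]

theorem IsAdmissible.norm_charFun_tiltedSum_le (hρ : IsAdmissible ρ) (hn : 0 < n)
    {σ : Fin k → Fin n → ℤˣ} {q : ℝ} (hq0 : 0 ≤ q)
    (hq : ∀ j l, j ≠ l → |overlap (σ j) (σ l)| ≤ q) (hqk : q * k ≤ 1 / 2) {c : ℝ} (hc : 0 ≤ c)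
    {θ : Fin k → ℝ} (hθ : ∀ (δ : Fin k → ℤˣ) u,
      ‖tiltedCharFun ρ (dot δ θ) u‖ ≤ Real.exp (-(c * min 1 (u ^ 2))))
    (t : EuclideanSpace ℝ (Fin k)) :
    ‖charFun (tiltedSum ρ σ θ) t‖ ≤ Real.exp (-(c / 2 * min (‖t‖ ^ 2) (n / (k + 1)))) := by
  rw [hρ.norm_charFun_tiltedSum_eq hn]
  calc ∏ s, ‖tiltedCharFun ρ (dot (pattern σ s) θ) (dot (pattern σ s) t / √n)‖
      ≤ ∏ s, Real.exp (-(c * min 1 ((dot (pattern σ s) t / √n) ^ 2))) :=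
        Finset.prod_le_prod (fun s _ => norm_nonneg _) fun s _ => hθ _ _
    _ = Real.exp (-(c * ∑ s, min 1 ((dot (pattern σ s) t / √n) ^ 2))) := by
        rw [← Real.exp_sum, Finset.mul_sum, Finset.sum_neg_distrib]
    _ ≤ _ := by
        refine Real.exp_le_exp.2 (neg_le_neg ?_)
        have := mul_le_mul_of_nonneg_left (le_sum_min_one_sq hn hq0 hq hqk t) hc
        linarith

/-- All factors are at most 1, so the product only grows when just N sites are kept for each of the
k distinct flip patterns. -/
theorem prod_pattern_le_prod_flipPattern {σ : Fin k → Fin n → ℤˣ} {A : (Fin k → ℤˣ) → ℝ}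
    (hA0 : ∀ δ, 0 ≤ A δ) (hA1 : ∀ δ, A δ ≤ 1) {N : ℕ}
    (hN : ∀ j, N ≤ patternCount σ (flipPattern j)) :
    ∏ s, A (pattern σ s) ≤ ∏ j, A (flipPattern j) ^ N := by
  classical
  rw [prod_pattern]
  calc ∏ δ, A δ ^ patternCount σ δ
      ≤ ∏ δ, if δ ∈ Finset.univ.image flipPattern then A δ ^ N else 1 := by
        refine Finset.prod_le_prod (fun δ _ => by have := hA0 δ; positivity) fun δ _ => ?_
        split_ifs with h
        · obtain ⟨j, -, rfl⟩ := Finset.mem_image.1 h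
          exact pow_le_pow_of_le_one (hA0 _) (hA1 _) (hN j)
        · exact pow_le_one₀ (hA0 _) (hA1 _)
    _ = ∏ δ ∈ Finset.univ.image flipPattern, A δ ^ N := by
        rw [Finset.prod_ite_mem, Finset.univ_inter]
    _ = _ := Finset.prod_image fun i _ j _ h => flipPattern_injective h

/-- Geometric mean of two bounds: one is exponentially small in n but not integrable in t, the other
is a product with exponent 2N. Taking the square root of their product retains half of each,
exponential smallness together with integrability. -/
theorem IsAdmissible.norm_charFun_tiltedSum_le_of_large (hρ : IsAdmissible ρ) (hn : 0 < n)
    {σ : Fin k → Fin n → ℤˣ} {q : ℝ} (hq0 : 0 ≤ q)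
    (hq : ∀ j l, j ≠ l → |overlap (σ j) (σ l)| ≤ q) (hqk : q * k ≤ 1 / 2) {c : ℝ} (hc : 0 ≤ c)
    {θ : Fin k → ℝ} (hθ : ∀ (δ : Fin k → ℤˣ) u,
      ‖tiltedCharFun ρ (dot δ θ) u‖ ≤ Real.exp (-(c * min 1 (u ^ 2)))) {N : ℕ}
    (hN : ∀ j, 2 * N ≤ patternCount σ (flipPattern j))
    {t : EuclideanSpace ℝ (Fin k)} (ht : n / (k + 1) ≤ ‖t‖ ^ 2) :
    ‖charFun (tiltedSum ρ σ θ) t‖ ≤ Real.exp (-(c / 4 * (n / (k + 1)))) *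
      ∏ j, ‖tiltedCharFun ρ (dot (flipPattern j) θ) (dot (flipPattern j) t / √n)‖ ^ N := by
  have h1 := hρ.norm_charFun_tiltedSum_le hn hq0 hq hqk hc hθ t
  rw [min_eq_right ht] at h1
  have h2 : ‖charFun (tiltedSum ρ σ θ) t‖ ≤
      ∏ j, ‖tiltedCharFun ρ (dot (flipPattern j) θ) (dot (flipPattern j) t / √n)‖ ^ (2 * N) := by
    rw [hρ.norm_charFun_tiltedSum_eq hn]
    refine prod_pattern_le_prod_flipPattern
      (A := fun δ => ‖tiltedCharFun ρ (dot δ θ) (dot δ t / √n)‖) (fun δ => norm_nonneg _)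
      (fun δ => (hθ δ _).trans ?_) hN
    rw [Real.exp_le_one_iff]
    have : 0 ≤ min 1 ((dot δ t / √n) ^ 2) := le_min zero_le_one (sq_nonneg _)
    nlinarith
  refine le_of_sq_le_sq ?_ (by positivity)
  rw [sq]
  refine (mul_le_mul h1 h2 (norm_nonneg _) (Real.exp_pos _).le).trans_eq ?_
  rw [mul_pow, ← Finset.prod_pow, sq (Real.exp _), ← Real.exp_add]
  congr 1
  · congr 1; ring
  · exact Finset.prod_congr rfl fun j _ => by rw [← pow_mul, mul_comm]

theorem IsAdmissible.charFun_tiltedSum_eq_cexp (hρ : IsAdmissible ρ) (hn : 0 < n)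
    (σ : Fin k → Fin n → ℤˣ) (θ : Fin k → ℝ) (t y : EuclideanSpace ℝ (Fin k)) {e : ℝ → ℝ → ℂ}
    (he : ∀ s, tiltedCharFun ρ (dot (pattern σ s) θ) (dot (pattern σ s) t / √n) =
      Complex.exp (deriv (cgf id (baseLaw ρ)) (dot (pattern σ s) θ) *
        ((dot (pattern σ s) t / √n : ℝ) : ℂ) * Complex.I
        - ((dot (pattern σ s) t / √n : ℝ) : ℂ) ^ 2 / 2
        + e (dot (pattern σ s) θ) (dot (pattern σ s) t / √n))) :
    charFun (tiltedSum ρ σ θ) t * Complex.exp (-(inner ℝ y t : ℝ) * Complex.I) =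
      Complex.exp (-((∑ j, (y j - (∑ s, spin (σ j s) *
          deriv (cgf id (baseLaw ρ)) (dot (pattern σ s) θ)) / √n) * t j : ℝ) : ℂ) * Complex.I
        - ((∑ s, (dot (pattern σ s) t / √n) ^ 2 : ℝ) : ℂ) / 2
        + ∑ s, e (dot (pattern σ s) θ) (dot (pattern σ s) t / √n)) := by
  rw [hρ.charFun_tiltedSum hn, Finset.prod_congr rfl fun s _ => he s, ← Complex.exp_sum,
    ← Complex.exp_add]
  congr 1
  have h1 : inner ℝ y t = ∑ j, y j * t j := by
    rw [PiLp.inner_apply]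
    exact Finset.sum_congr rfl fun j _ => mul_comm _ _
  have h2 : ∑ j, (y j - (∑ s, spin (σ j s) *
      deriv (cgf id (baseLaw ρ)) (dot (pattern σ s) θ)) / √n) * t j =
      inner ℝ y t -
        ∑ s, deriv (cgf id (baseLaw ρ)) (dot (pattern σ s) θ) * (dot (pattern σ s) t / √n) := by
    simp_rw [sub_mul, Finset.sum_sub_distrib, h1]
    congr 1
    simp only [dot, pattern, Finset.mul_sum, Finset.sum_div, Finset.sum_mul]
    rw [Finset.sum_comm]
    refine Finset.sum_congr rfl fun s _ => Finset.sum_congr rfl fun j _ => ?_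
    ring
  rw [h2]
  push_cast
  simp_rw [Finset.sum_add_distrib, Finset.sum_sub_distrib, ← Finset.sum_mul, ← Finset.sum_div]
  ring

end Bounds

/-! ### The local limit theorem along a filter. -/

section LocalLimit

variable {ρ : ℝ → ℝ} {k : ℕ} {ι : Type*}

/-- The hypotheses of the local limit theorem along a filter: the number of sites `N` and the
numbers of sites with the patterns `flipPattern j` tend to infinity, the off-diagonal overlaps and
the tilts `θ` tend to zero, and `y` is asymptotically the mean of the tilted sum. -/
structure LocalRegime (ρ : ℝ → ℝ) (l : Filter ι) (N : ι → ℕ) (σ : ∀ i, Fin k → Fin (N i) → ℤˣ)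
    (θ : ι → Fin k → ℝ) (y : ι → EuclideanSpace ℝ (Fin k)) : Prop where
  sites : Tendsto N l atTop
  overlaps : ∀ j j', j ≠ j' → Tendsto (fun i => overlap (σ i j) (σ i j')) l (𝓝 0)
  counts : ∀ j, Tendsto (fun i => patternCount (σ i) (flipPattern j)) l atTop
  tilts : Tendsto θ l (𝓝 0)
  means : ∀ j, Tendsto (fun i => y i j - (∑ s, spin (σ i j s) *
    deriv (cgf id (baseLaw ρ)) (dot (pattern (σ i) s) (θ i))) / √(N i)) l (𝓝 0)

variable {l : Filter ι} {N : ι → ℕ} {σ : ∀ i, Fin k → Fin (N i) → ℤˣ} {θ : ι → Fin k → ℝ}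
  {y : ι → EuclideanSpace ℝ (Fin k)}

theorem eventually_abs_dot_lt (h : Tendsto θ l (𝓝 0)) {τ : ℝ} (hτ : 0 < τ) :
    ∀ᶠ i in l, ∀ δ : Fin k → ℤˣ, |dot δ (θ i)| < τ := by
  have h1 : Tendsto (fun i => k * ‖θ i‖) l (𝓝 0) := by simpa using h.norm.const_mul (k : ℝ)
  filter_upwards [h1.eventually_lt_const hτ] with i hi δ
  exact (abs_dot_le _ _).trans_lt hi

theorem eventually_abs_overlap_le
    (h : ∀ j j', j ≠ j' → Tendsto (fun i => overlap (σ i j) (σ i j')) l (𝓝 0)) {q : ℝ}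
    (hq : 0 < q) : ∀ᶠ i in l, ∀ j j', j ≠ j' → |overlap (σ i j) (σ i j')| ≤ q := by
  refine eventually_all.2 fun j => eventually_all.2 fun j' => ?_
  by_cases hj : j = j'
  · exact Eventually.of_forall fun i h => absurd hj h
  · have := (h j j' hj).abs
    rw [abs_zero] at this
    filter_upwards [this.eventually_lt_const hq] with i hi _ using hi.le

/-- Supplies the domination for the inversion integral: a fixed Gaussian on the ball ‖t‖² ≤ N/(k+1),
and outside it an integrable function whose integral is exponentially small in N. -/
theorem LocalRegime.charFun_bounds (hρ : IsAdmissible ρ) (h : LocalRegime ρ l N σ θ y) :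
    ∃ c D : ℝ, 0 < c ∧ 0 ≤ D ∧ ∀ᶠ i in l, 0 < N i ∧
      (∀ δ, dot δ (θ i) ∈ interior (integrableExpSet id (baseLaw ρ))) ∧
      (∀ t : EuclideanSpace ℝ (Fin k), ‖t‖ ^ 2 ≤ N i / (k + 1) →
        ‖charFun (tiltedSum ρ (σ i) (θ i)) t‖ ≤ Real.exp (-c * ‖t‖ ^ 2)) ∧
      ∃ g : EuclideanSpace ℝ (Fin k) → ℝ, Integrable g ∧ (∀ t, 0 ≤ g t) ∧
        ∫ t, g t ≤ D * (√(N i) ^ k * Real.exp (-(c / 2 * (N i / (k + 1))))) ∧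
        ∀ t : EuclideanSpace ℝ (Fin k), N i / (k + 1) ≤ ‖t‖ ^ 2 →
          ‖charFun (tiltedSum ρ (σ i) (θ i)) t‖ ≤ g t := by
  obtain ⟨c, κ₀, hc, hκ₀, hdecay⟩ := hρ.norm_tiltedCharFun_le
  obtain ⟨M, κ₁, B, hκ₁, hB, hpow⟩ := hρ.exists_integral_tiltedCharFun_pow_le
  obtain ⟨τ, hτ, hstrip⟩ := hρ.exists_strip
  obtain ⟨C, hC, hlin⟩ := exists_integral_prod_flipPattern k
  refine ⟨c / 2, C * B ^ k, by positivity, by positivity, ?_⟩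
  have hq : (0 : ℝ) < 1 / (2 * (k + 1)) := by positivity
  have hqk : (1 : ℝ) / (2 * (k + 1)) * k ≤ 1 / 2 := by
    rw [div_mul_eq_mul_div, div_le_div_iff₀ (by positivity) (by positivity)]
    linarith
  filter_upwards [h.sites.eventually_gt_atTop 0, eventually_abs_overlap_le h.overlaps hq,
    eventually_abs_dot_lt h.tilts hκ₀, eventually_abs_dot_lt h.tilts hκ₁,
    eventually_abs_dot_lt h.tilts hτ,
    eventually_all.2 fun j => (h.counts j).eventually_ge_atTop (2 * M)]
    with i hn hov h0 h1 h2 hcount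
  have hθ : ∀ (δ : Fin k → ℤˣ) u,
      ‖tiltedCharFun ρ (dot δ (θ i)) u‖ ≤ Real.exp (-(c * min 1 (u ^ 2))) :=
    fun δ u => hdecay _ _ (h0 δ)
  have hnR : (0 : ℝ) < N i := by positivity
  obtain ⟨hi, hint⟩ := hlin (fun j u => ‖tiltedCharFun ρ (dot (flipPattern j) (θ i)) u‖ ^ M)
    (fun j => (hpow _ (h1 _)).1) (√(N i)) (by positivity)
  refine ⟨hn, fun δ => hstrip _ (h2 δ), fun t ht => ?_,
    fun t => Real.exp (-(c / 4 * (N i / (k + 1)))) *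
      ∏ j, ‖tiltedCharFun ρ (dot (flipPattern j) (θ i)) (dot (flipPattern j) t / √(N i))‖ ^ M,
    hi.const_mul _, fun t => by positivity, ?_, fun t ht => ?_⟩
  · refine (hρ.norm_charFun_tiltedSum_le hn hq.le hov hqk hc.le hθ t).trans_eq ?_
    rw [min_eq_left ht, neg_mul]
  · rw [integral_const_mul, hint]
    have hprod : ∏ j, ∫ u, ‖tiltedCharFun ρ (dot (flipPattern j) (θ i)) u‖ ^ M ≤ B ^ k := by
      calc _ ≤ ∏ _j : Fin k, B := Finset.prod_le_prod
            (fun j _ => integral_nonneg fun u => by positivity) fun j _ => (hpow _ (h1 _)).2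
        _ = B ^ k := by simp
    calc Real.exp (-(c / 4 * (N i / (k + 1)))) * (C * (√(N i) ^ k *
          ∏ j, ∫ u, ‖tiltedCharFun ρ (dot (flipPattern j) (θ i)) u‖ ^ M))
        ≤ Real.exp (-(c / 4 * (N i / (k + 1)))) * (C * (√(N i) ^ k * B ^ k)) := by gcongr
      _ = _ := by
        rw [show c / 2 / 2 = c / 4 by ring]
        ring
  · exact hρ.norm_charFun_tiltedSum_le_of_large hn hq.le hov hqk hc.le hθ hcount ht

theorem LocalRegime.eventually_integrable_charFun (hρ : IsAdmissible ρ)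
    (h : LocalRegime ρ l N σ θ y) :
    ∀ᶠ i in l, Integrable (charFun (tiltedSum ρ (σ i) (θ i))) := by
  obtain ⟨c, D, hc, -, hb⟩ := h.charFun_bounds hρ
  filter_upwards [hb] with i ⟨hn, hint, hsmall, g, hg, hg0, _, hlarge⟩
  have := hρ.isProbabilityMeasure_tiltedSum hn (σ i) (θ i) fun s => hint _
  refine ((integrable_gaussian (V := EuclideanSpace ℝ (Fin k)) hc).add hg).mono'
    measurable_charFun.aestronglyMeasurable (ae_of_all _ fun t => ?_)
  rcases le_total (‖t‖ ^ 2) (N i / (k + 1)) with ht | ht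
  · exact (hsmall t ht).trans (le_add_of_nonneg_right (hg0 t))
  · exact (hlarge t ht).trans (le_add_of_nonneg_left (Real.exp_pos _).le)

theorem LocalRegime.tendsto_sum_sq (h : LocalRegime ρ l N σ θ y) (t : EuclideanSpace ℝ (Fin k)) :
    Tendsto (fun i => ∑ s, (dot (pattern (σ i) s) t / √(N i)) ^ 2) l (𝓝 (‖t‖ ^ 2)) := by
  rw [EuclideanSpace.real_norm_sq_eq]
  set T := ∑ j, t j ^ 2 with hT
  have hT0 : 0 ≤ T := Finset.sum_nonneg fun j _ => sq_nonneg _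
  refine Metric.tendsto_nhds.2 fun ε hε => ?_
  have hq : 0 < ε / (2 * (k * T + 1)) := by positivity
  filter_upwards [h.sites.eventually_gt_atTop 0, eventually_abs_overlap_le h.overlaps hq]
    with i hn hov
  have hnR : (0 : ℝ) < N i := by positivity
  have h1 := abs_sum_dot_sq_sub_le hn hov hq.le t
  rw [Real.dist_eq]
  have h2 : ∑ s, (dot (pattern (σ i) s) t / √(N i)) ^ 2 - T =
      (∑ s, dot (pattern (σ i) s) t ^ 2 - N i * T) / N i := by
    simp_rw [div_pow, Real.sq_sqrt hnR.le]
    rw [← Finset.sum_div, sub_div, mul_div_cancel_left₀ _ hnR.ne']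
  rw [h2, abs_div, abs_of_pos hnR, div_lt_iff₀ hnR]
  refine h1.trans_lt ?_
  rw [mul_comm]
  refine mul_lt_mul_of_pos_right ?_ hnR
  rw [div_mul_eq_mul_div, div_lt_iff₀ (by positivity)]
  nlinarith [mul_nonneg (Nat.cast_nonneg (α := ℝ) k) hT0]

/-- The linear terms cancel up to `means`, the quadratic terms converge because the overlap matrix
tends to the identity, and the remainders sum to at most ε times a bounded quadratic form. -/
theorem LocalRegime.tendsto_charFun (hρ : IsAdmissible ρ) (h : LocalRegime ρ l N σ θ y)
    (t : EuclideanSpace ℝ (Fin k)) :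
    Tendsto (fun i => charFun (tiltedSum ρ (σ i) (θ i)) t *
      Complex.exp (-(inner ℝ (y i) t : ℝ) * Complex.I)) l
      (𝓝 ((Real.exp (-(1 / 2) * ‖t‖ ^ 2) : ℝ) : ℂ)) := by
  obtain ⟨e, he⟩ := hρ.tilted_charFun_expansion
  have hu : ∀ δ : ℝ, 0 < δ → ∀ᶠ i in l, ∀ s, |dot (pattern (σ i) s) t / √(N i)| < δ := by
    intro δ hδ
    have h1 : Tendsto (fun i => k * ‖t.ofLp‖ / √(N i : ℝ)) l (𝓝 0) :=
      (Real.tendsto_sqrt_atTop.comp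
        (tendsto_natCast_atTop_atTop.comp h.sites)).const_div_atTop _
    filter_upwards [h1.eventually_lt_const hδ] with i hi s
    rw [abs_div, abs_of_nonneg (Real.sqrt_nonneg _)]
    exact (div_le_div_of_nonneg_right (abs_dot_le _ _) (Real.sqrt_nonneg _)).trans_lt hi
  have hsq := h.tendsto_sum_sq t
  have herr : Tendsto (fun i => ∑ s, e (dot (pattern (σ i) s) (θ i))
      (dot (pattern (σ i) s) t / √(N i))) l (𝓝 0) := by
    refine Metric.tendsto_nhds.2 fun ε hε => ?_
    have hε' : 0 < ε / (‖t‖ ^ 2 + 1) := by positivity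
    obtain ⟨δ, hδ, hb⟩ := he _ hε'
    filter_upwards [hu δ hδ, eventually_abs_dot_lt h.tilts hδ,
      hsq.eventually_lt_const (lt_add_one (‖t‖ ^ 2))] with i h1 h2 h3
    rw [dist_zero_right]
    calc _ ≤ ∑ s, ‖e (dot (pattern (σ i) s) (θ i)) (dot (pattern (σ i) s) t / √(N i))‖ :=
          norm_sum_le _ _
      _ ≤ ∑ s, ε / (‖t‖ ^ 2 + 1) * (dot (pattern (σ i) s) t / √(N i)) ^ 2 :=
          Finset.sum_le_sum fun s _ => (hb _ _ (h2 _) (h1 s)).1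
      _ = ε / (‖t‖ ^ 2 + 1) * ∑ s, (dot (pattern (σ i) s) t / √(N i)) ^ 2 := by
          rw [Finset.mul_sum]
      _ < ε / (‖t‖ ^ 2 + 1) * (‖t‖ ^ 2 + 1) := mul_lt_mul_of_pos_left h3 hε'
      _ = ε := div_mul_cancel₀ _ (by positivity)
  have hmean : Tendsto (fun i => ∑ j, (y i j - (∑ s, spin (σ i j s) *
      deriv (cgf id (baseLaw ρ)) (dot (pattern (σ i) s) (θ i))) / √(N i)) * t j) l (𝓝 0) := by
    have := tendsto_finsetSum Finset.univ fun j (_ : j ∈ Finset.univ) =>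
      (h.means j).mul_const (t j)
    simpa using this
  have hlim := ((((Complex.continuous_ofReal.tendsto _).comp hmean).neg.mul_const
    Complex.I).sub (((Complex.continuous_ofReal.tendsto _).comp hsq).div_const 2)).add herr
  have hlim' := (Complex.continuous_exp.tendsto _).comp hlim
  obtain ⟨δ, hδ, hb⟩ := he 1 one_pos
  have hval : Complex.exp (-((0 : ℝ) : ℂ) * Complex.I - ((‖t‖ ^ 2 : ℝ) : ℂ) / 2 + 0) =
      ((Real.exp (-(1 / 2) * ‖t‖ ^ 2) : ℝ) : ℂ) := by
    push_cast
    congr 1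
    ring
  rw [hval] at hlim'
  refine hlim'.congr' ?_
  filter_upwards [h.sites.eventually_gt_atTop 0, hu δ hδ, eventually_abs_dot_lt h.tilts hδ]
    with i hn h1 h2
  rw [hρ.charFun_tiltedSum_eq_cexp hn (σ i) (θ i) t (y i) (e := e)
    fun s => (hb _ _ (h2 _) (h1 s)).2]
  rfl

theorem tendsto_sqrt_pow_mul_exp_neg (k : ℕ) {c : ℝ} (hc : 0 < c) :
    Tendsto (fun n : ℕ => √(n : ℝ) ^ k * Real.exp (-(c * n))) atTop (𝓝 0) := by
  have h3 := (Real.tendsto_pow_mul_exp_neg_atTop_nhds_zero k).comp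
    ((tendsto_natCast_atTop_atTop (R := ℝ)).const_mul_atTop hc)
  have h4 := h3.const_mul ((c ^ k)⁻¹)
  rw [mul_zero] at h4
  refine squeeze_zero' (Eventually.of_forall fun n => by positivity) ?_ h4
  filter_upwards [eventually_ge_atTop 1] with n hn
  have hn1 : (1 : ℝ) ≤ n := by exact_mod_cast hn
  have h5 : √(n : ℝ) ≤ n := by
    rw [Real.sqrt_le_left (by positivity)]
    nlinarith
  calc √(n : ℝ) ^ k * Real.exp (-(c * n)) ≤ (n : ℝ) ^ k * Real.exp (-(c * n)) := by gcongr
    _ = (c ^ k)⁻¹ * ((c * n) ^ k * Real.exp (-(c * n))) := by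
      rw [mul_pow]
      field_simp

theorem integral_standard_gaussian (k : ℕ) :
    ∫ t : EuclideanSpace ℝ (Fin k), Real.exp (-(1 / 2) * ‖t‖ ^ 2) = √(2 * Real.pi) ^ k := by
  rw [GaussianFourier.integral_rexp_neg_mul_sq_norm (by norm_num : (0 : ℝ) < 1 / 2),
    finrank_euclideanSpace_fin, Real.sqrt_eq_rpow, ← Real.rpow_natCast, ← Real.rpow_mul
    (by positivity)]
  congr 1 <;> ring

/-- Dominated convergence on a growing ball reduces the inversion integral to the Gaussian one, with
value (2π)^{k/2}. Its complement contributes at most √N^k times a decaying exponential in N. -/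
theorem LocalRegime.tendsto_density (hρ : IsAdmissible ρ) [l.IsCountablyGenerated]
    (h : LocalRegime ρ l N σ θ y) :
    Tendsto (fun i => (invCharFun (tiltedSum ρ (σ i) (θ i)) (y i)).re) l
      (𝓝 ((√(2 * Real.pi) ^ k)⁻¹)) := by
  obtain ⟨c, D, hc, hD, hb⟩ := h.charFun_bounds hρ
  set φ : ι → EuclideanSpace ℝ (Fin k) → ℂ := fun i t => charFun (tiltedSum ρ (σ i) (θ i)) t *
    Complex.exp (-(inner ℝ (y i) t : ℝ) * Complex.I) with hφ
  have hnorm : ∀ i t, ‖φ i t‖ = ‖charFun (tiltedSum ρ (σ i) (θ i)) t‖ := fun i t =>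
    norm_charFun_mul_exp _ _ _
  set S : ι → Set (EuclideanSpace ℝ (Fin k)) := fun i => {t | ‖t‖ ^ 2 ≤ N i / (k + 1)} with hS
  have hSm : ∀ i, MeasurableSet (S i) := fun i =>
    measurableSet_le (by fun_prop) measurable_const
  have hfm : ∀ᶠ i in l, AEStronglyMeasurable (φ i) := by
    filter_upwards [h.eventually_integrable_charFun hρ] with i hi
    exact hi.1.mul (Continuous.aestronglyMeasurable (by fun_prop))
  have hmain : Tendsto (fun i => ∫ t, (S i).indicator (φ i) t) l
      (𝓝 (∫ t : EuclideanSpace ℝ (Fin k), ((Real.exp (-(1 / 2) * ‖t‖ ^ 2) : ℝ) : ℂ))) := by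
    refine tendsto_integral_filter_of_dominated_convergence
      (fun t => Real.exp (-c * ‖t‖ ^ 2)) ?_ ?_ (integrable_gaussian hc) ?_
    · filter_upwards [hfm] with i hi using hi.indicator (hSm i)
    · filter_upwards [hb] with i ⟨_, _, hsmall, _⟩
      refine ae_of_all _ fun t => ?_
      by_cases ht : t ∈ S i
      · rw [Set.indicator_of_mem ht, hnorm]
        exact hsmall t ht
      · rw [Set.indicator_of_notMem ht, norm_zero]
        positivity
    · refine ae_of_all _ fun t => (h.tendsto_charFun hρ t).congr' ?_
      have h1 : Tendsto (fun i => (N i : ℝ) / (k + 1)) l atTop :=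
        (tendsto_natCast_atTop_atTop.comp h.sites).atTop_div_const (by positivity)
      filter_upwards [h1.eventually_ge_atTop (‖t‖ ^ 2)] with i hi
      rw [Set.indicator_of_mem (show t ∈ S i from hi)]
  have htail : Tendsto (fun i => ∫ t, (S i)ᶜ.indicator (φ i) t) l (𝓝 0) := by
    have h1 : Tendsto (fun i => D * (√(N i : ℝ) ^ k *
        Real.exp (-(c / 2 * (N i / (k + 1)))))) l (𝓝 0) := by
      have h2 := ((tendsto_sqrt_pow_mul_exp_neg k
        (c := c / 2 / (k + 1)) (by positivity)).comp h.sites).const_mul D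
      rw [mul_zero] at h2
      refine h2.congr fun i => ?_
      simp only [Function.comp]
      congr 4
      ring
    refine squeeze_zero_norm' ?_ h1
    filter_upwards [hb] with i ⟨_, _, _, g, hg, hg0, hgD, hlarge⟩
    refine (norm_integral_le_of_norm_le hg (ae_of_all _ fun t => ?_)).trans hgD
    by_cases ht : t ∈ (S i)ᶜ
    · rw [Set.indicator_of_mem ht, hnorm]
      exact hlarge t (le_of_not_ge ht)
    · rw [Set.indicator_of_notMem ht, norm_zero]
      exact hg0 t
  have hsum := hmain.add htail
  rw [add_zero, integral_complex_ofReal, integral_standard_gaussian] at hsum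
  have hsum' := (Complex.continuous_re.tendsto _).comp
    (hsum.const_mul ((((2 * Real.pi) ^ k)⁻¹ : ℝ) : ℂ))
  have hval : (((((2 * Real.pi) ^ k)⁻¹ : ℝ) : ℂ) * ((√(2 * Real.pi) ^ k : ℝ) : ℂ)).re =
      (√(2 * Real.pi) ^ k)⁻¹ := by
    rw [← Complex.ofReal_mul, Complex.ofReal_re]
    have hp : (2 * Real.pi) = √(2 * Real.pi) ^ 2 := (Real.sq_sqrt (by positivity)).symm
    have hp0 : 0 < √(2 * Real.pi) := by positivity
    nth_rewrite 1 [hp]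
    rw [← pow_mul, mul_comm 2 k, pow_mul]
    field_simp
  rw [hval] at hsum'
  refine hsum'.congr' ?_
  filter_upwards [h.eventually_integrable_charFun hρ, hfm] with i hi hm
  have hφi : Integrable (φ i) := hi.norm.mono' hm (ae_of_all _ fun t => (hnorm i t).le)
  have h1 : (∫ t, (S i).indicator (φ i) t) + ∫ t, (S i)ᶜ.indicator (φ i) t = ∫ t, φ i t := by
    rw [integral_indicator (hSm i), integral_indicator (hSm i).compl,
      integral_add_compl (hSm i) hφi]
  simp only [Function.comp]
  rw [invCharFun, finrank_euclideanSpace_fin]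
  refine congrArg (fun z : ℂ => z.re) ?_
  rw [h1]

end LocalLimit

/-! ### Existence and uniqueness of the saddle point. -/

section Saddle

variable {ρ : ℝ → ℝ} {k n : ℕ}

/-- The gradient of `θ ↦ n⁻¹ ∑_s K(v_s · θ)`, where `K` is the cumulant generating function of the
base law and `v_s` is the vector of spins at the site `s`. -/
noncomputable def gradCGF (ρ : ℝ → ℝ) (σ : Fin k → Fin n → ℤˣ) (θ : Fin k → ℝ) : Fin k → ℝ :=
  fun j => (∑ s, spin (σ j s) * deriv (cgf id (baseLaw ρ)) (dot (pattern σ s) θ)) / n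

/-- The exponent `θ · x - n⁻¹ ∑_s K(v_s · θ)`. -/
noncomputable def tiltExponent (ρ : ℝ → ℝ) (σ : Fin k → Fin n → ℤˣ) (x θ : Fin k → ℝ) : ℝ :=
  ∑ j, θ j * x j - (∑ s, cgf id (baseLaw ρ) (dot (pattern σ s) θ)) / n

theorem IsAdmissible.gradCGF_zero (hρ : IsAdmissible ρ) (σ : Fin k → Fin n → ℤˣ) :
    gradCGF ρ σ 0 = 0 := by
  ext j
  simp [gradCGF, dot, hρ.deriv_cgf_zero]

theorem abs_gradCGF_sub_le (hn : 0 < n) {σ : Fin k → Fin n → ℤˣ} {q : ℝ} (hq0 : 0 ≤ q)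
    (hq : ∀ j l, j ≠ l → |overlap (σ j) (σ l)| ≤ q) {θ θ' : Fin k → ℝ} {a : ℝ}
    (ha : ∀ s, |deriv (cgf id (baseLaw ρ)) (dot (pattern σ s) θ) -
      deriv (cgf id (baseLaw ρ)) (dot (pattern σ s) θ') -
      (dot (pattern σ s) θ - dot (pattern σ s) θ')| ≤ a) (j : Fin k) :
    |gradCGF ρ σ θ j - gradCGF ρ σ θ' j - (θ j - θ' j)| ≤ a + q * k * ‖θ - θ'‖ := by
  have hnR : (0 : ℝ) < n := by positivity
  have h1 := abs_sum_overlap_sub_le hn hq hq0 (θ - θ') j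
  have h2 : ∑ l, |(θ - θ') l| ≤ k * ‖θ - θ'‖ := by
    calc ∑ l, |(θ - θ') l| ≤ ∑ _l : Fin k, ‖θ - θ'‖ :=
          Finset.sum_le_sum fun l _ => norm_le_pi_norm (θ - θ') l
      _ = k * ‖θ - θ'‖ := by simp
  have h3 : gradCGF ρ σ θ j - gradCGF ρ σ θ' j - (θ j - θ' j) =
      (∑ s, spin (σ j s) * (deriv (cgf id (baseLaw ρ)) (dot (pattern σ s) θ) -
        deriv (cgf id (baseLaw ρ)) (dot (pattern σ s) θ') -
        (dot (pattern σ s) θ - dot (pattern σ s) θ'))) / n +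
      (∑ l, overlap (σ j) (σ l) * (θ - θ') l - (θ - θ') j) := by
    have h4 := sum_spin_mul_dot hn σ (θ - θ') j
    simp_rw [dot_sub] at h4
    simp_rw [mul_sub] at h4 ⊢
    rw [Finset.sum_sub_distrib] at h4
    simp_rw [Finset.sum_sub_distrib]
    rw [h4]
    simp only [gradCGF, Pi.sub_apply]
    field_simp
    ring
  rw [h3]
  refine (abs_add_le _ _).trans (add_le_add ?_ ?_)
  · rw [abs_div, abs_of_pos hnR, div_le_iff₀ hnR]
    calc _ ≤ ∑ s, |spin (σ j s) * (deriv (cgf id (baseLaw ρ)) (dot (pattern σ s) θ) -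
          deriv (cgf id (baseLaw ρ)) (dot (pattern σ s) θ') -
          (dot (pattern σ s) θ - dot (pattern σ s) θ'))| := Finset.abs_sum_le_sum_abs _ _
      _ ≤ ∑ _s : Fin n, a := Finset.sum_le_sum fun s _ => by
          rw [abs_mul, abs_spin, one_mul]
          exact ha s
      _ = a * n := by simp [mul_comm]
  · refine h1.trans ?_
    rw [mul_assoc]
    exact mul_le_mul_of_nonneg_left h2 hq0

/-- The difference from the identity has two small sources: K' is nearly linear with slope 1 near 0,
and the overlap matrix is nearly the identity. Each accounts for a Lipschitz constant of at most
1/4. -/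
theorem IsAdmissible.norm_gradCGF_sub_le (hρ : IsAdmissible ρ) (k : ℕ) :
    ∃ R q : ℝ, 0 < R ∧ 0 < q ∧ ∀ (n : ℕ) (_ : 0 < n) (σ : Fin k → Fin n → ℤˣ),
      (∀ j l, j ≠ l → |overlap (σ j) (σ l)| ≤ q) → ∀ θ θ' : Fin k → ℝ, ‖θ‖ ≤ R → ‖θ'‖ ≤ R →
        ‖gradCGF ρ σ θ - gradCGF ρ σ θ' - (θ - θ')‖ ≤ 1 / 2 * ‖θ - θ'‖ := by
  have hk : (0 : ℝ) < k + 1 := by positivity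
  obtain ⟨δ, hδ, hK⟩ := hρ.deriv_cgf_sub_real (ε := 1 / (4 * (k + 1))) (by positivity)
  refine ⟨δ / (k + 1), 1 / (4 * (k + 1)), by positivity, by positivity,
    fun n hn σ hq θ θ' hθ hθ' => ?_⟩
  have hlt : ∀ ϑ : Fin k → ℝ, ‖ϑ‖ ≤ δ / (k + 1) → ∀ s, |dot (pattern σ s) ϑ| < δ := by
    intro ϑ hϑ s
    refine (abs_dot_le _ _).trans_lt ?_
    rw [le_div_iff₀ hk] at hϑ
    rcases (norm_nonneg ϑ).eq_or_lt with h | h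
    · rw [← h]; simpa using hδ
    · linarith
  refine (pi_norm_le_iff_of_nonneg (by positivity)).2 fun j => ?_
  have := abs_gradCGF_sub_le (ρ := ρ) hn (by positivity) hq (θ := θ) (θ' := θ')
    (a := 1 / (4 * (k + 1)) * (k * ‖θ - θ'‖)) (fun s => (hK _ _ (hlt θ hθ s) (hlt θ' hθ' s)).trans
      (mul_le_mul_of_nonneg_left (by rw [← dot_sub]; exact abs_dot_le _ _) (by positivity))) j
  refine this.trans ?_
  have h1 : 1 / (4 * ((k : ℝ) + 1)) * k ≤ 1 / 4 := by
    rw [div_mul_eq_mul_div, div_le_div_iff₀ (by positivity) (by positivity)]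
    linarith
  nlinarith [norm_nonneg (θ - θ'), mul_le_mul_of_nonneg_right h1 (norm_nonneg (θ - θ'))]

theorem IsAdmissible.exists_gradCGF_eq (hρ : IsAdmissible ρ) (k : ℕ) :
    ∃ R q : ℝ, 0 < R ∧ 0 < q ∧ ∀ (n : ℕ) (_ : 0 < n) (σ : Fin k → Fin n → ℤˣ),
      (∀ j l, j ≠ l → |overlap (σ j) (σ l)| ≤ q) →
      (∀ θ θ' : Fin k → ℝ, ‖θ‖ ≤ R → ‖θ'‖ ≤ R → gradCGF ρ σ θ = gradCGF ρ σ θ' → θ = θ') ∧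
      ∀ r x, r ≤ R → ‖x‖ ≤ r / 2 → ∃ θ, ‖θ‖ ≤ r ∧ ‖θ‖ ≤ 2 * ‖x‖ ∧ gradCGF ρ σ θ = x := by
  obtain ⟨R, q, hR, hq, h⟩ := hρ.norm_gradCGF_sub_le k
  refine ⟨R, q, hR, hq, fun n hn σ hσ => ⟨fun θ θ' hθ hθ' heq => ?_, fun r x hr hx => ?_⟩⟩
  · have := h n hn σ hσ θ θ' hθ hθ'
    rw [heq, sub_self, zero_sub, norm_neg] at this
    have h0 := norm_nonneg (θ - θ')
    exact sub_eq_zero.1 (norm_eq_zero.1 (by linarith))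
  · have h0 : ∀ θ : Fin k → ℝ, ‖θ‖ ≤ R → ‖gradCGF ρ σ θ - θ‖ ≤ 1 / 2 * ‖θ‖ := fun θ hθ => by
      have := h n hn σ hσ θ 0 hθ (by simpa using hR.le)
      rwa [hρ.gradCGF_zero, sub_zero, sub_zero] at this
    have hr0 : 0 ≤ r := by linarith [norm_nonneg x]
    -- Fixed points of this 1/2-contraction are exactly the solutions of the gradient equation, and
    -- ‖x‖ ≤ r/2 lets it preserve the ball of radius r.
    set T : (Fin k → ℝ) → (Fin k → ℝ) := fun θ => θ - gradCGF ρ σ θ + x with hT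
    have hmaps : Set.MapsTo T (Metric.closedBall 0 r) (Metric.closedBall 0 r) := by
      intro θ hθ
      rw [mem_closedBall_zero_iff] at hθ ⊢
      have h1 := h0 θ (hθ.trans hr)
      rw [norm_sub_rev] at h1
      calc ‖T θ‖ ≤ ‖θ - gradCGF ρ σ θ‖ + ‖x‖ := norm_add_le _ _
        _ ≤ r := by linarith
    have hcontr : ContractingWith (1 / 2) (hmaps.restrict T _ _) := by
      refine ⟨by norm_num, LipschitzWith.of_dist_le_mul fun θ θ' => ?_⟩
      have hθ := mem_closedBall_zero_iff.1 θ.2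
      have hθ' := mem_closedBall_zero_iff.1 θ'.2
      have h1 := h n hn σ hσ θ θ' (hθ.trans hr) (hθ'.trans hr)
      rw [Subtype.dist_eq, Subtype.dist_eq, dist_eq_norm, dist_eq_norm]
      simp only [Set.MapsTo.val_restrict_apply, hT]
      rw [norm_sub_rev] at h1
      push_cast
      convert! h1 using 2
      abel
    obtain ⟨θ, hθ, hfix, -⟩ := hcontr.exists_fixedPoint' Metric.isClosed_closedBall.isComplete hmaps
      (Metric.mem_closedBall_self hr0) (edist_ne_top _ _)
    have hg : gradCGF ρ σ θ = x := by
      have h1 : θ - gradCGF ρ σ θ + x = θ := hfix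
      have h2 : x - gradCGF ρ σ θ = 0 := by
        calc x - gradCGF ρ σ θ = (θ - gradCGF ρ σ θ + x) - θ := by abel
          _ = 0 := by rw [h1, sub_self]
      exact (sub_eq_zero.1 h2).symm
    have hθr := mem_closedBall_zero_iff.1 hθ
    refine ⟨θ, hθr, ?_, hg⟩
    have h1 := h0 θ (hθr.trans hr)
    rw [hg, norm_sub_rev] at h1
    have h2 : ‖θ‖ ≤ ‖θ - x‖ + ‖x‖ := by
      calc ‖θ‖ = ‖θ - x + x‖ := by rw [sub_add_cancel]
        _ ≤ _ := norm_add_le _ _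
    linarith

theorem sum_patternCount_div {σ : Fin k → Fin n → ℤˣ} (f : (Fin k → ℤˣ) → ℂ) :
    ∑ δ, ((patternCount σ δ : ℂ) / n) * f δ = (∑ s, f (pattern σ s)) / n := by
  rw [sum_pattern, Finset.sum_div]
  refine Finset.sum_congr rfl fun δ _ => ?_
  rw [nsmul_eq_mul]
  ring

/-- Dictionary between the Fourier variable η and the tilt θ = 2πη. The common factor 2πi cancels
from the saddle point equations. -/
theorem IsAdmissible.saddle_iff_and_action_eq (hρ : IsAdmissible ρ) (k : ℕ) :
    ∃ r : ℝ, 0 < r ∧ ∀ (n : ℕ) (σ : Fin k → Fin n → ℤˣ) (x η : Fin k → ℝ), ‖η‖ < r →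
      (IsSaddlePoint ρ σ x η ↔ gradCGF ρ σ ((2 * Real.pi) • η) = x) ∧
      action ρ σ x η = (tiltExponent ρ σ x ((2 * Real.pi) • η) : ℂ) := by
  obtain ⟨δ, hδ, hF⟩ := hρ.F_and_deriv_F
  have hk : (0 : ℝ) < k + 1 := by positivity
  refine ⟨δ / (k + 1), by positivity, fun n σ x η hη => ?_⟩
  have hlt : ∀ v : Fin k → ℤˣ, |dot v η| < δ := by
    intro v
    refine (abs_dot_le _ _).trans_lt ?_
    rw [lt_div_iff₀ hk] at hη
    linarith [norm_nonneg η]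
  have hpi : (2 * Real.pi * Complex.I : ℂ) ≠ 0 := Complex.two_pi_I_ne_zero
  constructor
  · have key : ∀ j, ∑ δ : Fin k → ℤˣ, ((patternCount σ δ : ℂ) / n) * (spin (δ j) : ℂ) *
        deriv (F ρ) (Complex.I * (dot δ η : ℂ)) =
        2 * Real.pi * Complex.I * ((gradCGF ρ σ ((2 * Real.pi) • η) j : ℝ) : ℂ) := by
      intro j
      simp_rw [mul_assoc]
      rw [sum_patternCount_div fun v => (spin (v j) : ℂ) * deriv (F ρ) (Complex.I * (dot v η : ℂ))]
      simp_rw [(hF _ (hlt _)).2, gradCGF, dot_smul, pattern]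
      push_cast
      rw [mul_div_assoc', mul_div_assoc', mul_div_assoc', Finset.mul_sum, Finset.mul_sum,
        Finset.mul_sum]
      congr 1
      refine Finset.sum_congr rfl fun s _ => ?_
      ring
    simp only [IsSaddlePoint, key, funext_iff]
    refine forall_congr' fun j => ⟨fun h => ?_, fun h => by rw [h]⟩
    exact_mod_cast mul_left_cancel₀ hpi h
  · rw [action, sum_patternCount_div fun v => F ρ (Complex.I * (dot v η : ℂ))]
    simp_rw [(hF _ (hlt _)).1, tiltExponent, dot_smul]
    push_cast
    simp only [Pi.smul_apply, smul_eq_mul, Finset.sum_neg_distrib, Finset.mul_sum]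
    push_cast
    rw [neg_div, neg_add_eq_sub]
    congr 1
    exact Finset.sum_congr rfl fun j _ => by ring

theorem IsAdmissible.exists_saddle (hρ : IsAdmissible ρ) (k : ℕ) :
    ∃ r R q : ℝ, 0 < r ∧ 0 < R ∧ 0 < q ∧ ∀ (n : ℕ) (_ : 0 < n) (σ : Fin k → Fin n → ℤˣ),
      (∀ j l, j ≠ l → |overlap (σ j) (σ l)| ≤ q) → ∀ x : Fin k → ℝ, ‖x‖ < R →
      ∃ η, ‖η‖ < r ∧ IsSaddlePoint ρ σ x η ∧
        (∀ η', ‖η'‖ < r → IsSaddlePoint ρ σ x η' → η' = η) ∧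
        ‖(2 * Real.pi) • η‖ ≤ 2 * ‖x‖ ∧ gradCGF ρ σ ((2 * Real.pi) • η) = x ∧
        action ρ σ x η = (tiltExponent ρ σ x ((2 * Real.pi) • η) : ℂ) := by
  obtain ⟨R, q, hR, hq, hgrad⟩ := hρ.exists_gradCGF_eq k
  obtain ⟨r, hr, hF⟩ := hρ.saddle_iff_and_action_eq k
  have hpi := Real.pi_pos
  have h2pi : (0 : ℝ) < 2 * Real.pi := by positivity
  set r' := min r (R / (2 * Real.pi)) with hr'
  have hr'0 : 0 < r' := lt_min hr (by positivity)
  have hscale : ∀ η : Fin k → ℝ, ‖(2 * Real.pi) • η‖ = 2 * Real.pi * ‖η‖ := fun η => by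
    rw [norm_smul, Real.norm_of_nonneg h2pi.le]
  -- For ‖x‖ < πr'/2 the solution has ‖θ‖ ≤ πr', that is ‖η‖ ≤ r'/2 < r'. Competitors with ‖η'‖ < r'
  -- have tilts of norm below 2πr' ≤ R, where the gradient map is injective.
  refine ⟨r', Real.pi * r' / 2, q, hr'0, by positivity, hq, fun n hn σ hσ x hx => ?_⟩
  obtain ⟨huniq, hex⟩ := hgrad n hn σ hσ
  have hle : Real.pi * r' ≤ R := by
    have := min_le_right r (R / (2 * Real.pi))
    rw [← hr', le_div_iff₀ h2pi] at this
    nlinarith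
  obtain ⟨θ, hθr, hθx, hθ⟩ := hex (Real.pi * r') x hle hx.le
  have hθη : (2 * Real.pi) • ((2 * Real.pi)⁻¹ • θ) = θ := smul_inv_smul₀ h2pi.ne' θ
  have hη : ‖(2 * Real.pi)⁻¹ • θ‖ < r' := by
    have := hscale ((2 * Real.pi)⁻¹ • θ)
    rw [hθη] at this
    have h1 : 2 * Real.pi * ‖(2 * Real.pi)⁻¹ • θ‖ < 2 * Real.pi * r' := by
      rw [← this]
      nlinarith
    exact lt_of_mul_lt_mul_left h1 h2pi.le
  obtain ⟨hs, ha⟩ := hF n σ x _ (hη.trans_le (min_le_left _ _))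
  rw [hθη] at hs ha
  refine ⟨(2 * Real.pi)⁻¹ • θ, hη, hs.2 hθ, fun η' hη' hsad => ?_, ?_, ?_, ?_⟩
  · have h1 := (hF n σ x η' (hη'.trans_le (min_le_left _ _))).1.1 hsad
    have h2 := huniq ((2 * Real.pi) • η') θ ?_ (hθr.trans hle) (h1.trans hθ.symm)
    · rw [← h2, inv_smul_smul₀ h2pi.ne']
    · have h3 := min_le_right r (R / (2 * Real.pi))
      rw [← hr', le_div_iff₀ h2pi] at h3
      rw [hscale]
      nlinarith
  · rwa [hθη]
  · rwa [hθη]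
  · rwa [hθη]

end Saddle

/-! ### The value of the exponent at the saddle point. -/

section Value

variable {ρ : ℝ → ℝ} {k n : ℕ}

/-- Completing the square isolates three errors: the shift x - θ, the defect of the overlap matrix,
and the non-quadratic part of K. -/
theorem tiltExponent_sub_eq (σ : Fin k → Fin n → ℤˣ) (x θ : Fin k → ℝ) :
    tiltExponent ρ σ x θ - (∑ j, x j ^ 2) / 2 =
      -(∑ j, (x j - θ j) ^ 2) / 2 - ((∑ s, dot (pattern σ s) θ ^ 2) / n - ∑ j, θ j ^ 2) / 2
        - (∑ s, (cgf id (baseLaw ρ) (dot (pattern σ s) θ) - dot (pattern σ s) θ ^ 2 / 2)) / n := by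
  have h1 : ∑ j, (x j - θ j) ^ 2 = ∑ j, x j ^ 2 - 2 * ∑ j, θ j * x j + ∑ j, θ j ^ 2 := by
    rw [Finset.mul_sum, ← Finset.sum_sub_distrib, ← Finset.sum_add_distrib]
    exact Finset.sum_congr rfl fun j _ => by ring
  rw [h1, Finset.sum_sub_distrib, ← Finset.sum_div, tiltExponent]
  ring

/-- The saddle equation gives x - θ = O(q‖θ‖ + ‖θ‖³), which enters squared; q ≤ 1 lets q² be
replaced by q. The overlap defect is O(q‖θ‖²) and the cumulant remainder is O(‖θ‖⁴), K being even.
-/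
theorem IsAdmissible.exists_abs_tiltExponent_sub_le (hρ : IsAdmissible ρ) (k : ℕ) :
    ∃ C δ : ℝ, 0 < C ∧ 0 < δ ∧ ∀ (n : ℕ) (_ : 0 < n) (σ : Fin k → Fin n → ℤˣ) (q : ℝ), 0 ≤ q →
      q ≤ 1 → (∀ j l, j ≠ l → |overlap (σ j) (σ l)| ≤ q) → ∀ x θ : Fin k → ℝ, ‖x‖ < δ →
      ‖θ‖ ≤ 2 * ‖x‖ → gradCGF ρ σ θ = x →
      |tiltExponent ρ σ x θ - (∑ j, x j ^ 2) / 2| ≤ C * (q * ‖x‖ ^ 2 + ‖x‖ ^ 4) := by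
  obtain ⟨C₁, δ₁, hC₁, hδ₁, hK⟩ := hρ.cgf_quartic
  obtain ⟨C₂, δ₂, hC₂, hδ₂, hK'⟩ := hρ.deriv_cgf_cubic
  have hk : (0 : ℝ) < k + 1 := by positivity
  refine ⟨16 * (C₂ ^ 2 * k ^ 7 + C₁ * k ^ 4) + 4 * (k ^ 3 + k ^ 2) + 1,
    min (1 / 2) (min δ₁ δ₂ / (2 * (k + 1))), by positivity, by positivity,
    fun n hn σ q hq0 hq1 hq x θ hx hθ hgrad => ?_⟩
  have hnR : (0 : ℝ) < n := by positivity
  set b := ‖θ‖ with hb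
  set a := ‖x‖ with ha
  have hb0 : 0 ≤ b := norm_nonneg _
  have hb1 : b ≤ 1 := by linarith [hx.trans_le (min_le_left _ _)]
  have hlt : ∀ s, |dot (pattern σ s) θ| < min δ₁ δ₂ := by
    intro s
    have h1 := hx.trans_le (min_le_right _ _)
    rw [lt_div_iff₀ (by positivity)] at h1
    have h2 := abs_dot_le (pattern σ s) θ
    have h3 : (k : ℝ) * b ≤ k * (2 * a) := by gcongr
    have : 0 ≤ a := norm_nonneg _
    linarith
  have hdot : ∀ s, |dot (pattern σ s) θ| ≤ k * b := fun s => abs_dot_le _ _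
  have hθj : ∀ j, |θ j| ≤ b := fun j => norm_le_pi_norm θ j
  have hsq : ∑ j, θ j ^ 2 ≤ k * b ^ 2 := by
    calc ∑ j, θ j ^ 2 ≤ ∑ _j : Fin k, b ^ 2 := Finset.sum_le_sum fun j _ => by
          rw [← sq_abs]
          exact pow_le_pow_left₀ (abs_nonneg _) (hθj j) 2
      _ = k * b ^ 2 := by simp
  have hA : |(∑ s, (cgf id (baseLaw ρ) (dot (pattern σ s) θ) - dot (pattern σ s) θ ^ 2 / 2)) / (n : ℝ)| ≤
      C₁ * (k * b) ^ 4 := by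
    rw [abs_div, abs_of_pos hnR, div_le_iff₀ hnR]
    calc _ ≤ ∑ s, |cgf id (baseLaw ρ) (dot (pattern σ s) θ) - dot (pattern σ s) θ ^ 2 / 2| :=
          Finset.abs_sum_le_sum_abs _ _
      _ ≤ ∑ _s : Fin n, C₁ * (k * b) ^ 4 := Finset.sum_le_sum fun s _ =>
          (hK _ ((hlt s).trans_le (min_le_left _ _))).trans (by gcongr; exact hdot s)
      _ = C₁ * (k * b) ^ 4 * n := by simp [mul_comm]
  have hB : |(∑ s, dot (pattern σ s) θ ^ 2) / n - ∑ j, θ j ^ 2| ≤ q * (k * (k * b ^ 2)) := by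
    have h1 := abs_sum_dot_sq_sub_le hn hq hq0 θ
    rw [show (∑ s, dot (pattern σ s) θ ^ 2) / n - ∑ j, θ j ^ 2 =
      (∑ s, dot (pattern σ s) θ ^ 2 - n * ∑ j, θ j ^ 2) / n by field_simp, abs_div, abs_of_pos hnR, div_le_iff₀ hnR, mul_comm _ (n : ℝ)]
    exact h1.trans (by gcongr)
  have hCj : ∀ j, (x j - θ j) ^ 2 ≤ 2 * (C₂ ^ 2 * k ^ 6 * b ^ 4 + q * (k ^ 2 * b ^ 2)) := by
    intro j
    have h1 := abs_gradCGF_sub_le (ρ := ρ) hn hq0 hq (θ := θ) (θ' := 0) (a := C₂ * (k * b) ^ 3)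
      (fun s => by
        have h0 : dot (pattern σ s) (0 : Fin k → ℝ) = 0 := by simp [dot]
        rw [h0, hρ.deriv_cgf_zero, sub_zero, sub_zero]
        exact (hK' _ ((hlt s).trans_le (min_le_right _ _))).trans (by gcongr; exact hdot s)) j
    rw [hgrad, hρ.gradCGF_zero] at h1
    simp only [Pi.zero_apply, sub_zero, ← hb] at h1
    calc (x j - θ j) ^ 2 = |x j - θ j| ^ 2 := (sq_abs _).symm
      _ ≤ (C₂ * (k * b) ^ 3 + q * k * b) ^ 2 := by gcongr
      _ ≤ 2 * ((C₂ * (k * b) ^ 3) ^ 2 + (q * k * b) ^ 2) := add_sq_le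
      _ = 2 * (C₂ ^ 2 * k ^ 6 * b ^ 4 * b ^ 2 + q * q * (k ^ 2 * b ^ 2)) := by ring
      _ ≤ 2 * (C₂ ^ 2 * k ^ 6 * b ^ 4 * 1 + q * 1 * (k ^ 2 * b ^ 2)) := by
          gcongr
          exact pow_le_one₀ hb0 hb1
      _ = _ := by ring
  have hC : ∑ j, (x j - θ j) ^ 2 ≤ k * (2 * (C₂ ^ 2 * k ^ 6 * b ^ 4 + q * (k ^ 2 * b ^ 2))) := by
    calc _ ≤ ∑ _j : Fin k, 2 * (C₂ ^ 2 * k ^ 6 * b ^ 4 + q * (k ^ 2 * b ^ 2)) :=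
          Finset.sum_le_sum fun j _ => hCj j
      _ = _ := by simp
  have hC0 : 0 ≤ ∑ j, (x j - θ j) ^ 2 := Finset.sum_nonneg fun j _ => sq_nonneg _
  have hb2 : b ^ 2 ≤ 4 * a ^ 2 := by
    calc b ^ 2 ≤ (2 * a) ^ 2 := by gcongr
      _ = 4 * a ^ 2 := by ring
  have hb4 : b ^ 4 ≤ 16 * a ^ 4 := by
    calc b ^ 4 ≤ (2 * a) ^ 4 := by gcongr
      _ = 16 * a ^ 4 := by ring
  rw [tiltExponent_sub_eq]
  have htot : (C₂ ^ 2 * k ^ 7 + C₁ * k ^ 4) * b ^ 4 + (k ^ 3 + k ^ 2) * (q * b ^ 2) ≤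
      (16 * (C₂ ^ 2 * k ^ 7 + C₁ * k ^ 4) + 4 * (k ^ 3 + k ^ 2) + 1) * (q * a ^ 2 + a ^ 4) := by
    have h1 : (C₂ ^ 2 * k ^ 7 + C₁ * k ^ 4) * b ^ 4 ≤
        (C₂ ^ 2 * k ^ 7 + C₁ * k ^ 4) * (16 * a ^ 4) := by gcongr
    have h2 : (k ^ 3 + k ^ 2) * (q * b ^ 2) ≤ ((k : ℝ) ^ 3 + k ^ 2) * (q * (4 * a ^ 2)) := by
      gcongr
    have e1 : 0 ≤ (C₂ ^ 2 * k ^ 7 + C₁ * k ^ 4) * (q * a ^ 2) := by positivity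
    have e2 : 0 ≤ ((k : ℝ) ^ 3 + k ^ 2) * a ^ 4 := by positivity
    have e3 : 0 ≤ q * a ^ 2 + a ^ 4 := by positivity
    linarith
  refine le_trans ?_ htot
  have hq2 : 0 ≤ q * (k ^ 2 * b ^ 2) := by positivity
  rw [abs_le] at hA hB ⊢
  constructor
  · linarith [hA.2, hB.2]
  · linarith [hA.1, hB.1, show 0 ≤ C₂ ^ 2 * k ^ 7 * b ^ 4 by positivity,
      show 0 ≤ (k : ℝ) ^ 3 * (q * b ^ 2) by positivity]

end Value

/-! ### Uniformity over classes of configurations. -/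

section Uniform

variable {ρ : ℝ → ℝ} {k : ℕ}

/-- Classes of families of configurations in which the off-diagonal overlaps tend to zero and the
numbers of sites with the patterns `flipPattern j` tend to infinity, uniformly. -/
structure UniformRegime (𝒮 : ∀ n, Set (Fin k → Fin n → ℤˣ)) : Prop where
  overlaps : ∀ ε : ℝ, 0 < ε → ∀ᶠ n in atTop, ∀ σ ∈ 𝒮 n, ∀ j l, j ≠ l →
    |overlap (σ j) (σ l)| ≤ ε
  counts : ∀ M : ℕ, ∀ᶠ n in atTop, ∀ σ ∈ 𝒮 n, ∀ j, M ≤ patternCount σ (flipPattern j)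

theorem uniformRegime_one :
    UniformRegime (k := 1) fun n => {fun _ => (1 : Fin n → ℤˣ)} := by
  refine ⟨fun ε _ => Eventually.of_forall fun n σ _ j l h => absurd (Subsingleton.elim j l) h,
    fun M => ?_⟩
  filter_upwards [eventually_ge_atTop M] with n hn σ hσ j
  rw [Set.mem_singleton_iff] at hσ
  subst hσ
  have h1 : patternCount (fun _ : Fin 1 => (1 : Fin n → ℤˣ)) (flipPattern j) = n := by
    rw [patternCount_eq_card, Finset.filter_true_of_mem, Finset.card_univ, Fintype.card_fin]
    intro s _
    ext i
    simp [pattern, flipPattern]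
  rwa [h1]

theorem norm_corner_le {α : ℕ → ℝ} {n : ℕ} (hα : 0 ≤ α n) (s : Fin k → ℤˣ) :
    ‖corner α n s‖ ≤ α n / √n := by
  refine (pi_norm_le_iff_of_nonneg (by positivity)).2 fun j => ?_
  rw [corner, Real.norm_eq_abs, abs_mul, abs_spin, one_mul, abs_of_nonneg (by positivity)]

theorem tendsto_div_sqrt {α : ℕ → ℝ} (hα : α =o[atTop] fun n : ℕ => √(n : ℝ)) :
    Tendsto (fun n => α n / √(n : ℝ)) atTop (𝓝 0) := hα.tendsto_div_nhds_zero

/-- Uniformity is encoded in a filter: the tuples (n, σ, s, θ, y) satisfying all constraints, with n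
tending to infinity. An eventual statement for this filter is exactly a uniform statement for large
n. The gradient equation makes the tilted mean equal to s_j α_n, so `means` reduces to w → 0. -/
theorem UniformRegime.density (hρ : IsAdmissible ρ) {𝒮 : ∀ n, Set (Fin k → Fin n → ℤˣ)}
    (h𝒮 : UniformRegime 𝒮) {α w : ℕ → ℝ} (hα0 : ∀ n, 0 ≤ α n)
    (hα : α =o[atTop] fun n : ℕ => √(n : ℝ)) (hw : Tendsto w atTop (𝓝 0)) {ε : ℝ} (hε : 0 < ε) :
    ∀ᶠ n in atTop, ∀ σ ∈ 𝒮 n, ∀ (s : Fin k → ℤˣ) (θ : Fin k → ℝ),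
      ‖θ‖ ≤ 2 * ‖corner α n s‖ → gradCGF ρ σ θ = corner α n s →
      ∀ y : EuclideanSpace ℝ (Fin k), (∀ j, |y j - spin (s j) * α n| ≤ w n) →
        (∀ δ, dot δ θ ∈ interior (integrableExpSet id (baseLaw ρ))) ∧
        Integrable (charFun (tiltedSum ρ σ θ)) ∧
        |(invCharFun (tiltedSum ρ σ θ) y).re - (√(2 * Real.pi) ^ k)⁻¹| ≤ ε := by
  let ι := Σ n : ℕ, (Fin k → Fin n → ℤˣ) × (Fin k → ℤˣ) × (Fin k → ℝ) × EuclideanSpace ℝ (Fin k)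
  let S : Set ι := {p | p.2.1 ∈ 𝒮 p.1 ∧ ‖p.2.2.2.1‖ ≤ 2 * ‖corner α p.1 p.2.2.1‖ ∧
    gradCGF ρ p.2.1 p.2.2.2.1 = corner α p.1 p.2.2.1 ∧
    ∀ j, |p.2.2.2.2 j - spin (p.2.2.1 j) * α p.1| ≤ w p.1}
  let L : Filter ι := comap Sigma.fst atTop ⊓ 𝓟 S
  have hN : Tendsto (Sigma.fst : ι → ℕ) L atTop := tendsto_comap.mono_left inf_le_left
  have hL : ∀ {P : ι → Prop}, (∀ᶠ n in atTop, ∀ p : ι, p.1 = n → p ∈ S → P p) →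
      ∀ᶠ p in L, P p := fun {P} h => by
    rw [eventually_inf_principal, eventually_comap]
    filter_upwards [h] with n hn p hp hpS using hn p hp hpS
  have hLS : ∀ᶠ p in L, p ∈ S := hL (Eventually.of_forall fun n p _ h => h)
  have hx := (tendsto_div_sqrt hα).comp hN
  have hreg : LocalRegime ρ L (fun p => p.1) (fun p => p.2.1) (fun p => p.2.2.2.1)
      (fun p => p.2.2.2.2) := by
    refine ⟨hN, fun j l hjl => ?_, fun j => ?_, ?_, fun j => ?_⟩
    · refine Metric.tendsto_nhds.2 fun η hη => hL ?_
      filter_upwards [h𝒮.overlaps (η / 2) (by positivity)] with n hn p hp hpS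
      subst hp
      rw [Real.dist_eq, sub_zero]
      exact (hn _ hpS.1 j l hjl).trans_lt (by linarith)
    · refine tendsto_atTop.2 fun M => hL ?_
      filter_upwards [h𝒮.counts M] with n hn p hp hpS
      subst hp
      exact hn _ hpS.1 j
    · refine squeeze_zero_norm' ?_ (by simpa using hx.const_mul 2)
      filter_upwards [hLS] with p hp
      exact hp.2.1.trans (mul_le_mul_of_nonneg_left (norm_corner_le (hα0 _) _) zero_le_two)
    · refine squeeze_zero_norm' ?_ (hw.comp hN)
      filter_upwards [hLS, hN.eventually_gt_atTop 0] with p hp hn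
      have hnR : (0 : ℝ) < p.1 := by exact_mod_cast hn
      have hsq : √(p.1 : ℝ) ≠ 0 := by positivity
      have hg := congrFun hp.2.2.1 j
      rw [gradCGF, corner, div_eq_iff hnR.ne'] at hg
      rw [hg]
      convert! hp.2.2.2 j using 2
      congr 1
      nth_rewrite 2 [← Real.mul_self_sqrt hnR.le]
      field_simp
  have h1 := hreg.eventually_integrable_charFun hρ
  have h2 := hreg.tendsto_density hρ
  obtain ⟨c, D, -, -, h3⟩ := hreg.charFun_bounds hρ
  have h4 : ∀ᶠ p in L, (∀ δ, dot δ p.2.2.2.1 ∈ interior (integrableExpSet id (baseLaw ρ))) ∧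
      Integrable (charFun (tiltedSum ρ p.2.1 p.2.2.2.1)) ∧
      |(invCharFun (tiltedSum ρ p.2.1 p.2.2.2.1) p.2.2.2.2).re - (√(2 * Real.pi) ^ k)⁻¹| ≤ ε := by
    filter_upwards [h1, Metric.tendsto_nhds.1 h2 ε hε, h3] with p h1 h2 h3
    exact ⟨h3.2.1, h1, (Real.dist_eq _ _ ▸ h2).le⟩
  rw [eventually_inf_principal, eventually_comap] at h4
  filter_upwards [h4] with n hn σ hσ s θ hθ hgrad y hy
  exact hn ⟨n, σ, s, θ, y⟩ rfl ⟨hσ, hθ, hgrad, hy⟩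

end Uniform

/-! ### Probabilities of boxes and of energy windows. -/

section Boxes

variable {ρ : ℝ → ℝ} {k n : ℕ}

theorem energy_eq_abs_scaledSum (σ : Fin k → Fin n → ℤˣ) (X : Fin n → ℝ) (j : Fin k) :
    energy (σ j) X = |scaledSum σ X j| := by
  rw [energy, scaledSum, abs_div, abs_of_nonneg (Real.sqrt_nonneg _)]

/-- The product of intervals `s_j [lo_j, hi_j]`. -/
def signBox (lo hi : Fin k → ℝ) (s : Fin k → ℤˣ) : Set (EuclideanSpace ℝ (Fin k)) :=
  {y | ∀ j, spin (s j) * y j ∈ Set.Icc (lo j) (hi j)}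

theorem measurableSet_signBox (lo hi : Fin k → ℝ) (s : Fin k → ℤˣ) :
    MeasurableSet (signBox lo hi s) := by
  simp only [signBox, Set.ofPred_forall]
  refine MeasurableSet.iInter fun j => ?_
  exact (measurable_const.mul (by fun_prop)) measurableSet_Icc

theorem volume_signBox (lo hi : Fin k → ℝ) (s : Fin k → ℤˣ) :
    volume (signBox lo hi s) = ∏ j, ENNReal.ofReal (hi j - lo j) := by
  have h1 : signBox lo hi s = (MeasurableEquiv.toLp 2 (Fin k → ℝ)).symm ⁻¹'
      (Set.univ.pi fun j => (fun u => spin (s j) * u) ⁻¹' Set.Icc (lo j) (hi j)) := by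
    ext y
    simp [signBox, Set.mem_pi]
  rw [h1, (EuclideanSpace.volume_preserving_symm_measurableEquiv_toLp (Fin k)).measure_preimage_equiv,
    volume_pi_pi]
  refine Finset.prod_congr rfl fun j _ => ?_
  rcases Int.units_eq_one_or (s j) with h | h
  · simp [h, spin]
  · have : (fun u => spin (s j) * u) ⁻¹' Set.Icc (lo j) (hi j) = Set.Icc (-hi j) (-lo j) := by
      ext u
      simp only [h, spin, Units.val_neg, Units.val_one, Int.cast_neg, Int.cast_one, neg_mul,
        one_mul, Set.mem_preimage, Set.mem_Icc]
      constructor <;> rintro ⟨h1, h2⟩ <;> constructor <;> linarith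
    rw [this, Real.volume_Icc]
    congr 1
    ring

theorem volume_real_signBox {lo hi : Fin k → ℝ} (h : ∀ j, lo j ≤ hi j) (s : Fin k → ℤˣ) :
    volume.real (signBox lo hi s) = ∏ j, (hi j - lo j) := by
  rw [measureReal_def, volume_signBox, ENNReal.toReal_prod]
  exact Finset.prod_congr rfl fun j _ => ENNReal.toReal_ofReal (sub_nonneg.2 (h j))

theorem volume_coordinate_eq_zero (j : Fin k) :
    volume {y : EuclideanSpace ℝ (Fin k) | y j = 0} = 0 := by
  have h1 : {y : EuclideanSpace ℝ (Fin k) | y j = 0} = (MeasurableEquiv.toLp 2 (Fin k → ℝ)).symm ⁻¹'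
      (Set.univ.pi fun i => if i = j then {0} else Set.univ) := by
    ext y
    simp only [Set.mem_ofPred_eq, Set.mem_preimage, Set.mem_pi, Set.mem_univ, true_imp_iff]
    constructor
    · intro h i
      split_ifs with hi
      · subst hi; exact h
      · trivial
    · intro h
      simpa using h j
  rw [h1, (EuclideanSpace.volume_preserving_symm_measurableEquiv_toLp (Fin k)).measure_preimage_equiv,
    volume_pi_pi]
  exact Finset.prod_eq_zero (Finset.mem_univ j) (by simp)

theorem law_real_energy_mem (ρ : ℝ → ℝ) (σ : Fin k → Fin n → ℤˣ) (J : Fin k → Set ℝ)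
    (hJ : ∀ j, MeasurableSet (J j)) :
    (law ρ n).real {X | ∀ j, energy (σ j) X ∈ J j} =
      (sumLaw ρ σ).real {y | ∀ j, |y j| ∈ J j} := by
  have hm : MeasurableSet {y : EuclideanSpace ℝ (Fin k) | ∀ j, |y j| ∈ J j} := by
    simp only [Set.ofPred_forall]
    exact MeasurableSet.iInter fun j =>
      (show Measurable fun y : EuclideanSpace ℝ (Fin k) => |y j| by fun_prop) (hJ j)
  rw [sumLaw, map_measureReal_apply (measurable_scaledSum σ) hm]
  simp only [energy_eq_abs_scaledSum]
  rfl

/-- Since the lower ends are nonnegative, two boxes with different signs meet only inside a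
coordinate hyperplane, which is null. -/
theorem sumLaw_real_abs_mem (hρ : IsAdmissible ρ) (σ : Fin k → Fin n → ℤˣ)
    (hac : sumLaw ρ σ ≪ volume) {lo hi : Fin k → ℝ} (hlo : ∀ j, 0 ≤ lo j) :
    (sumLaw ρ σ).real {y | ∀ j, |y j| ∈ Set.Icc (lo j) (hi j)} =
      ∑ s, (sumLaw ρ σ).real (signBox lo hi s) := by
  have := hρ.isProbabilityMeasure_sumLaw σ
  have h1 : {y : EuclideanSpace ℝ (Fin k) | ∀ j, |y j| ∈ Set.Icc (lo j) (hi j)} =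
      ⋃ s : Fin k → ℤˣ, signBox lo hi s := by
    ext y
    simp only [Set.mem_ofPred_eq, Set.mem_iUnion, signBox]
    constructor
    · intro h
      refine ⟨fun j => if 0 ≤ y j then 1 else -1, fun j => ?_⟩
      have h2 := h j
      beta_reduce
      split_ifs with h0
      · simpa [spin, abs_of_nonneg h0] using h2
      · simpa [spin, abs_of_neg (not_le.1 h0)] using h2
    · rintro ⟨s, h⟩ j
      have h2 := h j
      have h3 : |y j| = spin (s j) * y j := by
        rw [← abs_of_nonneg ((hlo j).trans h2.1), abs_mul, abs_spin, one_mul]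
      rwa [h3]
  rw [h1, measureReal_def, measure_iUnion₀ _ fun s => (measurableSet_signBox lo hi s).nullMeasurableSet,
    tsum_fintype, ENNReal.toReal_sum fun s _ => measure_ne_top _ _]
  · rfl
  · intro s s' hss
    obtain ⟨j, hj⟩ := Function.ne_iff.1 hss
    refine measure_mono_null (fun y hy => ?_) (hac (volume_coordinate_eq_zero j))
    have h2 := ((hlo j).trans (hy.1 j).1)
    have h3 := ((hlo j).trans (hy.2 j).1)
    simp only [Set.mem_ofPred_eq]
    rcases Int.units_eq_one_or (s j) with h | h <;> rcases Int.units_eq_one_or (s' j) with h' | h' <;>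
      rw [h] at h2 <;> rw [h'] at h3 <;> simp [spin] at h2 h3
    · exact absurd (h.trans h'.symm) hj
    · linarith
    · linarith
    · exact absurd (h.trans h'.symm) hj

theorem abs_exp_neg_mul_sub_le {c₀ ε z h : ℝ} (hc₀ : 0 < c₀) (hε1 : ε ≤ 1)
    (hz : |z| ≤ ε / 8) (hh : |h - c₀| ≤ c₀ * ε / 2) : |Real.exp (-z) * h - c₀| ≤ ε * c₀ := by
  have h1 := Real.abs_exp_sub_one_le (x := -z) (by rw [abs_neg]; linarith)
  rw [abs_neg] at h1
  have hh2 : |h| ≤ 2 * c₀ := by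
    have : |h| ≤ |h - c₀| + |c₀| := by
      calc |h| = |h - c₀ + c₀| := by rw [sub_add_cancel]
        _ ≤ _ := abs_add_le _ _
    rw [abs_of_pos hc₀] at this
    nlinarith
  calc |Real.exp (-z) * h - c₀| = |(Real.exp (-z) - 1) * h + (h - c₀)| := by congr 1; ring
    _ ≤ |Real.exp (-z) - 1| * |h| + |h - c₀| := by rw [← abs_mul]; exact abs_add_le _ _
    _ ≤ (2 * (ε / 8)) * (2 * c₀) + c₀ * ε / 2 := by
        have := (abs_nonneg z).trans hz
        gcongr
        linarith
    _ = ε * c₀ := by ring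

/-- On a box of side at most w the density of the tilted law is nearly (2π)^{-k/2}. The untilting
factor deviates from e^{-nG} by the exponential of √n θ·(y - α_n s), which is at most 2k√n w in
size, hence negligible. -/
theorem UniformRegime.sumLaw_signBox (hρ : IsAdmissible ρ) {𝒮 : ∀ n, Set (Fin k → Fin n → ℤˣ)}
    (h𝒮 : UniformRegime 𝒮) {α w : ℕ → ℝ} (hα0 : ∀ n, 0 ≤ α n)
    (hα : α =o[atTop] fun n : ℕ => √(n : ℝ))
    (hw : Tendsto (fun n : ℕ => √(n : ℝ) * w n) atTop (𝓝 0)) {ε : ℝ} (hε : 0 < ε) (hε1 : ε ≤ 1) :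
    ∀ᶠ n in atTop, ∀ σ ∈ 𝒮 n, ∀ (s : Fin k → ℤˣ) (θ : Fin k → ℝ),
      ‖θ‖ ≤ 2 * ‖corner α n s‖ → gradCGF ρ σ θ = corner α n s → 0 ≤ w n →
      sumLaw ρ σ ≪ volume ∧
      ∀ lo hi : Fin k → ℝ, (∀ j, α n ≤ lo j) → (∀ j, lo j ≤ hi j) → (∀ j, hi j ≤ α n + w n) →
        |(sumLaw ρ σ).real (signBox lo hi s) - (∏ j, (hi j - lo j)) * ((√(2 * Real.pi) ^ k)⁻¹ *
            Real.exp (-(n * tiltExponent ρ σ (corner α n s) θ)))| ≤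
          ε * ((∏ j, (hi j - lo j)) * ((√(2 * Real.pi) ^ k)⁻¹ *
            Real.exp (-(n * tiltExponent ρ σ (corner α n s) θ)))) := by
  have hpi := Real.pi_pos
  have hc₀ : 0 < (√(2 * Real.pi) ^ k)⁻¹ := by positivity
  set c₀ := (√(2 * Real.pi) ^ k)⁻¹
  have hw' : Tendsto w atTop (𝓝 0) := by
    refine squeeze_zero_norm' ?_ (by simpa using hw.norm)
    filter_upwards [eventually_ge_atTop 1] with n hn
    rw [abs_of_nonneg (Real.sqrt_nonneg _)]
    exact le_mul_of_one_le_left (norm_nonneg _) (Real.one_le_sqrt.2 (by exact_mod_cast hn))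
  have hx := tendsto_div_sqrt hα
  have hz := hw.const_mul (2 * (k : ℝ))
  rw [mul_zero] at hz
  filter_upwards [h𝒮.density hρ hα0 hα hw' (ε := c₀ * ε / 2) (by positivity),
    hx.eventually_lt_const one_pos, hz.eventually_lt_const (show 0 < ε / 8 by positivity),
    eventually_gt_atTop 0] with n hn hx1 hzn hn0 σ hσ s θ hθ hgrad hw0
  have hnR : (0 : ℝ) < n := by positivity
  have hsq : 0 < √(n : ℝ) := by positivity
  have hden := hn σ hσ s θ hθ hgrad
  obtain ⟨hi, hint, -⟩ := hden (WithLp.toLp 2 fun j => spin (s j) * α n) (fun j => by simpa using hw0)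
  refine ⟨hρ.sumLaw_absolutelyContinuous hn0 σ θ (fun s => hi _) hint, fun lo hi' hlo hlohi hhi => ?_⟩
  have := hρ.isProbabilityMeasure_tiltedSum hn0 σ θ (fun s => hi _)
  rw [hρ.sumLaw_real_eq hn0 σ θ (fun s => hi _) hint (measurableSet_signBox lo hi' s)]
  set T := tiltExponent ρ σ (corner α n s) θ with hT
  set f : EuclideanSpace ℝ (Fin k) → ℝ := fun y =>
    Real.exp (∑ s, cgf id (baseLaw ρ) (dot (pattern σ s) θ) - √n * ∑ j, θ j * y j) *
      (invCharFun (tiltedSum ρ σ θ) y).re with hf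
  have hfc : Continuous f := by
    have := Complex.continuous_re.comp (continuous_invCharFun hint)
    exact (by fun_prop : Continuous fun y : EuclideanSpace ℝ (Fin k) => Real.exp
      (∑ s, cgf id (baseLaw ρ) (dot (pattern σ s) θ) - √n * ∑ j, θ j * y j)).mul this
  have hbound : ∀ y ∈ signBox lo hi' s,
      |f y - c₀ * Real.exp (-(n * T))| ≤ ε * (c₀ * Real.exp (-(n * T))) := by
    intro y hy
    have hyj : ∀ j, |y j - spin (s j) * α n| ≤ w n := by
      intro j
      have h1 := hy j
      have h2 : |y j - spin (s j) * α n| = |spin (s j) * y j - α n| := by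
        rw [← one_mul |y j - _|, ← abs_spin (s j), ← abs_mul, mul_sub, ← mul_assoc, spin_mul_self,
          one_mul]
      rw [h2, abs_le]
      constructor <;> linarith [h1.1, h1.2, hlo j, hhi j]
    have hh := (hden y hyj).2.2
    set z := √n * ∑ j, θ j * (y j - spin (s j) * α n) with hz
    have hexp : ∑ s, cgf id (baseLaw ρ) (dot (pattern σ s) θ) - √n * ∑ j, θ j * y j =
        -(n * T) + -z := by
      have h1 : √(n : ℝ) * ∑ j, θ j * (spin (s j) * α n) = n * ∑ j, θ j * corner α n s j := by
        rw [Finset.mul_sum, Finset.mul_sum]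
        refine Finset.sum_congr rfl fun j _ => ?_
        rw [corner]
        nth_rewrite 2 [← Real.mul_self_sqrt hnR.le]
        field_simp
      rw [hT, tiltExponent, mul_sub, ← h1, mul_div_cancel₀ _ hnR.ne', hz]
      simp_rw [mul_sub, Finset.sum_sub_distrib]
      ring
    have hzle : |z| ≤ ε / 8 := by
      refine le_trans ?_ hzn.le
      rw [hz, abs_mul, abs_of_pos hsq]
      have hθ2 : ‖θ‖ ≤ 2 := hθ.trans (by linarith [norm_corner_le (hα0 n) s])
      calc √(n : ℝ) * |∑ j, θ j * (y j - spin (s j) * α n)|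
          ≤ √(n : ℝ) * ∑ _j : Fin k, 2 * w n := by
            gcongr
            refine (Finset.abs_sum_le_sum_abs _ _).trans (Finset.sum_le_sum fun j _ => ?_)
            rw [abs_mul]
            exact mul_le_mul ((norm_le_pi_norm θ j).trans hθ2) (hyj j) (abs_nonneg _) zero_le_two
        _ = 2 * k * (√n * w n) := by
            rw [Finset.sum_const, Finset.card_univ, Fintype.card_fin, nsmul_eq_mul]
            ring
    have h3 := abs_exp_neg_mul_sub_le hc₀ hε1 hzle hh
    simp only [hf]
    rw [hexp, Real.exp_add]
    calc |Real.exp (-(n * T)) * Real.exp (-z) * (invCharFun (tiltedSum ρ σ θ) y).re -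
          c₀ * Real.exp (-(n * T))|
        = |Real.exp (-(n * T))| *
          |Real.exp (-z) * (invCharFun (tiltedSum ρ σ θ) y).re - c₀| := by
          rw [← abs_mul]; congr 1; ring
      _ ≤ Real.exp (-(n * T)) * (ε * c₀) := by
          rw [abs_of_pos (Real.exp_pos _)]
          gcongr
      _ = _ := by ring
  have hvol : volume (signBox lo hi' s) < ⊤ := by
    rw [volume_signBox]
    exact ENNReal.prod_lt_top fun j _ => ENNReal.ofReal_lt_top
  have hfi : IntegrableOn f (signBox lo hi' s) := by
    refine Measure.integrableOn_of_bounded (M := (1 + ε) * (c₀ * Real.exp (-(n * T)))) hvol.ne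
      hfc.aestronglyMeasurable ((ae_restrict_mem (measurableSet_signBox lo hi' s)).mono fun y hy => ?_)
    have h1 := abs_le.1 (hbound y hy)
    have h2 : 0 < c₀ * Real.exp (-(n * T)) := by positivity
    rw [Real.norm_eq_abs, abs_le]
    constructor <;> nlinarith [h1.1, h1.2]
  have hsub : (∫ y in signBox lo hi' s, f y) -
      (∏ j, (hi' j - lo j)) * (c₀ * Real.exp (-(n * T))) =
      ∫ y in signBox lo hi' s, (f y - c₀ * Real.exp (-(n * T))) := by
    rw [integral_sub hfi (integrableOn_const hvol.ne), setIntegral_const, volume_real_signBox hlohi,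
      smul_eq_mul]
  rw [hsub]
  have := norm_setIntegral_le_of_norm_le_const hvol (f := fun y => f y - c₀ * Real.exp (-(n * T)))
    (C := ε * (c₀ * Real.exp (-(n * T)))) fun y hy => hbound y hy
  rw [volume_real_signBox hlohi] at this
  refine this.trans_eq ?_
  ring

theorem UniformRegime.energy_mem (hρ : IsAdmissible ρ) {𝒮 : ∀ n, Set (Fin k → Fin n → ℤˣ)}
    (h𝒮 : UniformRegime 𝒮) {α w : ℕ → ℝ} (hα0 : ∀ n, 0 ≤ α n)
    (hα : α =o[atTop] fun n : ℕ => √(n : ℝ)) (hw0 : ∀ᶠ n in atTop, 0 ≤ w n)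
    (hw : Tendsto (fun n : ℕ => √(n : ℝ) * w n) atTop (𝓝 0)) {ε : ℝ} (hε : 0 < ε) :
    ∀ᶠ n in atTop, ∀ σ ∈ 𝒮 n, ∀ θ : (Fin k → ℤˣ) → Fin k → ℝ,
      (∀ s, ‖θ s‖ ≤ 2 * ‖corner α n s‖ ∧ gradCGF ρ σ (θ s) = corner α n s) →
      ∀ lo hi : Fin k → ℝ, (∀ j, α n ≤ lo j) → (∀ j, lo j ≤ hi j) → (∀ j, hi j ≤ α n + w n) →
        |(law ρ n).real {X | ∀ j, energy (σ j) X ∈ Set.Icc (lo j) (hi j)} -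
          (∏ j, (hi j - lo j)) * (√(2 * Real.pi) ^ k)⁻¹ *
            ∑ s, Real.exp (-(n * tiltExponent ρ σ (corner α n s) (θ s)))| ≤
          ε * ((∏ j, (hi j - lo j)) * (√(2 * Real.pi) ^ k)⁻¹ *
            ∑ s, Real.exp (-(n * tiltExponent ρ σ (corner α n s) (θ s)))) := by
  filter_upwards [h𝒮.sumLaw_signBox hρ hα0 hα hw (ε := min ε 1) (by positivity) (min_le_right _ _), hw0]
    with n hn hw0 σ hσ θ hθ lo hi hlo hlohi hhi
  have hbox := fun s => hn σ hσ s (θ s) (hθ s).1 (hθ s).2 hw0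
  rw [law_real_energy_mem ρ σ _ fun j => measurableSet_Icc,
    sumLaw_real_abs_mem hρ σ (hbox 1).1 fun j => (hα0 n).trans (hlo j), Finset.mul_sum,
    Finset.mul_sum, ← Finset.sum_sub_distrib]
  refine (Finset.abs_sum_le_sum_abs _ _).trans (Finset.sum_le_sum fun s _ => ?_)
  have h1 := (hbox s).2 lo hi hlo hlohi hhi
  rw [mul_assoc]
  refine h1.trans (mul_le_mul_of_nonneg_right (min_le_left _ _) ?_)
  have : 0 ≤ ∏ j, (hi j - lo j) := Finset.prod_nonneg fun j _ => sub_nonneg.2 (hlohi j)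
  positivity

end Boxes

/-! ### The energy density and the size of the scaling factor. -/

section EnergyDensity

variable {ρ : ℝ → ℝ} {n : ℕ}

theorem setIntegral_euclideanSpace_one (g : EuclideanSpace ℝ (Fin 1) → ℝ) (J : Set ℝ) :
    ∫ y in {y | y 0 ∈ J}, g y = ∫ u in J, g (WithLp.toLp 2 fun _ => u) := by
  let e : EuclideanSpace ℝ (Fin 1) ≃ᵐ ℝ :=
    (MeasurableEquiv.toLp 2 (Fin 1 → ℝ)).symm.trans (MeasurableEquiv.funUnique (Fin 1) ℝ)
  have he : MeasurePreserving e volume volume :=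
    (volume_preserving_funUnique (Fin 1) ℝ).comp
      (EuclideanSpace.volume_preserving_symm_measurableEquiv_toLp (Fin 1))
  rw [← he.setIntegral_preimage_emb e.measurableEmbedding]
  have h1 : ∀ y : EuclideanSpace ℝ (Fin 1), WithLp.toLp 2 (fun _ => e y) = y := by
    intro y
    ext i
    have : i = 0 := Subsingleton.elim _ _
    subst this
    rfl
  simp_rw [h1]
  rfl

theorem hasDerivAt_integral_symmetric {g : ℝ → ℝ} (hg : Continuous g) (a : ℝ) :
    HasDerivAt (fun t => ∫ u in -t..t, g u) (g a + g (-a)) a := by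
  have h1 : HasDerivAt (fun t => ∫ u in (0 : ℝ)..t, g u) (g a) a :=
    (hg.integral_hasStrictDerivAt 0 a).hasDerivAt
  have h2 : HasDerivAt (fun t => ∫ u in (0 : ℝ)..-t, g u) (-g (-a)) a := by
    have := ((hg.integral_hasStrictDerivAt 0 (-a)).hasDerivAt).scomp a (hasDerivAt_neg a)
    simpa [Function.comp_def] using this
  have h3 := h1.sub h2
  rw [sub_neg_eq_add] at h3
  refine h3.congr_of_eventuallyEq (Eventually.of_forall fun t => ?_)
  exact (intervalIntegral.integral_interval_sub_left (hg.intervalIntegrable _ _)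
    (hg.intervalIntegrable _ _)).symm

/-- The density of the signed energy of `σ = (1, …, 1)`, written with the help of a tilt. -/
noncomputable def signedDensity (ρ : ℝ → ℝ) (n : ℕ) (θ : Fin 1 → ℝ) (u : ℝ) : ℝ :=
  Real.exp (∑ s, cgf id (baseLaw ρ) (dot (pattern (fun _ : Fin 1 => (1 : Fin n → ℤˣ)) s) θ) -
      √n * (θ 0 * u)) *
    (invCharFun (tiltedSum ρ (fun _ : Fin 1 => (1 : Fin n → ℤˣ)) θ) (WithLp.toLp 2 fun _ => u)).re

/-- For t ≥ a ≥ 0 the distribution function is the integral of a continuous density over [-t, t].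
Its derivative collects both end points, and the formula remains valid at a = 0 because only the
right derivative is taken. -/
theorem IsAdmissible.energyDensity_eq (hρ : IsAdmissible ρ) (hn : 0 < n) {θ : Fin 1 → ℝ}
    (hi : ∀ δ, dot δ θ ∈ interior (integrableExpSet id (baseLaw ρ)))
    (hint : Integrable (charFun (tiltedSum ρ (fun _ : Fin 1 => (1 : Fin n → ℤˣ)) θ))) {a : ℝ}
    (ha : 0 ≤ a) :
    energyDensity ρ n a = signedDensity ρ n θ a + signedDensity ρ n θ (-a) := by
  set σ : Fin 1 → Fin n → ℤˣ := fun _ => 1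
  have := hρ.isProbabilityMeasure_tiltedSum hn σ θ (fun s => hi _)
  have hcont : Continuous (signedDensity ρ n θ) := by
    have h1 := (Complex.continuous_re.comp (continuous_invCharFun hint)).comp
      (by fun_prop : Continuous fun u : ℝ => (WithLp.toLp 2 fun _ => u : EuclideanSpace ℝ (Fin 1)))
    unfold signedDensity
    exact Continuous.mul (by fun_prop) h1
  have hF : ∀ t ∈ Set.Ici a, (law ρ n).real {X | energy (1 : Fin n → ℤˣ) X ≤ t} =
      ∫ u in -t..t, signedDensity ρ n θ u := by
    intro t ht
    have ht0 : 0 ≤ t := ha.trans ht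
    have h1 := law_real_energy_mem ρ σ (fun _ => Set.Iic t) fun _ => measurableSet_Iic
    simp only [Fin.forall_fin_one, Set.mem_Iic] at h1
    have h2 : {y : EuclideanSpace ℝ (Fin 1) | |y 0| ≤ t} = {y | y 0 ∈ Set.Icc (-t) t} := by
      ext y
      simp [abs_le]
    have hm : MeasurableSet {y : EuclideanSpace ℝ (Fin 1) | y 0 ∈ Set.Icc (-t) t} :=
      (show Measurable fun y : EuclideanSpace ℝ (Fin 1) => y 0 by fun_prop) measurableSet_Icc
    rw [h1, h2, hρ.sumLaw_real_eq hn σ θ (fun s => hi _) hint hm, setIntegral_euclideanSpace_one,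
      intervalIntegral.integral_of_le (by linarith), ← integral_Icc_eq_integral_Ioc]
    refine integral_congr_ae (ae_of_all _ fun u => ?_)
    simp only [signedDensity, Fin.sum_univ_one]
    rfl
  have hd := (hasDerivAt_integral_symmetric hcont a).hasDerivWithinAt (s := Set.Ici a)
  exact (hd.congr hF (hF a Set.self_mem_Ici)).derivWithin (uniqueDiffOn_Ici a a Set.self_mem_Ici)

/-- A crude bound suffices: the contribution at -α_n is dropped, K ≥ 0, and the tilt costs at most
√n θα_n ≤ 2α_n². -/
theorem IsAdmissible.le_energyDensity (hρ : IsAdmissible ρ) {α : ℕ → ℝ} (hα0 : ∀ n, 0 ≤ α n)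
    (hα : α =o[atTop] fun n : ℕ => √(n : ℝ)) :
    ∀ᶠ n in atTop, (2 * √(2 * Real.pi))⁻¹ * Real.exp (-(2 * α n ^ 2)) ≤ energyDensity ρ n (α n) := by
  have hpi := Real.pi_pos
  have hc₀ : 0 < (√(2 * Real.pi) ^ 1)⁻¹ := by positivity
  obtain ⟨r, R, q, -, hR, -, hsaddle⟩ := hρ.exists_saddle 1
  filter_upwards [uniformRegime_one.density hρ (w := fun _ => 0) hα0 hα tendsto_const_nhds
      (ε := (√(2 * Real.pi) ^ 1)⁻¹ / 2) (by positivity),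
    (tendsto_div_sqrt hα).eventually_lt_const hR, eventually_gt_atTop 0] with n hn hx hn0
  have hnR : (0 : ℝ) < n := by positivity
  set σ : Fin 1 → Fin n → ℤˣ := fun _ => 1
  obtain ⟨η, -, -, -, hθ, hgrad, -⟩ := hsaddle n hn0 σ
    (fun j l h => absurd (Subsingleton.elim j l) h) (corner α n 1)
    ((norm_corner_le (hα0 n) 1).trans_lt hx)
  set θ := (2 * Real.pi) • η
  obtain ⟨hi, hint, hh⟩ := hn σ rfl 1 θ hθ hgrad (WithLp.toLp 2 fun _ => α n)
    (fun j => by simp [spin])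
  have := hρ.isProbabilityMeasure_tiltedSum hn0 σ θ (fun s => hi _)
  rw [hρ.energyDensity_eq hn0 hi hint (hα0 n)]
  have h1 : 0 ≤ signedDensity ρ n θ (-α n) :=
    mul_nonneg (Real.exp_pos _).le (invCharFun_re_nonneg hint _)
  have h2 : (2 * √(2 * Real.pi))⁻¹ * Real.exp (-(2 * α n ^ 2)) ≤ signedDensity ρ n θ (α n) := by
    rw [signedDensity, mul_comm]
    refine mul_le_mul ?_ ?_ (by positivity) (Real.exp_pos _).le
    · refine Real.exp_le_exp.2 ?_
      have h3 : 0 ≤ ∑ s, cgf id (baseLaw ρ) (dot (pattern σ s) θ) := by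
        refine Finset.sum_nonneg fun s _ => hρ.cgf_nonneg (hi _) ?_
        have h4 := hi (-pattern σ s)
        have h5 : dot (-pattern σ s) θ = -dot (pattern σ s) θ := by
          simp [dot, spin]
        rwa [h5] at h4
      have h4 : √(n : ℝ) * (θ 0 * α n) ≤ 2 * α n ^ 2 := by
        have h5 : θ 0 ≤ 2 * (α n / √n) := (le_abs_self _).trans
          ((norm_le_pi_norm θ 0).trans (hθ.trans (by
            gcongr; exact norm_corner_le (hα0 n) 1)))
        calc √(n : ℝ) * (θ 0 * α n) ≤ √(n : ℝ) * (2 * (α n / √n) * α n) := by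
              have := hα0 n
              gcongr
          _ = 2 * α n ^ 2 := by field_simp
      change -(2 * α n ^ 2) ≤ ∑ s, cgf id (baseLaw ρ) (dot (pattern σ s) θ) - √n * (θ 0 * α n)
      linarith
    · have h3 := (abs_le.1 hh).1
      have h4 : (2 * √(2 * Real.pi))⁻¹ = (√(2 * Real.pi) ^ 1)⁻¹ / 2 := by
        rw [pow_one, mul_inv]
        ring
      rw [h4]
      change _ ≤ (invCharFun (tiltedSum ρ σ θ) (WithLp.toLp 2 fun _ => α n)).re
      linarith
  linarith

theorem IsAdmissible.eventually_xi_pos (hρ : IsAdmissible ρ) {α : ℕ → ℝ} (hα0 : ∀ n, 0 ≤ α n)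
    (hα : α =o[atTop] fun n : ℕ => √(n : ℝ)) : ∀ᶠ n in atTop, 0 < xi ρ α n := by
  filter_upwards [hρ.le_energyDensity hα0 hα] with n hn
  have hpi := Real.pi_pos
  have : 0 < energyDensity ρ n (α n) := lt_of_lt_of_le (by positivity) hn
  rw [xi]
  positivity

/-- The factor 2^{n-1} beats e^{-2α_n²} because α_n = o(√n), so ξ_n is exponentially small. -/
theorem IsAdmissible.tendsto_sqrt_mul_xi (hρ : IsAdmissible ρ) {α : ℕ → ℝ} (hα0 : ∀ n, 0 ≤ α n)
    (hα : α =o[atTop] fun n : ℕ => √(n : ℝ)) :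
    Tendsto (fun n : ℕ => √(n : ℝ) * xi ρ α n) atTop (𝓝 0) := by
  have hpi := Real.pi_pos
  have h0 := (tendsto_sqrt_pow_mul_exp_neg 1 (c := 1 / 4) (by norm_num)).const_mul
    (4 * √(2 * Real.pi))
  rw [mul_zero] at h0
  refine squeeze_zero' ?_ ?_ h0
  · filter_upwards [hρ.eventually_xi_pos hα0 hα] with n hn
    positivity
  · filter_upwards [hρ.le_energyDensity hα0 hα, eventually_gt_atTop 0,
      (tendsto_div_sqrt hα).eventually_lt_const (show (0 : ℝ) < 1 / 3 by norm_num)] with n hg hn hx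
    have hnR : (0 : ℝ) < n := by positivity
    have hsq : 0 < √(n : ℝ) := by positivity
    have hα2 : 2 * α n ^ 2 ≤ n / 4 := by
      rw [div_lt_iff₀ hsq] at hx
      have h1 : α n ^ 2 ≤ (1 / 3 * √n) ^ 2 := pow_le_pow_left₀ (hα0 n) hx.le 2
      rw [mul_pow, Real.sq_sqrt hnR.le] at h1
      linarith
    -- This only uses log 2 > 1/2. Together with 2α_n² ≤ n/4 it leaves a net growth e^{n/4}.
    have hpow : Real.exp (n / 2) ≤ 2 * 2 ^ (n - 1) := by
      rw [← pow_succ', Nat.sub_add_cancel hn, ← Real.rpow_natCast 2 n,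
        Real.rpow_def_of_pos (by norm_num)]
      refine Real.exp_le_exp.2 ?_
      nlinarith [Real.log_two_gt_d9]
    have hden : (4 * √(2 * Real.pi))⁻¹ * Real.exp (n / 4) ≤
        2 ^ (n - 1) * energyDensity ρ n (α n) := by
      calc (4 * √(2 * Real.pi))⁻¹ * Real.exp (n / 4)
          = (Real.exp (n / 2) / 2) * ((2 * √(2 * Real.pi))⁻¹ * Real.exp (-(n / 4))) := by
            rw [show (n : ℝ) / 2 = n / 4 + n / 4 by ring, Real.exp_add, Real.exp_neg]
            field_simp
            norm_num
        _ ≤ 2 ^ (n - 1) * energyDensity ρ n (α n) := by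
            refine mul_le_mul (by linarith) (le_trans ?_ hg) (by positivity) (by positivity)
            gcongr
    rw [xi, pow_one]
    calc √(n : ℝ) * (1 / (2 ^ (n - 1) * energyDensity ρ n (α n)))
        ≤ √(n : ℝ) * (1 / ((4 * √(2 * Real.pi))⁻¹ * Real.exp (n / 4))) := by gcongr
      _ = 4 * √(2 * Real.pi) * (√n * Real.exp (-(1 / 4 * n))) := by
        rw [Real.exp_neg, show (1 : ℝ) / 4 * n = n / 4 by ring]
        field_simp

end EnergyDensity

/-! ### Balanced families have small overlaps and many sites of every pattern. -/

section BalancedFamilies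

variable {k n : ℕ}

/-- Flipping the sign of coordinate j is a bijection that reverses every term. -/
theorem sum_spin_mul_spin {j l : Fin k} (h : j ≠ l) :
    ∑ δ : Fin k → ℤˣ, spin (δ j) * spin (δ l) = 0 := by
  have h1 := Fintype.sum_equiv (Equiv.mulLeft (Pi.mulSingle j (-1) : Fin k → ℤˣ))
    (fun δ => -(spin (δ j) * spin (δ l))) (fun δ => spin (δ j) * spin (δ l)) (fun δ => by
      simp [h.symm, spin])
  rw [Finset.sum_neg_distrib] at h1
  linarith

/-- Equal pattern counts would give overlap zero, so only the deviations n_δ - n2^{-k} contribute.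
-/
theorem Balanced.abs_overlap_le (hn : 0 < n) {lam : ℝ} {σ : Fin k → Fin n → ℤˣ}
    (h : Balanced lam σ) {j l : Fin k} (hjl : j ≠ l) :
    |overlap (σ j) (σ l)| ≤ 2 ^ k * (lam / √n) := by
  have hnR : (0 : ℝ) < n := by positivity
  have hsq : 0 < √(n : ℝ) := by positivity
  have h1 : overlap (σ j) (σ l) =
      (∑ δ : Fin k → ℤˣ, ((patternCount σ δ : ℝ) - n / 2 ^ k) * (spin (δ j) * spin (δ l))) / n := by
    have h2 := sum_pattern σ fun δ => spin (δ j) * spin (δ l)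
    simp only [nsmul_eq_mul, pattern] at h2
    simp_rw [sub_mul, Finset.sum_sub_distrib, ← Finset.mul_sum, sum_spin_mul_spin hjl, mul_zero,
      sub_zero]
    rw [overlap, h2]
  rw [h1, abs_div, abs_of_pos hnR, div_le_iff₀ hnR]
  calc _ ≤ ∑ δ : Fin k → ℤˣ, |((patternCount σ δ : ℝ) - n / 2 ^ k) * (spin (δ j) * spin (δ l))| :=
        Finset.abs_sum_le_sum_abs _ _
    _ ≤ ∑ _δ : Fin k → ℤˣ, √n * lam := Finset.sum_le_sum fun δ _ => by
        rw [abs_mul, abs_mul, abs_spin, abs_spin, mul_one, mul_one]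
        exact h δ
    _ = 2 ^ k * (lam / √n) * n := by
        rw [Finset.sum_const, Finset.card_univ, Fintype.card_fun, Fintype.card_units_int,
          Fintype.card_fin, nsmul_eq_mul]
        push_cast
        have : (n : ℝ) = √n * √n := (Real.mul_self_sqrt hnR.le).symm
        rw [mul_assoc, div_mul_eq_mul_div, div_eq_of_eq_mul hsq.ne' (c := √n * lam)]
        rw [mul_right_comm, ← this, mul_comm]

theorem uniformRegime_balanced {lam : ℕ → ℝ} (hlam : lam =o[atTop] fun n : ℕ => √(n : ℝ)) :
    UniformRegime fun n => {σ : Fin k → Fin n → ℤˣ | Balanced (lam n) σ} := by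
  have h0 := tendsto_div_sqrt hlam
  refine ⟨fun ε hε => ?_, fun M => ?_⟩
  · have h1 := h0.const_mul ((2 : ℝ) ^ k)
    rw [mul_zero] at h1
    filter_upwards [h1.eventually_lt_const hε, eventually_gt_atTop 0] with n hn hn0 σ hσ j l hjl
    exact (Balanced.abs_overlap_le hn0 hσ hjl).trans hn.le
  · filter_upwards [h0.eventually_lt_const (show (0 : ℝ) < 1 / 2 ^ (k + 1) by positivity),
      (tendsto_natCast_atTop_atTop (R := ℝ)).eventually_ge_atTop (M * 2 ^ (k + 1)),
      eventually_gt_atTop 0] with n hn hM hn0 σ hσ j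
    have hnR : (0 : ℝ) < n := by positivity
    have hsq : 0 < √(n : ℝ) := by positivity
    have h1 := (abs_le.1 (hσ (flipPattern j))).1
    rw [div_lt_iff₀ hsq] at hn
    have h2 : √n * lam n ≤ n / 2 ^ (k + 1) := by
      calc √n * lam n ≤ √n * (1 / 2 ^ (k + 1) * √n) := by gcongr
        _ = (√n * √n) / 2 ^ (k + 1) := by ring
        _ = n / 2 ^ (k + 1) := by rw [Real.mul_self_sqrt hnR.le]
    have h3 : (n : ℝ) / 2 ^ k = n / 2 ^ (k + 1) + n / 2 ^ (k + 1) := by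
      rw [pow_succ]
      field_simp
      norm_num
    have h4 : (M : ℝ) ≤ n / 2 ^ (k + 1) := by rwa [le_div_iff₀ (by positivity)]
    have h5 : (M : ℝ) ≤ patternCount σ (flipPattern j) := by linarith
    exact_mod_cast h5

theorem qMax_nonneg (σ : Fin k → Fin n → ℤˣ) : 0 ≤ qMax σ :=
  Real.iSup_nonneg fun _ => abs_nonneg _

theorem abs_overlap_le_qMax (σ : Fin k → Fin n → ℤˣ) {j l : Fin k} (h : j ≠ l) :
    |overlap (σ j) (σ l)| ≤ qMax σ :=
  le_ciSup (f := fun p : {p : Fin k × Fin k // p.1 ≠ p.2} => |overlap (σ p.1.1) (σ p.1.2)|)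
    (Set.finite_range _).bddAbove ⟨(j, l), h⟩

theorem qMax_le {σ : Fin k → Fin n → ℤˣ} {q : ℝ} (hq0 : 0 ≤ q)
    (hq : ∀ j l, j ≠ l → |overlap (σ j) (σ l)| ≤ q) : qMax σ ≤ q :=
  Real.iSup_le (fun p => hq _ _ p.2) hq0

end BalancedFamilies

/-! ### Logarithmic asymptotics below n^{1/4}. -/

section Logarithm

variable {ρ : ℝ → ℝ} {k n : ℕ}

theorem abs_log_sub_log_le {P B a : ℝ} (hB : 0 < B) (h1 : Real.exp (-a) * B ≤ P)
    (h2 : P ≤ Real.exp a * B) : 0 < P ∧ |Real.log P - Real.log B| ≤ a := by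
  have hP : 0 < P := lt_of_lt_of_le (by positivity) h1
  refine ⟨hP, ?_⟩
  have h3 := Real.log_le_log (by positivity) h1
  have h4 := Real.log_le_log hP h2
  rw [Real.log_mul (Real.exp_pos _).ne' hB.ne', Real.log_exp] at h3 h4
  rw [abs_le]
  constructor <;> linarith

theorem sum_corner_sq {α : ℕ → ℝ} (s : Fin k → ℤˣ) :
    ∑ j, corner α n s j ^ 2 = k * (α n ^ 2 / n) := by
  have : ∀ j, corner α n s j ^ 2 = α n ^ 2 / n := fun j => by
    rw [corner, mul_pow, sq (spin _), spin_mul_self, one_mul, div_pow,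
      Real.sq_sqrt (Nat.cast_nonneg n)]
  simp [this]

/-- Every one of the 2^k exponents is kα_n²/2 up to C(α_n² q + α_n⁴/n). The leading term is then a
sum over j of one-configuration terms, and the deviation from additivity is all in the error. -/
theorem UniformRegime.log_energy_mem (hρ : IsAdmissible ρ) {𝒮 : ∀ n, Set (Fin k → Fin n → ℤˣ)}
    (h𝒮 : UniformRegime 𝒮) {α w : ℕ → ℝ} (hα0 : ∀ n, 0 ≤ α n)
    (hα : α =o[atTop] fun n : ℕ => √(n : ℝ))
    (hα' : α =o[atTop] fun n : ℕ => (n : ℝ) ^ (1 / 4 : ℝ)) (hw0 : ∀ᶠ n in atTop, 0 ≤ w n)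
    (hw : Tendsto (fun n : ℕ => √(n : ℝ) * w n) atTop (𝓝 0)) :
    ∃ C : ℝ, ∀ ε : ℝ, 0 < ε → ∀ᶠ n in atTop, ∀ σ ∈ 𝒮 n, ∀ q : ℝ, 0 ≤ q → q ≤ 1 →
      (∀ j l, j ≠ l → |overlap (σ j) (σ l)| ≤ q) → ∀ lo hi : Fin k → ℝ, (∀ j, α n ≤ lo j) →
      (∀ j, lo j < hi j) → (∀ j, hi j ≤ α n + w n) →
      0 < (law ρ n).real {X | ∀ j, energy (σ j) X ∈ Set.Icc (lo j) (hi j)} ∧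
      |Real.log ((law ρ n).real {X | ∀ j, energy (σ j) X ∈ Set.Icc (lo j) (hi j)}) -
        ∑ j, (Real.log (hi j - lo j) + (Real.log (2 / √(2 * Real.pi)) - α n ^ 2 / 2))| ≤
        C * (α n ^ 2 * q) + ε := by
  have hpi := Real.pi_pos
  obtain ⟨C, δ, hC, hδ, hval⟩ := hρ.exists_abs_tiltExponent_sub_le k
  obtain ⟨r, R, q₀, -, hR, hq₀, hsaddle⟩ := hρ.exists_saddle k
  refine ⟨C, fun ε hε => ?_⟩
  have hquart : Tendsto (fun n : ℕ => C * (α n ^ 4 / n)) atTop (𝓝 0) := by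
    have h1 := (hα'.tendsto_div_nhds_zero.pow 4).const_mul C
    rw [zero_pow (by norm_num), mul_zero] at h1
    refine h1.congr fun n => ?_
    rw [div_pow, ← Real.rpow_natCast ((n : ℝ) ^ (1 / 4 : ℝ)), ← Real.rpow_mul (Nat.cast_nonneg n)]
    norm_num
  -- The relative error costs 2ε₁ ≤ ε/2 in the logarithm and the quartic term the other ε/2. The cap
  -- 1/2 gives e^{-2ε₁} ≤ 1 - ε₁.
  set ε₁ := min (ε / 4) (1 / 2) with hε₁
  have hε₁0 : 0 < ε₁ := by positivity
  filter_upwards [h𝒮.energy_mem hρ hα0 hα hw0 hw hε₁0, h𝒮.overlaps q₀ hq₀,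
    (tendsto_div_sqrt hα).eventually_lt_const (lt_min hR hδ),
    hquart.eventually_lt_const (show 0 < ε / 2 by positivity), eventually_gt_atTop 0]
    with n hn hov hx hquart hn0 σ hσ q hq0 hq1 hq lo hi hlo hlohi hhi
  have hnR : (0 : ℝ) < n := by positivity
  have hsq : 0 < √(n : ℝ) := by positivity
  have hxs := fun s : Fin k → ℤˣ => norm_corner_le (hα0 n) s
  choose η _ _ _ hθ hgrad _ using fun s : Fin k → ℤˣ => hsaddle n hn0 σ (hov σ hσ) (corner α n s)
    ((hxs s).trans_lt (hx.trans_le (min_le_left _ _)))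
  have hP := hn σ hσ (fun s => (2 * Real.pi) • η s) (fun s => ⟨hθ s, hgrad s⟩) lo hi hlo
    (fun j => (hlohi j).le) hhi
  set P := (law ρ n).real {X | ∀ j, energy (σ j) X ∈ Set.Icc (lo j) (hi j)}
  set T : (Fin k → ℤˣ) → ℝ := fun s => tiltExponent ρ σ (corner α n s) ((2 * Real.pi) • η s) with hT
  set D := C * (α n ^ 2 * q) + C * (α n ^ 4 / n) with hD
  have hTD : ∀ s, |n * T s - k * (α n ^ 2 / 2)| ≤ D := by
    intro s
    have h1 := hval n hn0 σ q hq0 hq1 hq (corner α n s) _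
      ((hxs s).trans_lt (hx.trans_le (min_le_right _ _))) (hθ s) (hgrad s)
    rw [sum_corner_sq] at h1
    have h2 : ‖corner α n s‖ ^ 2 ≤ α n ^ 2 / n := by
      calc ‖corner α n s‖ ^ 2 ≤ (α n / √n) ^ 2 := by gcongr; exact hxs s
        _ = α n ^ 2 / n := by rw [div_pow, Real.sq_sqrt hnR.le]
    have h3 : ‖corner α n s‖ ^ 4 ≤ (α n ^ 2 / n) ^ 2 := by
      calc ‖corner α n s‖ ^ 4 = (‖corner α n s‖ ^ 2) ^ 2 := by ring
        _ ≤ _ := by gcongr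
    have h4 : n * T s - k * (α n ^ 2 / 2) = n * (T s - k * (α n ^ 2 / n) / 2) := by field_simp
    rw [h4, abs_mul, abs_of_pos hnR]
    calc n * |T s - k * (α n ^ 2 / n) / 2|
        ≤ n * (C * (q * (α n ^ 2 / n) + (α n ^ 2 / n) ^ 2)) := by
          refine mul_le_mul_of_nonneg_left (h1.trans ?_) hnR.le
          gcongr
      _ = D := by
          rw [hD]
          field_simp
  set B := (∏ j, (hi j - lo j)) * (√(2 * Real.pi) ^ k)⁻¹ *
    (2 ^ k * Real.exp (-(k * (α n ^ 2 / 2)))) with hBdef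
  have hV : 0 < ∏ j, (hi j - lo j) := Finset.prod_pos fun j _ => sub_pos.2 (hlohi j)
  have hB : 0 < B := by positivity
  have hcard : ∀ a : ℝ, ∑ _s : Fin k → ℤˣ, a = 2 ^ k * a := fun a => by
    rw [Finset.sum_const, Finset.card_univ, Fintype.card_fun, Fintype.card_units_int,
      Fintype.card_fin, nsmul_eq_mul]
    push_cast
    rfl
  have hlow : 2 ^ k * Real.exp (-(k * (α n ^ 2 / 2))) * Real.exp (-D) ≤
      ∑ s, Real.exp (-(n * T s)) := by
    rw [mul_assoc, ← Real.exp_add, ← hcard]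
    exact Finset.sum_le_sum fun s _ => Real.exp_le_exp.2 (by linarith [(abs_le.1 (hTD s)).2])
  have hupp : ∑ s, Real.exp (-(n * T s)) ≤
      2 ^ k * Real.exp (-(k * (α n ^ 2 / 2))) * Real.exp D := by
    rw [mul_assoc, ← Real.exp_add, ← hcard]
    exact Finset.sum_le_sum fun s _ => Real.exp_le_exp.2 (by linarith [(abs_le.1 (hTD s)).1])
  set Q := (∏ j, (hi j - lo j)) * (√(2 * Real.pi) ^ k)⁻¹ * ∑ s, Real.exp (-(n * T s)) with hQ
  have hQlow : B * Real.exp (-D) ≤ Q := by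
    rw [hBdef, mul_assoc, hQ]
    gcongr
  have hQupp : Q ≤ B * Real.exp D := by
    rw [hBdef, mul_assoc _ _ (Real.exp D), hQ]
    gcongr
  have hPQ := abs_le.1 hP
  have hε₁2 : ε₁ ≤ 1 / 2 := min_le_right _ _
  have hQ0 : 0 < Q := lt_of_lt_of_le (by positivity) hQlow
  have e1 : 1 + ε₁ ≤ Real.exp (2 * ε₁) := by
    have := Real.add_one_le_exp (2 * ε₁)
    linarith
  have e2 : Real.exp (-(2 * ε₁)) ≤ 1 - ε₁ := by
    rw [Real.exp_neg, inv_le_iff_one_le_mul₀ (Real.exp_pos _)]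
    nlinarith [Real.add_one_le_exp (2 * ε₁)]
  have hfin := abs_log_sub_log_le (P := P) (a := 2 * ε₁ + D) hB
    (by
      calc Real.exp (-(2 * ε₁ + D)) * B = Real.exp (-(2 * ε₁)) * (B * Real.exp (-D)) := by
            rw [neg_add, Real.exp_add]; ring
        _ ≤ (1 - ε₁) * Q := mul_le_mul e2 hQlow (by positivity) (by linarith)
        _ ≤ P := by linarith [hPQ.1])
    (by
      calc P ≤ (1 + ε₁) * Q := by linarith [hPQ.2]
        _ ≤ Real.exp (2 * ε₁) * (B * Real.exp D) :=
          mul_le_mul e1 hQupp hQ0.le (Real.exp_pos _).le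
        _ = Real.exp (2 * ε₁ + D) * B := by rw [Real.exp_add _ D, mul_comm B, mul_assoc])
  refine ⟨hfin.1, ?_⟩
  have hlogB : Real.log B =
      ∑ j, (Real.log (hi j - lo j) + (Real.log (2 / √(2 * Real.pi)) - α n ^ 2 / 2)) := by
    have hs : √(2 * Real.pi) ≠ 0 := by positivity
    rw [Finset.sum_add_distrib, ← Real.log_prod fun j _ => (sub_pos.2 (hlohi j)).ne',
      Finset.sum_const, Finset.card_univ, Fintype.card_fin, nsmul_eq_mul, hBdef,
      Real.log_mul (by positivity) (by positivity), Real.log_mul hV.ne' (by positivity),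
      Real.log_mul (by positivity) (by positivity), Real.log_exp, Real.log_inv, Real.log_pow,
      Real.log_pow, Real.log_div two_ne_zero hs]
    ring
  rw [← hlogB]
  refine hfin.2.trans ?_
  have : ε₁ ≤ ε / 4 := min_le_left _ _
  linarith

/-- Flipping the signs of coordinates preserves the product law of an even density, so a single
configuration may be replaced by the constant one. -/
theorem IsAdmissible.law_real_energy_mem_eq (hρ : IsAdmissible ρ) (σ : Fin n → ℤˣ) {J : Set ℝ}
    (hJ : MeasurableSet J) :
    (law ρ n).real {X | energy σ X ∈ J} = (law ρ n).real {X | energy (1 : Fin n → ℤˣ) X ∈ J} := by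
  have := hρ.isProbabilityMeasure
  have h1 : ∀ i, MeasurePreserving (fun x => spin (σ i) * x) (baseLaw ρ) (baseLaw ρ) := by
    intro i
    rcases Int.units_eq_one_or (σ i) with h | h
    · simp only [h, spin, Units.val_one, Int.cast_one, one_mul]
      exact MeasurePreserving.id (baseLaw ρ)
    · simpa [h, spin] using hρ.measurePreserving_neg
  have h2 : MeasurePreserving (fun (X : Fin n → ℝ) i => spin (σ i) * X i) (law ρ n) (law ρ n) :=
    measurePreserving_pi _ _ h1
  have hm : MeasurableSet {X : Fin n → ℝ | energy (1 : Fin n → ℤˣ) X ∈ J} := by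
    have : Measurable fun X : Fin n → ℝ => energy (1 : Fin n → ℤˣ) X := by
      unfold energy
      fun_prop
    exact this hJ
  rw [measureReal_def, measureReal_def, ← h2.measure_preimage hm.nullMeasurableSet]
  congr 2
  ext X
  simp [energy, spin]

end Logarithm

end NPP

/-! ### Assembly of the two assertions. -/

theorem proposition5p6
    (ρ : ℝ → ℝ) (hρ : NPP.IsAdmissible ρ)
    -- the energy scale `α_n` and the balance parameter `λ_n`
    (α lam : ℕ → ℝ) (hα0 : ∀ n, 0 ≤ α n) (hlam0 : ∀ n, 0 ≤ lam n)
    (hα : α =o[atTop] fun n : ℕ => √(n : ℝ))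
    (hlam : lam =o[atTop] fun n : ℕ => √(n : ℝ))
    -- the intervals `[c_ℓ, d_ℓ]`, and the assignment `j ↦ ℓ(j)` that uses the `ℓ`-th one `k_ℓ` times
    (m k : ℕ) (c d : Fin m → ℝ) (hc : ∀ l, 0 ≤ c l) (hcd : ∀ l, c l < d l)
    (kk : Fin m → ℕ) (ell : Fin k → Fin m)
    (hkk : ∀ l, Fintype.card {j : Fin k // ell j = l} = kk l) :
    -- the saddle point representation, with an error that is uniform in the configurations
    (∃ r : ℝ, 0 < r ∧ ∀ ε : ℝ, 0 < ε → ∀ᶠ n : ℕ in atTop,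
      ∀ σ : Fin k → Fin n → ℤˣ, NPP.Balanced (lam n) σ →
        ∃ (η : (Fin k → ℤˣ) → Fin k → ℝ) (G : (Fin k → ℤˣ) → ℝ),
          (∀ s, ‖η s‖ < r ∧ NPP.IsSaddlePoint ρ σ (NPP.corner α n s) (η s)) ∧
          (∀ s η', ‖η'‖ < r → NPP.IsSaddlePoint ρ σ (NPP.corner α n s) η' → η' = η s) ∧
          (∀ s, (G s : ℂ) = NPP.action ρ σ (NPP.corner α n s) (η s)) ∧
          |(NPP.law ρ n).real
                {X | ∀ j, NPP.energy (σ j) X ∈ NPP.window ρ α n (c (ell j)) (d (ell j))}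
              - (∏ l, (d l - c l) ^ kk l) * (NPP.xi ρ α n / √(2 * Real.pi)) ^ k
                * ∑ s, Real.exp (-(n * G s))|
            ≤ ε * ((∏ l, (d l - c l) ^ kk l) * (NPP.xi ρ α n / √(2 * Real.pi)) ^ k
                * ∑ s, Real.exp (-(n * G s)))) ∧
    -- the approximate factorization
    ((α =o[atTop] fun n : ℕ => (n : ℝ) ^ (1 / 4 : ℝ)) →
      ∃ C : ℝ, ∀ ε : ℝ, 0 < ε → ∀ᶠ n : ℕ in atTop,
        ∀ σ : Fin k → Fin n → ℤˣ, NPP.Balanced (lam n) σ →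
          ∃ θ : ℝ, |θ| ≤ C * (α n ^ 2 * NPP.qMax σ) + ε ∧
            (NPP.law ρ n).real
                {X | ∀ j, NPP.energy (σ j) X ∈ NPP.window ρ α n (c (ell j)) (d (ell j))}
              = (∏ j, (NPP.law ρ n).real
                  {X | NPP.energy (σ j) X ∈ NPP.window ρ α n (c (ell j)) (d (ell j))})
                * Real.exp θ) := by
  have hwD : ∀ l, d l ≤ ∑ l, d l := fun l =>
    Finset.single_le_sum (fun i _ => (hc i).trans (hcd i).le) (Finset.mem_univ l)
  have hD0 : 0 ≤ ∑ l, d l := Finset.sum_nonneg fun i _ => (hc i).trans (hcd i).le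
  have hξ := hρ.eventually_xi_pos hα0 hα
  -- The single width ξ_n ∑ d_ℓ dominates the right end points of all windows at once.
  have hw0 : ∀ᶠ n in atTop, 0 ≤ NPP.xi ρ α n * ∑ l, d l := by
    filter_upwards [hξ] with n hn using mul_nonneg hn.le hD0
  have hw : Tendsto (fun n : ℕ => √(n : ℝ) * (NPP.xi ρ α n * ∑ l, d l)) atTop (𝓝 0) := by
    have := (hρ.tendsto_sqrt_mul_xi hα0 hα).mul_const (∑ l, d l)
    simpa only [mul_assoc, zero_mul] using this
  have hreg : NPP.UniformRegime fun n => {σ : Fin k → Fin n → ℤˣ | NPP.Balanced (lam n) σ} :=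
    NPP.uniformRegime_balanced hlam
  have hlo : ∀ n, 0 < NPP.xi ρ α n → ∀ j, α n ≤ α n + c (ell j) * NPP.xi ρ α n := fun n hn j =>
    le_add_of_nonneg_right (mul_nonneg (hc _) hn.le)
  have hlohi : ∀ n, 0 < NPP.xi ρ α n → ∀ j,
      α n + c (ell j) * NPP.xi ρ α n < α n + d (ell j) * NPP.xi ρ α n := fun n hn j =>
    add_lt_add_right (mul_lt_mul_of_pos_right (hcd _) hn) _
  have hhi : ∀ n, 0 < NPP.xi ρ α n → ∀ j,
      α n + d (ell j) * NPP.xi ρ α n ≤ α n + NPP.xi ρ α n * ∑ l, d l := fun n hn j => by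
    rw [mul_comm (d _)]
    exact add_le_add_right (mul_le_mul_of_nonneg_left (hwD _) hn.le) _
  constructor
  · obtain ⟨r, R, q, hr, hR, hq, hsaddle⟩ := hρ.exists_saddle k
    refine ⟨r, hr, fun ε hε => ?_⟩
    filter_upwards [hreg.energy_mem hρ hα0 hα hw0 hw hε, hreg.overlaps q hq, hξ,
      (NPP.tendsto_div_sqrt hα).eventually_lt_const hR, eventually_gt_atTop 0]
      with n hn hov hξn hx hn0 σ hσ
    choose η hηr hηs huniq hθ hgrad hact using fun s : Fin k → ℤˣ =>
      hsaddle n hn0 σ (hov σ hσ) (NPP.corner α n s) ((NPP.norm_corner_le (hα0 n) s).trans_lt hx)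
    refine ⟨η, fun s => NPP.tiltExponent ρ σ (NPP.corner α n s) ((2 * Real.pi) • η s),
      fun s => ⟨hηr s, hηs s⟩, huniq, fun s => (hact s).symm, ?_⟩
    have hmain := hn σ hσ _ (fun s => ⟨hθ s, hgrad s⟩) _ _ (hlo n hξn)
      (fun j => (hlohi n hξn j).le) (hhi n hξn)
    have hprod : (∏ j : Fin k, (α n + d (ell j) * NPP.xi ρ α n - (α n + c (ell j) * NPP.xi ρ α n)))
        * (√(2 * Real.pi) ^ k)⁻¹ =
        (∏ l, (d l - c l) ^ kk l) * (NPP.xi ρ α n / √(2 * Real.pi)) ^ k := by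
      -- Grouping the factors by the value of ℓ(j) produces the exponents k_ℓ.
      have h1 : ∏ l, (d l - c l) ^ kk l = ∏ j, (d (ell j) - c (ell j)) := by
        rw [← Finset.prod_fiberwise Finset.univ ell]
        refine Finset.prod_congr rfl fun l _ => ?_
        rw [← hkk l, Fintype.card_subtype, ← Finset.prod_const]
        exact Finset.prod_congr rfl fun j hj => by rw [(Finset.mem_filter.1 hj).2]
      have h2 : ∀ j, α n + d (ell j) * NPP.xi ρ α n - (α n + c (ell j) * NPP.xi ρ α n) =
          (d (ell j) - c (ell j)) * NPP.xi ρ α n := fun j => by ring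
      simp_rw [h2]
      rw [h1, Finset.prod_mul_distrib, Finset.prod_const, Finset.card_univ, Fintype.card_fin,
        div_pow, div_eq_mul_inv, mul_assoc]
    rw [hprod] at hmain
    exact hmain
  · intro hα'
    obtain ⟨C, hC⟩ := hreg.log_energy_mem hρ hα0 hα hα' hw0 hw
    -- The one-configuration case has no pairs, so it can be used with q = 0 and its constant C₁
    -- drops out. Each of the k factors is then allowed an error ε/(2(k+1)).
    obtain ⟨C₁, hC₁⟩ := NPP.uniformRegime_one.log_energy_mem hρ hα0 hα hα' hw0 hw
    refine ⟨C, fun ε hε => ?_⟩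
    filter_upwards [hC (ε / 2) (by positivity), hC₁ (ε / (2 * (k + 1))) (by positivity), hξ,
      hreg.overlaps 1 one_pos] with n hn hn₁ hξn hov σ hσ
    obtain ⟨hP0', hP⟩ := hn σ hσ (NPP.qMax σ) (NPP.qMax_nonneg σ)
      (NPP.qMax_le zero_le_one (hov σ hσ)) (fun j l h => NPP.abs_overlap_le_qMax σ h) _ _
      (hlo n hξn) (hlohi n hξn) (hhi n hξn)
    have hP0 : 0 < (NPP.law ρ n).real
        {X | ∀ j, NPP.energy (σ j) X ∈ NPP.window ρ α n (c (ell j)) (d (ell j))} := hP0'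
    have hsingle : ∀ j, 0 < (NPP.law ρ n).real
          {X | NPP.energy (σ j) X ∈ NPP.window ρ α n (c (ell j)) (d (ell j))} ∧
        |Real.log ((NPP.law ρ n).real
          {X | NPP.energy (σ j) X ∈ NPP.window ρ α n (c (ell j)) (d (ell j))}) -
          (Real.log (α n + d (ell j) * NPP.xi ρ α n - (α n + c (ell j) * NPP.xi ρ α n)) +
            (Real.log (2 / √(2 * Real.pi)) - α n ^ 2 / 2))| ≤ ε / (2 * (k + 1)) := by
      intro j
      have h1 := hn₁ _ rfl 0 le_rfl zero_le_one (fun i l h => absurd (Subsingleton.elim i l) h)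
        (fun _ => α n + c (ell j) * NPP.xi ρ α n) (fun _ => α n + d (ell j) * NPP.xi ρ α n)
        (fun _ => hlo n hξn j) (fun _ => hlohi n hξn j) (fun _ => hhi n hξn j)
      simp only [Fin.forall_fin_one, Fin.sum_univ_one, mul_zero, zero_add] at h1
      rw [hρ.law_real_energy_mem_eq (σ j)
        (J := NPP.window ρ α n (c (ell j)) (d (ell j))) measurableSet_Icc]
      exact h1
    have hsum : |∑ j, (Real.log ((NPP.law ρ n).real
          {X | NPP.energy (σ j) X ∈ NPP.window ρ α n (c (ell j)) (d (ell j))}) -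
          (Real.log (α n + d (ell j) * NPP.xi ρ α n - (α n + c (ell j) * NPP.xi ρ α n)) +
            (Real.log (2 / √(2 * Real.pi)) - α n ^ 2 / 2)))| ≤ ε / 2 := by
      calc _ ≤ ∑ _j : Fin k, ε / (2 * (k + 1)) :=
            (Finset.abs_sum_le_sum_abs _ _).trans (Finset.sum_le_sum fun j _ => (hsingle j).2)
        _ = k * (ε / (2 * (k + 1))) := by simp
        _ ≤ ε / 2 := by
            rw [← mul_div_assoc, div_le_div_iff₀ (by positivity) (by positivity)]
            linarith
    rw [Finset.sum_sub_distrib, ← Real.log_prod fun j _ => (hsingle j).1.ne'] at hsum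
    have hprod0 : 0 < ∏ j, (NPP.law ρ n).real
        {X | NPP.energy (σ j) X ∈ NPP.window ρ α n (c (ell j)) (d (ell j))} :=
      Finset.prod_pos fun j _ => (hsingle j).1
    -- Both logarithms share the same leading sum over j, so θ is bounded by the two errors, each
    -- with at most ε/2 besides the overlap term.
    refine ⟨Real.log ((NPP.law ρ n).real
      {X | ∀ j, NPP.energy (σ j) X ∈ NPP.window ρ α n (c (ell j)) (d (ell j))}) -
      Real.log (∏ j, (NPP.law ρ n).real
        {X | NPP.energy (σ j) X ∈ NPP.window ρ α n (c (ell j)) (d (ell j))}), ?_, ?_⟩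
    · have h1 := abs_le.1 hP
      have h2 := abs_le.1 hsum
      simp only [NPP.window] at h1 h2 ⊢
      rw [abs_le]
      constructor <;> linarith [h1.1, h1.2, h2.1, h2.2]
    · rw [Real.exp_sub, Real.exp_log hP0, Real.exp_log hprod0, mul_div_cancel₀ _ hprod0.ne']
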